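/- Let $q,p>0$, $\Omega=(0,q)\times(0,p)$, $0<\beta<1$, $\alpha=1$, $\gamma=\beta$, $a<0$, $b<0$, $\delta<0$. Put $E_{\alpha,\mu}^{\nu}(z)=\sum_{m\ge0}\frac{(\nu)_m}{\Gamma(\alpha m+\mu)}\frac{z^m}{m!}$, where $(\nu)_m$ is the rising factorial, and, for a function $y$ on $[0,q]$, let $$Dy(t)=\frac{d}{dt}\int_0^t (t-\xi)^{-\beta}E_{\alpha,1-\beta}^{-\gamma}\big(\delta(t-\xi)^{\alpha}\big)\,\big(y(\xi)-y(0)\big)\,d\xi$$ be its (regularized) Caputo–Prabhakar derivative; for absolutely continuous $y$ it equals $\int_0^t (t-\xi)^{-\beta}E_{\alpha,1-\beta}^{-\gamma}(\delta(t-\xi)^{\alpha})\,y'(\xi)\,d\xi$. Problem $N$: find $u$ with $$\partial_x Du-a\,\partial_x u-b\,Du=f\ \text{ in }\Omega,\qquad u(t,0)=\varphi(t)\ (0\le t\le q),\qquad u(0,x)-\int_0^q M(t)u(t,x)\,dt=\psi(x)\ (0\le x\le p),$$ where $D$ acts in $t$. A solution is regular if $u\in C(\overline\Omega)$, $u_x\in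 C(\Omega)$ and $Du\in C(\Omega)$. Let $$E(t)=\sum_{m,k\ge0}\frac{\Gamma(\gamma m+k+\gamma)}{\Gamma(\gamma)\Gamma(\beta m+\alpha k+\beta+1)}\frac{(at^\beta)^m}{\Gamma(\gamma m+\gamma)}\frac{(\delta t^{\alpha})^k}{k!},$$ $$F_{\sigma}^{\kappa,\lambda,\mu}(t,x)=\sum_{m,j,k\ge0}\frac{\Gamma(\gamma m+k+\gamma)\,\Gamma(m+j+\kappa)\,(at^\beta)^m(bx)^j(\delta t^{\alpha})^k}{\Gamma(\beta m+\alpha k+\sigma)\Gamma(\gamma m+\gamma)\Gamma(m+\lambda)\,\Gamma(k+1)\,\Gamma(j+1)\Gamma(j+\mu)},$$ and $F_1=F_{\beta+1}^{2,2,1}$, $F_2=F_{\beta+1}^{2,1,2}$, $F_3=F_{\beta}^{2,2,2}$, $F_4=F_{\beta}^{1,1,1}$ (these are bivariate and trivariate Mittag-Leffler type functions). Let $$A=1-\int_0^q M(t)\big(1+a\Gamma(\gamma)t^\beta E(t)\big)dt,\qquad M_1(\xi,x)=\int_0^q M(t)t^\beta F_2(t,x-\xi)\,dt,$$ $$g(x)=\psi(x)+e^{bx}\int_0^q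 M(t)(\varphi(t)-\varphi(0))dt-a\varphi(0)\int_0^q M(t)t^\beta F_1(t,x)\,dt$$ $$+\,abx\int_0^q\varphi(\eta)\int_\eta^q M(t)(t-\eta)^{\beta-1}F_3(t-\eta,x)\,dt\,d\eta+\int_0^q M(t)\int_0^t\int_0^x (t-\eta)^{\beta-1}f(\eta,\xi)F_4(t-\eta,x-\xi)\,d\xi\,d\eta\,dt.$$ Assume $\varphi\in C[0,q]\cap C^1(0,q)$, $\psi\in C[0,p]\cap C^1(0,p)$, $M\in C[0,q]$, $f(t,x)=t^{-\varepsilon_1}x^{-\varepsilon_2}\widetilde f(t,x)$ in $\Omega$ with $\widetilde f\in C(\overline\Omega)$, $0\le\varepsilon_1<\beta$, $0\le\varepsilon_2<1$, and $\varphi(0)-\int_0^q M(t)\varphi(t)\,dt=\psi(0)$. Assume $A\neq0$, put $M_2=M_1/A$ and $G=g/A$, and assume $\varphi(0)=G(0)$. Then Problem $N$ has exactly one regular solution, and for $(t,x)\in\overline\Omega$ it is given by $$u(t,x)=\tau(x)+(\varphi(t)-\varphi(0))e^{bx}+a\Gamma(\gamma)t^\beta\tau(x)E(t)-a\varphi(0)t^\beta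 F_1(t,x)+ab\,t^\beta\int_0^x\tau(\xi)F_2(t,x-\xi)\,d\xi$$ $$+\,abx\int_0^t(t-\eta)^{\beta-1}\varphi(\eta)F_3(t-\eta,x)\,d\eta+\int_0^t\int_0^x(t-\eta)^{\beta-1}f(\eta,\xi)F_4(t-\eta,x-\xi)\,d\xi\,d\eta,$$ where $\tau(x)=u(0,x)$, $\tau\in C[0,p]\cap C^1(0,p)$, is the unique continuous solution on $[0,p]$ of the second-kind Volterra equation $$\tau(x)-ab\int_0^x\tau(\xi)M_2(\xi,x)\,d\xi=G(x).$$ -/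

import Mathlib

open MeasureTheory Set

/-- The three-parameter Mittag-Leffler (Prabhakar) function
`E_{α,β}^γ(z) = ∑ₘ (γ)ₘ / Γ(α m + β) * zᵐ / m!`, with `(γ)ₘ` the rising factorial. -/
noncomputable def prabhakarML (α β γ z : ℝ) : ℝ :=
  ∑' m : ℕ, (ascPochhammer ℝ m).eval γ / Real.Gamma (α * m + β) * (z ^ m / (m.factorial : ℝ))

/-- The Prabhakar fractional integral
`(ᴾI_{0t}^{α,β,γ,δ} y)(t) = ∫₀ᵗ (t-ξ)^{β-1} E_{α,β}^γ(δ (t-ξ)^α) y(ξ) dξ`. -/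
noncomputable def prabhakarIntegral (α β γ δ : ℝ) (y : ℝ → ℝ) (t : ℝ) : ℝ :=
  ∫ ξ in (0 : ℝ)..t, (t - ξ) ^ (β - 1) * prabhakarML α β γ (δ * (t - ξ) ^ α) * y ξ

/-- For `0 < β < 1`: the function `ᴾI_{0t}^{α,1-β,-γ,δ} (y - y(0))`, whose derivative is the
Caputo-Prabhakar (regularized Prabhakar) derivative of `y`. -/
noncomputable def caputoPrabhakarPrimitive (α β γ δ : ℝ) (y : ℝ → ℝ) (t : ℝ) : ℝ :=
  prabhakarIntegral α (1 - β) (-γ) δ (fun ξ => y ξ - y 0) t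

/-- The Caputo-Prabhakar derivative of order `0 < β < 1`, in the regularized form
`(d/dt) ᴾI_{0t}^{α,1-β,-γ,δ} (y - y(0))`. For absolutely continuous `y` this is
`ᴾI_{0t}^{α,1-β,-γ,δ} (dy/dt)`; unlike the latter expression it also makes sense for
continuous `y` that have no pointwise derivative. -/
noncomputable def caputoPrabhakarDeriv (α β γ δ : ℝ) (y : ℝ → ℝ) (t : ℝ) : ℝ :=
  deriv (caputoPrabhakarPrimitive α β γ δ y) t

/-- The bivariate Mittag-Leffler type function
`E₂(α₁,β₁,γ₁; α₂,γ₂; α₃,β₂,δ₁; α₄,δ₂; β₃,δ₃ | x, y)`. The summation indices are `(m, k)`. -/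
noncomputable def bivariateML
    (α₁ β₁ γ₁ α₂ γ₂ α₃ β₂ δ₁ α₄ δ₂ β₃ δ₃ x y : ℝ) : ℝ :=
  ∑' i : ℕ × ℕ,
    (Real.Gamma (α₁ * i.1 + β₁ * i.2 + γ₁) * Real.Gamma (α₂ * i.1 + γ₂)) /
      (Real.Gamma γ₁ * Real.Gamma γ₂ * Real.Gamma (α₃ * i.1 + β₂ * i.2 + δ₁)) *
      (x ^ i.1 / Real.Gamma (α₄ * i.1 + δ₂)) * (y ^ i.2 / Real.Gamma (β₃ * i.2 + δ₃))

/-- The trivariate Mittag-Leffler type function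
`F_E⁽³⁾(α₁,β₁,δ₁; α₂,γ₁,δ₂; α₃,β₂,δ₃; α₄,δ₄; α₅,δ₅; β₃,δ₆; γ₂,δ₇; γ₃,δ₈ | x; y; z)`.
The summation indices are `(m, j, k)`, the exponents of `x`, `y`, `z`. -/
noncomputable def trivariateML
    (α₁ β₁ δ₁ α₂ γ₁ δ₂ α₃ β₂ δ₃ α₄ δ₄ α₅ δ₅ β₃ δ₆ γ₂ δ₇ γ₃ δ₈ x y z : ℝ) : ℝ :=
  ∑' i : ℕ × ℕ × ℕ,
    (Real.Gamma (α₁ * i.1 + β₁ * i.2.2 + δ₁) * Real.Gamma (α₂ * i.1 + γ₁ * i.2.1 + δ₂) *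
        (x ^ i.1 * y ^ i.2.1 * z ^ i.2.2)) /
      (Real.Gamma (α₃ * i.1 + β₂ * i.2.2 + δ₃) * Real.Gamma (α₄ * i.1 + δ₄) *
        Real.Gamma (α₅ * i.1 + δ₅) * Real.Gamma (β₃ * i.2.2 + δ₆) *
        Real.Gamma (γ₂ * i.2.1 + δ₇) * Real.Gamma (γ₃ * i.2.1 + δ₈))

/-- The data (parameters and given functions, no assumptions) of the nonlocal problem
`∂ₓ D u - a ∂ₓ u - b D u = f` in `0 < t < q`, `0 < x < p`, where `D` is the Caputo-Prabhakar
derivative in `t` with parameters `α, β, γ, δ`, with the conditions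
`u(t,0) = φ(t)` and `u(0,x) - ∫₀^q M(t) u(t,x) dt = ψ(x)`. -/
structure TelegraphProblem where
  (α β γ δ a b q p : ℝ)
  (φ ψ M : ℝ → ℝ)
  (f : ℝ → ℝ → ℝ)

namespace TelegraphProblem

/-- The open rectangle `Ω = {(t,x) : 0 < t < q, 0 < x < p}`. -/
def domain (P : TelegraphProblem) : Set (ℝ × ℝ) := Ioo 0 P.q ×ˢ Ioo 0 P.p

/-- The closed rectangle. -/
def closedDomain (P : TelegraphProblem) : Set (ℝ × ℝ) := Icc 0 P.q ×ˢ Icc 0 P.p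

/-- The Caputo-Prabhakar derivative of `u` in the first variable `t`, at the point `(t, x)`. -/
noncomputable def D (P : TelegraphProblem) (u : ℝ → ℝ → ℝ) (t x : ℝ) : ℝ :=
  caputoPrabhakarDeriv P.α P.β P.γ P.δ (fun s => u s x) t

/-- `u` is a regular solution of the nonlocal problem: `u ∈ C(closure Ω)`, `uₓ ∈ C(Ω)`,
`D u ∈ C(Ω)` (with all derivatives that occur existing), the equation holds in `Ω`, and both
conditions hold. -/
structure IsRegularSolution (P : TelegraphProblem) (u : ℝ → ℝ → ℝ) : Prop where
  continuousOn : ContinuousOn (fun z : ℝ × ℝ => u z.1 z.2) P.closedDomain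
  differentiable_x : ∀ z ∈ P.domain, DifferentiableAt ℝ (fun y => u z.1 y) z.2
  continuousOn_deriv_x :
    ContinuousOn (fun z : ℝ × ℝ => deriv (fun y => u z.1 y) z.2) P.domain
  differentiable_primitive : ∀ z ∈ P.domain,
    DifferentiableAt ℝ (caputoPrabhakarPrimitive P.α P.β P.γ P.δ (fun s => u s z.2)) z.1
  continuousOn_D : ContinuousOn (fun z : ℝ × ℝ => P.D u z.1 z.2) P.domain
  differentiable_D_x : ∀ z ∈ P.domain, DifferentiableAt ℝ (fun y => P.D u z.1 y) z.2
  equation : ∀ z ∈ P.domain,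
    deriv (fun y => P.D u z.1 y) z.2 - P.a * deriv (fun y => u z.1 y) z.2
      - P.b * P.D u z.1 z.2 = P.f z.1 z.2
  boundary : ∀ t ∈ Icc 0 P.q, u t 0 = P.φ t
  nonlocal : ∀ x ∈ Icc 0 P.p, u 0 x - ∫ t in (0 : ℝ)..P.q, P.M t * u t x = P.ψ x

/-- `E₂(γ,1,γ; 0,1; β,α,β+1; γ,γ; 1,1 | a t^β, δ t^α)`. -/
noncomputable def kernelE (P : TelegraphProblem) (t : ℝ) : ℝ :=
  bivariateML P.γ 1 P.γ 0 1 P.β P.α (P.β + 1) P.γ P.γ 1 1 (P.a * t ^ P.β) (P.δ * t ^ P.α)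

/-- `F_E⁽³⁾(γ,1,γ; 1,1,2; β,α,β+1; γ,γ; 1,2; 1,1; 1,1; 1,1 | a t^β; b x; δ t^α)`. -/
noncomputable def kernelF₁ (P : TelegraphProblem) (t x : ℝ) : ℝ :=
  trivariateML P.γ 1 P.γ 1 1 2 P.β P.α (P.β + 1) P.γ P.γ 1 2 1 1 1 1 1 1
    (P.a * t ^ P.β) (P.b * x) (P.δ * t ^ P.α)

/-- `F_E⁽³⁾(γ,1,γ; 1,1,2; β,α,β+1; γ,γ; 1,1; 1,1; 1,1; 1,2 | a t^β; b x; δ t^α)`. -/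
noncomputable def kernelF₂ (P : TelegraphProblem) (t x : ℝ) : ℝ :=
  trivariateML P.γ 1 P.γ 1 1 2 P.β P.α (P.β + 1) P.γ P.γ 1 1 1 1 1 1 1 2
    (P.a * t ^ P.β) (P.b * x) (P.δ * t ^ P.α)

/-- `F_E⁽³⁾(γ,1,γ; 1,1,2; β,α,β; γ,γ; 1,2; 1,1; 1,1; 1,2 | a t^β; b x; δ t^α)`. -/
noncomputable def kernelF₃ (P : TelegraphProblem) (t x : ℝ) : ℝ :=
  trivariateML P.γ 1 P.γ 1 1 2 P.β P.α P.β P.γ P.γ 1 2 1 1 1 1 1 2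
    (P.a * t ^ P.β) (P.b * x) (P.δ * t ^ P.α)

/-- `F_E⁽³⁾(γ,1,γ; 1,1,1; β,α,β; γ,γ; 1,1; 1,1; 1,1; 1,1 | a t^β; b x; δ t^α)`. -/
noncomputable def kernelF₄ (P : TelegraphProblem) (t x : ℝ) : ℝ :=
  trivariateML P.γ 1 P.γ 1 1 1 P.β P.α P.β P.γ P.γ 1 1 1 1 1 1 1 1
    (P.a * t ^ P.β) (P.b * x) (P.δ * t ^ P.α)

/-- The representation formula of the solution of the Goursat problem with
`u(t,0) = φ(t)` and `u(0,x) = τ(x)`. -/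
noncomputable def goursat (P : TelegraphProblem) (τ : ℝ → ℝ) (t x : ℝ) : ℝ :=
  τ x + (P.φ t - P.φ 0) * Real.exp (P.b * x)
    + P.a * Real.Gamma P.γ * t ^ P.β * τ x * P.kernelE t
    - P.a * P.φ 0 * t ^ P.β * P.kernelF₁ t x
    + P.a * P.b * t ^ P.β * (∫ ξ in (0 : ℝ)..x, τ ξ * P.kernelF₂ t (x - ξ))
    + P.a * P.b * x *
        (∫ η in (0 : ℝ)..t, (t - η) ^ (P.β - 1) * P.φ η * P.kernelF₃ (t - η) x)
    + ∫ η in (0 : ℝ)..t, ∫ ξ in (0 : ℝ)..x,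
        (t - η) ^ (P.β - 1) * P.f η ξ * P.kernelF₄ (t - η) (x - ξ)

/-- The coefficient of `τ(x)` when the representation formula is inserted into the nonlocal
condition: `A = 1 - ∫₀^q M(t) (1 + a Γ(γ) t^β E₂(…)) dt`. -/
noncomputable def A (P : TelegraphProblem) : ℝ :=
  1 - ∫ t in (0 : ℝ)..P.q,
    P.M t * (1 + P.a * Real.Gamma P.γ * t ^ P.β * P.kernelE t)

/-- `M₁(ξ,x) = ∫₀^q M(t) t^β F_E⁽³⁾(… | a t^β; b (x-ξ); δ t^α) dt`. -/
noncomputable def M₁ (P : TelegraphProblem) (ξ x : ℝ) : ℝ :=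
  ∫ t in (0 : ℝ)..P.q, P.M t * t ^ P.β * P.kernelF₂ t (x - ξ)

/-- All terms free of `τ` when the representation formula is inserted into the nonlocal
condition. -/
noncomputable def g (P : TelegraphProblem) (x : ℝ) : ℝ :=
  P.ψ x + Real.exp (P.b * x) * (∫ t in (0 : ℝ)..P.q, P.M t * (P.φ t - P.φ 0))
    - P.a * P.φ 0 * (∫ t in (0 : ℝ)..P.q, P.M t * t ^ P.β * P.kernelF₁ t x)
    + P.a * P.b * x * (∫ η in (0 : ℝ)..P.q, P.φ η *
        ∫ t in η..P.q, P.M t * (t - η) ^ (P.β - 1) * P.kernelF₃ (t - η) x)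
    + ∫ t in (0 : ℝ)..P.q, P.M t * ∫ η in (0 : ℝ)..t, ∫ ξ in (0 : ℝ)..x,
        (t - η) ^ (P.β - 1) * P.f η ξ * P.kernelF₄ (t - η) (x - ξ)

/-- The kernel `M₂ = M₁ / A`. -/
noncomputable def M₂ (P : TelegraphProblem) (ξ x : ℝ) : ℝ := P.M₁ ξ x / P.A

/-- The free term `G = g / A`. -/
noncomputable def G (P : TelegraphProblem) (x : ℝ) : ℝ := P.g x / P.A

/-- `τ ∈ C[0,p]` solves the second-kind Volterra equation
`τ(x) - a b ∫₀ˣ τ(ξ) M₂(ξ,x) dξ = G(x)` on `[0,p]`. -/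
def SolvesVolterra (P : TelegraphProblem) (τ : ℝ → ℝ) : Prop :=
  ContinuousOn τ (Icc 0 P.p) ∧
    ∀ x ∈ Icc 0 P.p,
      τ x - P.a * P.b * (∫ ξ in (0 : ℝ)..x, τ ξ * P.M₂ ξ x) = P.G x

end TelegraphProblem

open scoped BoundedContinuousFunction

/-! ### Euler's beta integral over the reals -/

/-! For `α = 1`, `γ = β` the Prabhakar kernel has Laplace transform `(s - δ) ^ β / s`. Let `K` be
convolution in `t` with this kernel, `I` convolution with `r ^ (β - 1) exp (δ r) / Γ(β)`, and `J`,
`X` integration from `0` in `t` and `x`. Then `I K = K I = J` (`integral_tempered_mul_prabhakar`),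
so `I` inverts the Caputo-Prabhakar derivative. All operators act on bounded continuous functions on
the plane, with arguments clamped to the rectangle.

Put `V(t,x) = u(t,x) - u(0,x)`. Integrating the equation over rectangles and cancelling the
injective `K` turns the problem into `(1 - a I - b X) V = load`, with a right side explicit in `φ`,
`u(0,·)` and `f` (`load_of_isRegularSolution`). `I` and `X` commute and are quasi-nilpotent, because
powers of a convolution gain Gamma functions or factorials in the denominator. Hence `1 - a I - b X`
has the two-sided inverse `N = ∑ C(m+j,m) a^m b^j I^m X^j`. The powers are explicit convolutions,
and `N` applied to each term of `load` sums to one of the Mittag-Leffler kernels (`N_one`, `N_X`,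
`N_I`, `N_source`). So every regular solution equals `goursat (u 0)`.

Conversely, `goursat τ` is regular when `τ` is `C¹` inside and `τ 0 = φ 0`. Inverting only `1 - a I`
leaves, besides `φ(t)`, products with `τ(x)` and integrals in `x`, which gives `u_x`. Inverting only
`1 - b X` leaves integrals in `t` and the convolution of `φ - φ(0)` with the Prabhakar kernel, which
is `C¹` inside by `contDiff_conv`; this gives `D u` and the equation.

Finally, integrating the formula against `M` shows that the nonlocal condition is the Volterra
equation for `τ` (`nonlocal_iff`). Its kernel is continuous and depends on `x - ξ` only, so its
operator is quasi-nilpotent and `τ` is unique. At `x = 0` the equation reads `τ 0 = G 0 = φ 0`. -/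

theorem intervalIntegrable_beta {s r : ℝ} (hs : 0 < s) (hr : 0 < r) :
    IntervalIntegrable (fun θ : ℝ => (1 - θ) ^ (s - 1) * θ ^ (r - 1)) volume 0 1 := by
  have h := (Complex.betaIntegral_convergent (u := (r : ℂ)) (v := (s : ℂ))
    (by simpa using hr) (by simpa using hs)).norm
  refine h.congr fun θ hθ => ?_
  rw [uIoc_of_le zero_le_one] at hθ
  have h1 : (0 : ℝ) ≤ 1 - θ := by linarith [hθ.2]
  have e1 : ((θ : ℂ)) ^ ((r : ℂ) - 1) = ((θ ^ (r - 1) : ℝ) : ℂ) := by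
    rw [Complex.ofReal_cpow hθ.1.le]; push_cast; rfl
  have e2 : (1 - (θ : ℂ)) ^ ((s : ℂ) - 1) = (((1 - θ) ^ (s - 1) : ℝ) : ℂ) := by
    rw [Complex.ofReal_cpow h1]; push_cast; rfl
  simp only [e1, e2]
  rw [← Complex.ofReal_mul, Complex.norm_real, Real.norm_of_nonneg, mul_comm]
  exact mul_nonneg (Real.rpow_nonneg hθ.1.le _) (Real.rpow_nonneg h1 _)

theorem integral_beta {s r : ℝ} (hs : 0 < s) (hr : 0 < r) :
    ∫ θ in (0 : ℝ)..1, (1 - θ) ^ (s - 1) * θ ^ (r - 1)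
      = Real.Gamma s * Real.Gamma r / Real.Gamma (s + r) := by
  have h := Complex.betaIntegral_eq_Gamma_mul_div (r : ℂ) (s : ℂ)
    (by simpa using hr) (by simpa using hs)
  rw [← Complex.ofReal_add, Complex.Gamma_ofReal, Complex.Gamma_ofReal, Complex.Gamma_ofReal,
    Complex.betaIntegral] at h
  have h2 : ∫ x in (0 : ℝ)..1, ((x : ℂ)) ^ ((r : ℂ) - 1) * (1 - (x : ℂ)) ^ ((s : ℂ) - 1)
      = ((∫ θ in (0 : ℝ)..1, (1 - θ) ^ (s - 1) * θ ^ (r - 1) : ℝ) : ℂ) := by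
    rw [← intervalIntegral.integral_ofReal]
    refine intervalIntegral.integral_congr fun θ hθ => ?_
    rw [uIcc_of_le zero_le_one] at hθ
    have h1 : (0 : ℝ) ≤ 1 - θ := by linarith [hθ.2]
    rw [Complex.ofReal_mul, Complex.ofReal_cpow hθ.1, Complex.ofReal_cpow h1]
    push_cast
    ring
  rw [h2] at h
  rw [mul_comm (Real.Gamma s), add_comm s r]
  exact_mod_cast h

/-- Rescaling `v = u θ` of an integral over `[0, u]`. -/
theorem integral_rescale (F : ℝ → ℝ) (u : ℝ) :
    ∫ v in (0 : ℝ)..u, F v = u * ∫ θ in (0 : ℝ)..1, F (u * θ) := by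
  rw [intervalIntegral.mul_integral_comp_mul_left]; simp

/-! ### Clamping to an interval -/

/-- The projection of `ℝ` to `[0, q]`. -/
noncomputable def clamp (q t : ℝ) : ℝ := max 0 (min q t)

theorem clamp_nonneg (q t : ℝ) : 0 ≤ clamp q t := le_max_left _ _

theorem clamp_le (q t : ℝ) : clamp q t ≤ max q 0 := by
  unfold clamp
  exact max_le (le_max_right _ _) ((min_le_left _ _).trans (le_max_left _ _))

theorem clamp_mem {q : ℝ} (hq : 0 ≤ q) (t : ℝ) : clamp q t ∈ Icc 0 q :=
  ⟨clamp_nonneg q t, (clamp_le q t).trans (by simp [hq])⟩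

theorem clamp_of_mem {q t : ℝ} (ht : t ∈ Icc 0 q) : clamp q t = t := by
  simp [clamp, ht.1, ht.2]

@[simp] theorem clamp_clamp (q t : ℝ) : clamp q (clamp q t) = clamp q t := by
  unfold clamp
  rcases le_total q 0 with h | h
  · have h1 : min q t ≤ 0 := (min_le_left _ _).trans h
    rw [max_eq_left h1, max_eq_left (min_le_of_left_le h)]
  · rw [min_eq_right (max_le h (min_le_left _ _))]
    simp

@[fun_prop] theorem continuous_clamp (q : ℝ) : Continuous (clamp q) := by
  unfold clamp; fun_prop

@[simp] theorem clamp_zero {q : ℝ} (hq : 0 ≤ q) : clamp q 0 = 0 := clamp_of_mem ⟨le_rfl, hq⟩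

/-! ### Weakly singular convolution kernels -/

/-- The data of a weakly singular convolution with kernel `r ^ (s - 1) * e r` against functions
with weight `r ^ (-ε)`. -/
structure WeakKernel where
  s : ℝ
  ε : ℝ
  e : ℝ → ℝ
  s_pos : 0 < s
  ε_nonneg : 0 ≤ ε
  ε_lt_one : ε < 1
  ε_lt_s : ε < s
  cont : Continuous e

namespace WeakKernel

/-- The weakly singular convolution. -/
noncomputable def conv (k : WeakKernel) (y : ℝ → ℝ) (t : ℝ) : ℝ :=
  ∫ η in (0 : ℝ)..t, (t - η) ^ (k.s - 1) * k.e (t - η) * (η ^ (-k.ε) * y η)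

@[simp] theorem conv_zero (k : WeakKernel) (y : ℝ → ℝ) : k.conv y 0 = 0 := by simp [conv]

theorem rescale_weight {s ε t θ : ℝ} (ht : 0 < t) (hθ : θ ∈ Icc (0 : ℝ) 1) (A B : ℝ) :
    t * ((t - t * θ) ^ (s - 1) * A * ((t * θ) ^ (-ε) * B))
      = t ^ (s - ε) * ((1 - θ) ^ (s - 1) * A * (θ ^ (-ε) * B)) := by
  have h1 : (0 : ℝ) ≤ 1 - θ := by linarith [hθ.2]
  rw [show t - t * θ = t * (1 - θ) by ring, Real.mul_rpow ht.le h1, Real.mul_rpow ht.le hθ.1]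
  have : t ^ (s - ε) = t * (t ^ (s - 1) * t ^ (-ε)) := by
    rw [← Real.rpow_add ht]
    nth_rw 2 [← Real.rpow_one t]
    rw [← Real.rpow_add ht]; ring_nf
  rw [this]; ring

/-- The substitution `η = t θ` fixes the interval of integration and collects the powers of `t`.
Since `ε < s`, the prefactor also gives continuity at `t = 0`. -/
theorem conv_eq_rescaled (k : WeakKernel) (y : ℝ → ℝ) {t : ℝ} (ht : 0 ≤ t) :
    k.conv y t = t ^ (k.s - k.ε) * ∫ θ in (0 : ℝ)..1,
      (1 - θ) ^ (k.s - 1) * k.e (t - t * θ) * (θ ^ (-k.ε) * y (t * θ)) := by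
  rcases ht.eq_or_lt with rfl | ht
  · rw [conv_zero, Real.zero_rpow (by linarith [k.ε_lt_s]), zero_mul]
  · rw [conv, integral_rescale, ← intervalIntegral.integral_const_mul,
      ← intervalIntegral.integral_const_mul]
    refine intervalIntegral.integral_congr fun θ hθ => ?_
    rw [uIcc_of_le zero_le_one] at hθ
    exact rescale_weight ht hθ _ _

theorem intervalIntegrable_weight {s ε : ℝ} (hs : 0 < s) (hε : ε < 1) {t : ℝ} (ht : 0 ≤ t) :
    IntervalIntegrable (fun η : ℝ => (t - η) ^ (s - 1) * η ^ (-ε)) volume 0 t := by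
  rcases ht.eq_or_lt with rfl | ht
  · exact IntervalIntegrable.refl
  have h := (intervalIntegrable_beta hs (show 0 < 1 - ε by linarith)).comp_mul_left (c := t⁻¹)
  rw [zero_div, one_div, inv_inv] at h
  refine (h.const_mul (t ^ (s - 1 - ε))).congr fun η hη => ?_
  rw [uIoc_of_le ht.le] at hη
  have h1 : (0 : ℝ) ≤ 1 - t⁻¹ * η := by
    rw [sub_nonneg, inv_mul_le_iff₀ ht]; linarith [hη.2]
  have h2 : t - η = t * (1 - t⁻¹ * η) := by field_simp
  rw [h2, Real.mul_rpow ht.le h1, show (1 - ε - 1) = -ε by ring,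
    Real.mul_rpow (inv_nonneg.2 ht.le) hη.1.le, Real.inv_rpow ht.le,
    show s - 1 - ε = (s - 1) + -ε by ring, Real.rpow_add ht]
  have : t ^ (-ε) ≠ 0 := (Real.rpow_pos_of_pos ht _).ne'
  field_simp

theorem intervalIntegrable_conv (k : WeakKernel) {y : ℝ → ℝ} {t : ℝ} (ht : 0 ≤ t)
    (hy : ContinuousOn y (Icc 0 t)) :
    IntervalIntegrable
      (fun η => (t - η) ^ (k.s - 1) * k.e (t - η) * (η ^ (-k.ε) * y η)) volume 0 t := by
  have hc : ContinuousOn (fun η => k.e (t - η) * y η) (uIcc 0 t) := by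
    rw [uIcc_of_le ht]
    exact (k.cont.comp (by fun_prop)).continuousOn.mul hy
  refine ((intervalIntegrable_weight k.s_pos k.ε_lt_one ht).mul_continuousOn hc).congr
    fun η _ => ?_
  ring

theorem conv_congr (k : WeakKernel) {y z : ℝ → ℝ} {t : ℝ} (ht : 0 ≤ t)
    (h : ∀ η ∈ Icc 0 t, y η = z η) : k.conv y t = k.conv z t := by
  refine intervalIntegral.integral_congr fun η hη => ?_
  rw [uIcc_of_le ht] at hη
  simp only [h η hη]

theorem abs_conv_le (k : WeakKernel) {y : ℝ → ℝ} {t C D : ℝ} (ht : 0 ≤ t)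
    (he : ∀ r ∈ Icc 0 t, |k.e r| ≤ C) (hy : ∀ η ∈ Icc 0 t, |y η| ≤ D) :
    |k.conv y t| ≤ C * D * ∫ η in (0 : ℝ)..t, (t - η) ^ (k.s - 1) * η ^ (-k.ε) := by
  rw [← intervalIntegral.integral_const_mul, ← Real.norm_eq_abs]
  refine intervalIntegral.norm_integral_le_of_norm_le ht (Filter.Eventually.of_forall ?_)
    ((intervalIntegrable_weight k.s_pos k.ε_lt_one ht).const_mul _)
  intro η hη
  have h1 : (0 : ℝ) ≤ t - η := by linarith [hη.2]
  have w1 := Real.rpow_nonneg h1 (k.s - 1)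
  have w2 := Real.rpow_nonneg hη.1.le (-k.ε)
  rw [Real.norm_eq_abs, abs_mul, abs_mul, abs_mul, abs_of_nonneg w1, abs_of_nonneg w2]
  have b1 := he (t - η) ⟨h1, by linarith [hη.1]⟩
  have b2 := hy η ⟨hη.1.le, hη.2⟩
  calc (t - η) ^ (k.s - 1) * |k.e (t - η)| * (η ^ (-k.ε) * |y η|)
      = |k.e (t - η)| * |y η| * ((t - η) ^ (k.s - 1) * η ^ (-k.ε)) := by ring
    _ ≤ C * D * ((t - η) ^ (k.s - 1) * η ^ (-k.ε)) := by
        gcongr; exact (abs_nonneg _).trans b1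

/-- In the rescaled form the integrand is dominated by a multiple of the beta weight, uniformly in
the parameter. The parameter space `Z` lets the upper limit and the function vary together. -/
theorem continuous_conv (k : WeakKernel) {Z : Type*} [TopologicalSpace Z]
    [FirstCountableTopology Z] {q D : ℝ} {y : Z → ℝ → ℝ} {T : Z → ℝ}
    (hT : Continuous T) (hT0 : ∀ z, T z ∈ Icc 0 q)
    (hy : Continuous (fun w : Z × ℝ => y w.1 w.2)) (hD : ∀ z η, |y z η| ≤ D) :
    Continuous (fun z => k.conv (y z) (T z)) := by
  have e0 : (fun z => k.conv (y z) (T z)) = fun z => (T z) ^ (k.s - k.ε) * ∫ θ in (0 : ℝ)..1,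
      (1 - θ) ^ (k.s - 1) * k.e (T z - T z * θ) * (θ ^ (-k.ε) * y z (T z * θ)) :=
    funext fun z => k.conv_eq_rescaled (y z) (hT0 z).1
  rw [e0]
  have hexp : 0 ≤ k.s - k.ε := by linarith [k.ε_lt_s]
  refine (hT.rpow_const fun z => Or.inr hexp).mul ?_
  obtain ⟨C, hC⟩ := isCompact_Icc.exists_bound_of_continuousOn
    (k.cont.continuousOn (s := Icc 0 q))
  have hsub : ∀ z, Continuous fun θ : ℝ => k.e (T z - T z * θ) * y z (T z * θ) := fun z =>
    (k.cont.comp (by fun_prop)).mul (hy.comp (by fun_prop : Continuous fun θ : ℝ => (z, T z * θ)))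
  have hw := intervalIntegrable_weight k.s_pos k.ε_lt_one (t := 1) zero_le_one
  refine intervalIntegral.continuous_of_dominated_interval
    (bound := fun θ => C * D * ((1 - θ) ^ (k.s - 1) * θ ^ (-k.ε))) ?_ ?_ (hw.const_mul _) ?_
  · intro z
    have := hw.mul_continuousOn (hsub z).continuousOn
    refine AEStronglyMeasurable.congr ((intervalIntegrable_iff.1 this).aestronglyMeasurable)
      (Filter.Eventually.of_forall fun θ => ?_)
    simp only; ring
  · intro z
    refine Filter.Eventually.of_forall fun θ hθ => ?_
    rw [uIoc_of_le zero_le_one] at hθ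
    have h1 : (0 : ℝ) ≤ 1 - θ := by linarith [hθ.2]
    have w1 := Real.rpow_nonneg h1 (k.s - 1)
    have w2 := Real.rpow_nonneg hθ.1.le (-k.ε)
    rw [Real.norm_eq_abs, abs_mul, abs_mul, abs_mul, abs_of_nonneg w1, abs_of_nonneg w2]
    have hm : T z - T z * θ ∈ Icc 0 q := by
      have := hT0 z
      constructor <;> nlinarith [this.1, this.2, hθ.1, hθ.2]
    have b1 := hC _ hm
    rw [Real.norm_eq_abs] at b1
    have b2 := hD z (T z * θ)
    calc (1 - θ) ^ (k.s - 1) * |k.e (T z - T z * θ)| * (θ ^ (-k.ε) * |y z (T z * θ)|)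
        = |k.e (T z - T z * θ)| * |y z (T z * θ)| * ((1 - θ) ^ (k.s - 1) * θ ^ (-k.ε)) := by ring
      _ ≤ C * D * ((1 - θ) ^ (k.s - 1) * θ ^ (-k.ε)) := by
          gcongr; exact (abs_nonneg _).trans b1
  · refine Filter.Eventually.of_forall fun θ _ => ?_
    refine (continuous_const.mul (k.cont.comp (by fun_prop))).mul (continuous_const.mul ?_)
    exact hy.comp (by fun_prop : Continuous fun z => (z, T z * θ))

end WeakKernel

/-! ### Interchanging the order of integration -/

/-- This lemma and the next write integrals over the triangle `ζ ≤ η` as integrals over a square,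
where Fubini's theorem is available. -/
theorem integral_Iic_eq_truncated (G : ℝ → ℝ) {η t : ℝ} (hη : η ∈ Icc 0 t) :
    ∫ ζ in (0 : ℝ)..t, (if ζ ≤ η then G ζ else 0) = ∫ ζ in (0 : ℝ)..η, G ζ := by
  rw [← intervalIntegral.integral_indicator (f := G) hη]
  rfl

theorem integral_Ici_eq_truncated (G : ℝ → ℝ) {ζ t : ℝ} (hζ : ζ ∈ Ioc 0 t) :
    ∫ η in (0 : ℝ)..t, (if ζ ≤ η then G η else 0) = ∫ η in ζ..t, G η := by
  have h0 : (fun η => if ζ ≤ η then G η else 0) = (Ici ζ).indicator G := rfl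
  rw [h0, intervalIntegral.integral_of_le (hζ.1.le.trans hζ.2),
    setIntegral_indicator measurableSet_Ici, intervalIntegral.integral_of_le hζ.2,
    ← integral_Icc_eq_integral_Ioc]
  congr 2
  ext η
  simp only [mem_inter_iff, mem_Ioc, mem_Ici, mem_Icc]
  exact ⟨fun h => ⟨h.2, h.1.2⟩, fun h => ⟨⟨hζ.1.trans_le h.1, h.2⟩, h.1⟩⟩

namespace WeakKernel

/-- Tonelli: by rescaling, the inner integral over `ζ` is a constant times `η ^ (s₂ - ε)`, which is
continuous, so only the outer singularity at `η = t` remains. -/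
theorem integrableOn_triangle {s₁ s₂ ε t : ℝ} (h₁ : 0 < s₁) (h₂ : 0 < s₂) (hε₀ : 0 ≤ ε)
    (hε : ε < 1) (hε' : ε < s₂) (ht : 0 ≤ t) :
    IntegrableOn (fun w : ℝ × ℝ => if w.2 ≤ w.1 then
      (t - w.1) ^ (s₁ - 1) * ((w.1 - w.2) ^ (s₂ - 1) * w.2 ^ (-ε)) else 0)
      (Ioc 0 t ×ˢ Ioc 0 t) := by
  have hmeas : Measurable (fun w : ℝ × ℝ => if w.2 ≤ w.1 then
      (t - w.1) ^ (s₁ - 1) * ((w.1 - w.2) ^ (s₂ - 1) * w.2 ^ (-ε)) else 0) := by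
    refine Measurable.ite (measurableSet_le measurable_snd measurable_fst) ?_ measurable_const
    fun_prop
  rw [IntegrableOn, Measure.volume_eq_prod, ← Measure.prod_restrict,
    integrable_prod_iff hmeas.aestronglyMeasurable]
  have key : ∀ η ∈ Ioc 0 t, IntegrableOn (fun ζ : ℝ => if ζ ≤ η then
      (t - η) ^ (s₁ - 1) * ((η - ζ) ^ (s₂ - 1) * ζ ^ (-ε)) else 0) (Ioc 0 t) := by
    intro η hη
    have h0 : (fun ζ : ℝ => if ζ ≤ η then
      (t - η) ^ (s₁ - 1) * ((η - ζ) ^ (s₂ - 1) * ζ ^ (-ε)) else 0) = (Iic η).indicator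
        (fun ζ => (t - η) ^ (s₁ - 1) * ((η - ζ) ^ (s₂ - 1) * ζ ^ (-ε))) := rfl
    rw [h0, IntegrableOn, integrable_indicator_iff measurableSet_Iic, IntegrableOn,
      Measure.restrict_restrict measurableSet_Iic]
    have := ((intervalIntegrable_weight h₂ hε hη.1.le).const_mul ((t - η) ^ (s₁ - 1)))
    rw [intervalIntegrable_iff_integrableOn_Ioc_of_le hη.1.le] at this
    refine this.mono_set ?_
    intro ζ hζ
    exact ⟨hζ.2.1, hζ.1⟩
  refine ⟨(ae_restrict_iff' measurableSet_Ioc).2 (Filter.Eventually.of_forall key), ?_⟩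
  let k : WeakKernel := ⟨s₂, ε, fun _ => 1, h₂, hε₀, hε, hε', continuous_const⟩
  set B : ℝ := ∫ θ in (0 : ℝ)..1, (1 - θ) ^ (s₂ - 1) * 1 * (θ ^ (-ε) * 1) with hB
  have hc : ContinuousOn (fun η : ℝ => η ^ (s₂ - ε) * B) (uIcc 0 t) :=
    ((continuous_id.rpow_const fun _ => Or.inr (by simp; linarith)).mul
      continuous_const).continuousOn
  have hw := (intervalIntegrable_weight h₁ zero_lt_one ht).mul_continuousOn hc
  rw [intervalIntegrable_iff_integrableOn_Ioc_of_le ht] at hw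
  refine IntegrableOn.congr_fun hw ?_ measurableSet_Ioc
  intro η hη
  have hnn : (0 : ℝ) ≤ t - η := by linarith [hη.2]
  have e1 : ∀ ζ ∈ Ioc 0 t, ‖(if ζ ≤ η then
      (t - η) ^ (s₁ - 1) * ((η - ζ) ^ (s₂ - 1) * ζ ^ (-ε)) else 0)‖ = if ζ ≤ η then
      (t - η) ^ (s₁ - 1) * ((η - ζ) ^ (s₂ - 1) * ζ ^ (-ε)) else 0 := by
    intro ζ hζ
    refine Real.norm_of_nonneg ?_
    split_ifs with h
    · have := Real.rpow_nonneg hnn (s₁ - 1)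
      have := Real.rpow_nonneg (sub_nonneg.2 h) (s₂ - 1)
      have := Real.rpow_nonneg hζ.1.le (-ε)
      positivity
    · exact le_rfl
  have e2 := k.conv_eq_rescaled (fun _ => 1) hη.1.le
  simp only [setIntegral_congr_fun measurableSet_Ioc e1]
  rw [← intervalIntegral.integral_of_le ht, integral_Iic_eq_truncated
    (fun ζ => (t - η) ^ (s₁ - 1) * ((η - ζ) ^ (s₂ - 1) * ζ ^ (-ε))) ⟨hη.1.le, hη.2⟩,
    intervalIntegral.integral_const_mul]
  simp only [conv, k, mul_one] at e2
  rw [e2]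
  simp only [hB, neg_zero, Real.rpow_zero, mul_one]

/-- Fubini's theorem for the composition of two weakly singular convolutions. -/
theorem conv_conv (k₁ k₂ : WeakKernel) (h₁ : k₁.ε = 0) {y : ℝ → ℝ} {t : ℝ} (ht : 0 ≤ t)
    (hy : ContinuousOn y (Icc 0 t)) :
    k₁.conv (k₂.conv y) t = ∫ ζ in (0 : ℝ)..t,
      (∫ v in (0 : ℝ)..(t - ζ), (t - ζ - v) ^ (k₁.s - 1) * k₁.e (t - ζ - v) *
        (v ^ (k₂.s - 1) * k₂.e v)) * (ζ ^ (-k₂.ε) * y ζ) := by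
  set F : ℝ → ℝ → ℝ := fun η ζ => (t - η) ^ (k₁.s - 1) * k₁.e (t - η) *
    ((η - ζ) ^ (k₂.s - 1) * k₂.e (η - ζ) * (ζ ^ (-k₂.ε) * y ζ)) with hF
  have hint : IntegrableOn (Function.uncurry fun η ζ => if ζ ≤ η then F η ζ else 0)
      (uIoc 0 t ×ˢ uIoc 0 t) := by
    rw [uIoc_of_le ht]
    have hc : ContinuousOn (fun w : ℝ × ℝ => k₁.e (t - w.1) * k₂.e (w.1 - w.2) * y w.2)
        (Icc 0 t ×ˢ Icc 0 t) := by
      refine ContinuousOn.mul ?_ (hy.comp continuousOn_snd fun w hw => hw.2)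
      exact ((k₁.cont.comp (by fun_prop)).mul (k₂.cont.comp (by fun_prop))).continuousOn
    refine ((integrableOn_triangle k₁.s_pos k₂.s_pos k₂.ε_nonneg k₂.ε_lt_one k₂.ε_lt_s
      ht).mul_continuousOn_of_subset hc (measurableSet_Ioc.prod measurableSet_Ioc)
      (isCompact_Icc.prod isCompact_Icc)
      (prod_mono Ioc_subset_Icc_self Ioc_subset_Icc_self)).congr_fun ?_
      (measurableSet_Ioc.prod measurableSet_Ioc)
    rintro ⟨η, ζ⟩ -
    simp only [Function.uncurry, hF]
    split_ifs
    · ring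
    · simp
  have e1 : k₁.conv (k₂.conv y) t = ∫ η in (0 : ℝ)..t, ∫ ζ in (0 : ℝ)..t,
      if ζ ≤ η then F η ζ else 0 := by
    refine intervalIntegral.integral_congr fun η hη => ?_
    rw [uIcc_of_le ht] at hη
    -- `k₁.ε = 0` means that no weight stands between the two kernels, so they combine into a
    -- function of `t - ζ`.
    rw [integral_Iic_eq_truncated (F η) hη, hF, h₁]
    simp only [neg_zero, Real.rpow_zero, one_mul, conv]
    rw [intervalIntegral.integral_const_mul]
  rw [e1, intervalIntegral_intervalIntegral_swap hint]
  refine intervalIntegral.integral_congr_ae (Filter.Eventually.of_forall fun ζ hζ => ?_)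
  rw [uIoc_of_le ht] at hζ
  rw [integral_Ici_eq_truncated (fun η => F η ζ) hζ, ← intervalIntegral.integral_mul_const]
  have := intervalIntegral.integral_comp_add_right (a := 0) (b := t - ζ) (fun η => F η ζ) ζ
  rw [zero_add, sub_add_cancel] at this
  rw [← this]
  refine intervalIntegral.integral_congr fun v _ => ?_
  simp only [hF, add_sub_cancel_right]
  rw [show t - (v + ζ) = t - ζ - v by ring]
  ring

/-- Two weakly singular convolutions in different variables commute. -/
theorem conv_conv_swap (k₁ k₂ : WeakKernel) {y : ℝ → ℝ → ℝ} {t x : ℝ} (ht : 0 ≤ t)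
    (hx : 0 ≤ x) (hy : ContinuousOn (fun w : ℝ × ℝ => y w.1 w.2) (Icc 0 t ×ˢ Icc 0 x)) :
    k₁.conv (fun η => k₂.conv (fun ξ => y η ξ) x) t
      = k₂.conv (fun ξ => k₁.conv (fun η => y η ξ) t) x := by
  set F : ℝ → ℝ → ℝ := fun η ξ => (t - η) ^ (k₁.s - 1) * k₁.e (t - η) * (η ^ (-k₁.ε) *
    ((x - ξ) ^ (k₂.s - 1) * k₂.e (x - ξ) * (ξ ^ (-k₂.ε) * y η ξ))) with hF
  have hint : IntegrableOn (Function.uncurry F) (uIoc 0 t ×ˢ uIoc 0 x) := by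
    rw [uIoc_of_le ht, uIoc_of_le hx]
    have w1 := intervalIntegrable_weight k₁.s_pos k₁.ε_lt_one ht
    have w2 := intervalIntegrable_weight k₂.s_pos k₂.ε_lt_one hx
    rw [intervalIntegrable_iff_integrableOn_Ioc_of_le ht] at w1
    rw [intervalIntegrable_iff_integrableOn_Ioc_of_le hx] at w2
    have w := Integrable.mul_prod w1 w2
    rw [Measure.prod_restrict, ← Measure.volume_eq_prod] at w
    have hc : ContinuousOn (fun w : ℝ × ℝ => k₁.e (t - w.1) * k₂.e (x - w.2) * y w.1 w.2)
        (Icc 0 t ×ˢ Icc 0 x) := by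
      refine ContinuousOn.mul ?_ hy
      exact ((k₁.cont.comp (by fun_prop)).mul (k₂.cont.comp (by fun_prop))).continuousOn
    refine (IntegrableOn.mul_continuousOn_of_subset w hc
      (measurableSet_Ioc.prod measurableSet_Ioc) (isCompact_Icc.prod isCompact_Icc)
      (prod_mono Ioc_subset_Icc_self Ioc_subset_Icc_self)).congr_fun ?_
      (measurableSet_Ioc.prod measurableSet_Ioc)
    rintro ⟨η, ξ⟩ -
    simp only [Function.uncurry, hF]
    ring
  have e1 : k₁.conv (fun η => k₂.conv (fun ξ => y η ξ) x) t
      = ∫ η in (0 : ℝ)..t, ∫ ξ in (0 : ℝ)..x, F η ξ := by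
    refine intervalIntegral.integral_congr fun η _ => ?_
    simp only [hF, conv]
    rw [← intervalIntegral.integral_const_mul, ← intervalIntegral.integral_const_mul]
  rw [e1, intervalIntegral_intervalIntegral_swap hint]
  refine intervalIntegral.integral_congr fun ξ _ => ?_
  simp only [conv]
  rw [← intervalIntegral.integral_const_mul, ← intervalIntegral.integral_const_mul]
  refine intervalIntegral.integral_congr fun η _ => ?_
  simp only [hF]
  ring

end WeakKernel

/-! ### Convolution operators on bounded continuous functions of two variables -/

/-- Bounded continuous functions of `(t, x)`. -/
abbrev Field₂ := (ℝ × ℝ) →ᵇ ℝ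

namespace WeakKernel

theorem conv_add (k : WeakKernel) {y z : ℝ → ℝ} {t : ℝ} (ht : 0 ≤ t)
    (hy : ContinuousOn y (Icc 0 t)) (hz : ContinuousOn z (Icc 0 t)) :
    k.conv (fun η => y η + z η) t = k.conv y t + k.conv z t := by
  simp only [conv]
  rw [← intervalIntegral.integral_add (k.intervalIntegrable_conv ht hy)
    (k.intervalIntegrable_conv ht hz)]
  refine intervalIntegral.integral_congr fun η _ => ?_
  ring

theorem conv_const_mul (k : WeakKernel) (c : ℝ) (y : ℝ → ℝ) (t : ℝ) :
    k.conv (fun η => c * y η) t = c * k.conv y t := by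
  simp only [conv]
  rw [← intervalIntegral.integral_const_mul]
  refine intervalIntegral.integral_congr fun η _ => ?_
  ring

theorem integral_weight_le {s ε : ℝ} (hs : 0 < s) (hε₀ : 0 ≤ ε) (hε : ε < 1) (hεs : ε < s)
    {t q : ℝ} (ht : 0 ≤ t) (htq : t ≤ q) :
    ∫ η in (0 : ℝ)..t, (t - η) ^ (s - 1) * η ^ (-ε)
      ≤ q ^ (s - ε) * ∫ θ in (0 : ℝ)..1, (1 - θ) ^ (s - 1) * θ ^ (-ε) := by
  have e := conv_eq_rescaled ⟨s, ε, fun _ => 1, hs, hε₀, hε, hεs, continuous_const⟩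
    (fun _ => 1) ht
  simp only [conv, mul_one] at e
  rw [e]
  refine mul_le_mul_of_nonneg_right (Real.rpow_le_rpow ht htq (by linarith)) ?_
  refine intervalIntegral.integral_nonneg zero_le_one fun θ hθ => ?_
  exact mul_nonneg (Real.rpow_nonneg (by linarith [hθ.2]) _) (Real.rpow_nonneg hθ.1 _)

/-- A bound for the operator norm of the convolution. -/
theorem abs_conv_le_const (k : WeakKernel) {y : ℝ → ℝ} {t q C D : ℝ} (ht : 0 ≤ t)
    (htq : t ≤ q) (hC : 0 ≤ C) (hD : 0 ≤ D)
    (he : ∀ r ∈ Icc 0 q, |k.e r| ≤ C) (hy : ∀ η, |y η| ≤ D) :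
    |k.conv y t| ≤ C * (q ^ (k.s - k.ε) *
      ∫ θ in (0 : ℝ)..1, (1 - θ) ^ (k.s - 1) * θ ^ (-k.ε)) * D := by
  refine (k.abs_conv_le ht (fun r hr => he r ⟨hr.1, hr.2.trans htq⟩)
    (fun η _ => hy η)).trans ?_
  rw [mul_right_comm]
  gcongr
  exact integral_weight_le k.s_pos k.ε_nonneg k.ε_lt_one k.ε_lt_s ht htq

theorem exists_bound (k : WeakKernel) (q : ℝ) : ∃ C, 0 ≤ C ∧ ∀ r ∈ Icc 0 q, |k.e r| ≤ C := by
  obtain ⟨C, hC⟩ := isCompact_Icc.exists_bound_of_continuousOn (k.cont.continuousOn (s := Icc 0 q))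
  exact ⟨max C 0, le_max_right _ _, fun r hr => (hC r hr).trans (le_max_left _ _)⟩

/-- Convolution in the first variable, as a bounded operator; the operator only sees the
rectangle `[0,q] × [0,p]`. -/
noncomputable def opT (q p : ℝ) (k : WeakKernel) : Field₂ →L[ℝ] Field₂ :=
  -- `max q 0` bounds `clamp q` for either sign of `q`, so the operator is defined without a
  -- hypothesis on `q`.
  let C := (k.exists_bound (max q 0)).choose
  let B := C * ((max q 0) ^ (k.s - k.ε) *
    ∫ θ in (0 : ℝ)..1, (1 - θ) ^ (k.s - 1) * θ ^ (-k.ε))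
  have hC := (k.exists_bound (max q 0)).choose_spec
  have hB : ∀ (y : Field₂) (z : ℝ × ℝ),
      |k.conv (fun η => y (η, clamp p z.2)) (clamp q z.1)| ≤ B * ‖y‖ := fun y z =>
    k.abs_conv_le_const (clamp_nonneg _ _) (clamp_le _ _) hC.1 (norm_nonneg _) hC.2
      (fun η => y.norm_coe_le_norm _)
  LinearMap.mkContinuous
    { toFun := fun y => BoundedContinuousFunction.ofNormedAddCommGroup
        (fun z : ℝ × ℝ => k.conv (fun η => y (η, clamp p z.2)) (clamp q z.1))
        (k.continuous_conv (Z := ℝ × ℝ) (q := max q 0) (D := ‖y‖)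
          (y := fun z η => y (η, clamp p z.2)) (T := fun z => clamp q z.1)
          (by fun_prop) (fun z => ⟨clamp_nonneg _ _, clamp_le _ _⟩)
          (y.continuous.comp (by fun_prop)) (fun z η => y.norm_coe_le_norm _))
        (B * ‖y‖) (hB y)
      map_add' := fun y z => by
        ext w
        exact k.conv_add (clamp_nonneg _ _) (y.continuous.comp (by fun_prop)).continuousOn
          (z.continuous.comp (by fun_prop)).continuousOn
      map_smul' := fun c y => by
        ext w
        exact k.conv_const_mul c _ _ }
    B fun y => by
      have hC0 := hC.1
      refine (BoundedContinuousFunction.norm_le ?_).2 (hB y)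
      have h1 : 0 ≤ ∫ θ in (0 : ℝ)..1, (1 - θ) ^ (k.s - 1) * θ ^ (-k.ε) :=
        intervalIntegral.integral_nonneg zero_le_one fun θ hθ =>
          mul_nonneg (Real.rpow_nonneg (by linarith [hθ.2]) _) (Real.rpow_nonneg hθ.1 _)
      have h2 : (0 : ℝ) ≤ max q 0 := le_max_right _ _
      exact mul_nonneg (mul_nonneg hC0 (mul_nonneg (Real.rpow_nonneg h2 _) h1)) (norm_nonneg _)

theorem opT_apply (q p : ℝ) (k : WeakKernel) (y : Field₂) (t x : ℝ) :
    opT q p k y (t, x) = k.conv (fun η => y (η, clamp p x)) (clamp q t) := rfl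

end WeakKernel

/-- Exchange of the two variables. -/
noncomputable def swapField : Field₂ →L[ℝ] Field₂ :=
  LinearMap.mkContinuous
    { toFun := fun y => y.compContinuous ⟨Prod.swap, continuous_swap⟩
      map_add' := fun _ _ => rfl
      map_smul' := fun _ _ => rfl } 1 fun y => by
    rw [one_mul]
    exact (BoundedContinuousFunction.norm_le (norm_nonneg _)).2 fun z => y.norm_coe_le_norm _

theorem swapField_mul_self : swapField * swapField = 1 := by
  ext y ⟨t, x⟩; rfl

namespace WeakKernel

/-- Convolution in the second variable. -/
noncomputable def opX (q p : ℝ) (k : WeakKernel) : Field₂ →L[ℝ] Field₂ :=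
  swapField * (opT p q k * swapField)

theorem opX_apply (q p : ℝ) (k : WeakKernel) (y : Field₂) (t x : ℝ) :
    opX q p k y (t, x) = k.conv (fun ξ => y (clamp q t, ξ)) (clamp p x) := rfl

/-- Fubini. The clamps inside the inner convolutions are harmless, because the integration variables
never leave the rectangle. -/
theorem commute_opT_opX {q p : ℝ} (hq : 0 ≤ q) (hp : 0 ≤ p) (k₁ k₂ : WeakKernel) :
    Commute (opT q p k₁) (opX q p k₂) := by
  refine ContinuousLinearMap.ext fun y => BoundedContinuousFunction.ext fun ⟨t, x⟩ => ?_
  have ht := clamp_mem hq t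
  have hx := clamp_mem hp x
  change opT q p k₁ (opX q p k₂ y) (t, x) = opX q p k₂ (opT q p k₁ y) (t, x)
  simp only [opT_apply, opX_apply, clamp_clamp]
  rw [k₁.conv_congr (z := fun η => k₂.conv (fun ξ => y (η, ξ)) (clamp p x)) ht.1,
    k₂.conv_congr (z := fun ξ => k₁.conv (fun η => y (η, ξ)) (clamp q t)) hx.1]
  · exact conv_conv_swap k₁ k₂ ht.1 hx.1 (y.continuous.comp (by fun_prop)).continuousOn
  · intro ξ hξ
    rw [clamp_of_mem ⟨hξ.1, hξ.2.trans hx.2⟩]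
  · intro η hη
    rw [clamp_of_mem ⟨hη.1, hη.2.trans ht.2⟩]

/-- Composition of two convolutions from a convolution identity of the kernels. -/
theorem opT_mul_opT {q p : ℝ} (hq : 0 ≤ q) (k₁ k₂ k₃ : WeakKernel) (h₁ : k₁.ε = 0)
    (h₃ : k₃.ε = k₂.ε)
    (h : ∀ u ∈ Ioc 0 q, ∫ v in (0 : ℝ)..u, (u - v) ^ (k₁.s - 1) * k₁.e (u - v) *
        (v ^ (k₂.s - 1) * k₂.e v) = u ^ (k₃.s - 1) * k₃.e u) :
    opT q p k₁ * opT q p k₂ = opT q p k₃ := by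
  refine ContinuousLinearMap.ext fun y => BoundedContinuousFunction.ext fun ⟨t, x⟩ => ?_
  change opT q p k₁ (opT q p k₂ y) (t, x) = opT q p k₃ y (t, x)
  have ht := clamp_mem hq t
  simp only [opT_apply, clamp_clamp]
  rw [k₁.conv_congr (z := k₂.conv fun η => y (η, clamp p x)) ht.1, k₁.conv_conv k₂ h₁
    (y := fun η => y (η, clamp p x)) ht.1
    (y.continuous.comp (by fun_prop)).continuousOn, conv]
  -- The endpoint `ζ = t` is dropped, since the kernel identity is only assumed for `u > 0`.
  · rw [intervalIntegral.integral_of_le ht.1, intervalIntegral.integral_of_le ht.1,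
      integral_Ioc_eq_integral_Ioo, integral_Ioc_eq_integral_Ioo]
    refine setIntegral_congr_fun measurableSet_Ioo fun ζ hζ => ?_
    rw [h (clamp q t - ζ) ⟨by linarith [hζ.2], by linarith [hζ.1, ht.2]⟩, h₃]
  · intro η hη
    rw [clamp_of_mem ⟨hη.1, hη.2.trans ht.2⟩]

theorem opX_mul_opX {q p : ℝ} (hp : 0 ≤ p) (k₁ k₂ k₃ : WeakKernel) (h₁ : k₁.ε = 0)
    (h₃ : k₃.ε = k₂.ε)
    (h : ∀ u ∈ Ioc 0 p, ∫ v in (0 : ℝ)..u, (u - v) ^ (k₁.s - 1) * k₁.e (u - v) *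
        (v ^ (k₂.s - 1) * k₂.e v) = u ^ (k₃.s - 1) * k₃.e u) :
    opX q p k₁ * opX q p k₂ = opX q p k₃ := by
  have := opT_mul_opT (p := q) hp k₁ k₂ k₃ h₁ h₃ h
  simp only [opX, ← this]
  rw [show swapField * (opT p q k₁ * swapField) * (swapField * (opT p q k₂ * swapField))
    = swapField * (opT p q k₁ * (swapField * swapField) * opT p q k₂ * swapField) by
      simp only [mul_assoc], swapField_mul_self]
  simp only [mul_one]

end WeakKernel

/-! ### Exponentially tempered power kernels -/

theorem integral_beta_scaled {s r u : ℝ} (hs : 0 < s) (hr : 0 < r) (hu : 0 < u) :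
    ∫ v in (0 : ℝ)..u, (u - v) ^ (s - 1) * v ^ (r - 1)
      = u ^ (s + r - 1) * (Real.Gamma s * Real.Gamma r / Real.Gamma (s + r)) := by
  rw [integral_rescale, ← integral_beta hs hr, ← intervalIntegral.integral_const_mul,
    ← intervalIntegral.integral_const_mul]
  refine intervalIntegral.integral_congr fun θ hθ => ?_
  rw [uIcc_of_le zero_le_one] at hθ
  -- With `ε = 1 - r` the weight `v ^ (-ε)` becomes `v ^ (r - 1)`.
  have := WeakKernel.rescale_weight (s := s) (ε := 1 - r) hu hθ 1 1
  simp only [mul_one, neg_sub] at this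
  rw [this, show s - (1 - r) = s + r - 1 by ring]

/-- The kernel `r ^ (s - 1) exp (δ r) / Γ(s)`, acting on functions with weight `r ^ (-ε)`. -/
noncomputable def temperedKernel (δ s ε : ℝ) (hs : 0 < s) (hε₀ : 0 ≤ ε) (hε : ε < 1)
    (hεs : ε < s) : WeakKernel where
  s := s
  ε := ε
  e r := Real.exp (δ * r) / Real.Gamma s
  s_pos := hs
  ε_nonneg := hε₀
  ε_lt_one := hε
  ε_lt_s := hεs
  cont := by fun_prop

/-- The exponentials multiply to the constant `exp (δ u)`, and Euler's beta integral remains. This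
is the semigroup law in the order `s`. -/
theorem integral_tempered_mul_tempered {δ s r u : ℝ} (hs : 0 < s) (hr : 0 < r) (hu : 0 < u) :
    ∫ v in (0 : ℝ)..u, (u - v) ^ (s - 1) * (Real.exp (δ * (u - v)) / Real.Gamma s) *
        (v ^ (r - 1) * (Real.exp (δ * v) / Real.Gamma r))
      = u ^ (s + r - 1) * (Real.exp (δ * u) / Real.Gamma (s + r)) := by
  have e : ∀ v : ℝ, (u - v) ^ (s - 1) * (Real.exp (δ * (u - v)) / Real.Gamma s) *
      (v ^ (r - 1) * (Real.exp (δ * v) / Real.Gamma r))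
      = Real.exp (δ * u) / (Real.Gamma s * Real.Gamma r) * ((u - v) ^ (s - 1) * v ^ (r - 1)) := by
    intro v
    rw [show δ * u = δ * (u - v) + δ * v by ring, Real.exp_add]
    field_simp
  simp_rw [e]
  rw [intervalIntegral.integral_const_mul, integral_beta_scaled hs hr hu]
  have := (Real.Gamma_pos_of_pos hs).ne'
  have := (Real.Gamma_pos_of_pos hr).ne'
  have := (Real.Gamma_pos_of_pos (add_pos hs hr)).ne'
  field_simp

/-- The order `w` is a separate variable so that it can later be taken in the form `s * (m + 1)`. -/
theorem opT_tempered_mul {q p δ s r ε : ℝ} (hq : 0 ≤ q) (hs : 0 < s) (hr : 0 < r) (hε₀ : 0 ≤ ε)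
    (hε : ε < 1) (hεr : ε < r) {w : ℝ} (hw : w = s + r) (hw0 : 0 < w) (hεw : ε < w) :
    (temperedKernel δ s 0 hs le_rfl zero_lt_one hs).opT q p *
      (temperedKernel δ r ε hr hε₀ hε hεr).opT q p
      = (temperedKernel δ w ε hw0 hε₀ hε hεw).opT q p := by
  subst hw
  exact WeakKernel.opT_mul_opT hq _ _ _ rfl rfl fun u hu =>
    integral_tempered_mul_tempered hs hr hu.1

theorem opX_tempered_mul {q p δ s r ε : ℝ} (hp : 0 ≤ p) (hs : 0 < s) (hr : 0 < r) (hε₀ : 0 ≤ ε)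
    (hε : ε < 1) (hεr : ε < r) {w : ℝ} (hw : w = s + r) (hw0 : 0 < w) (hεw : ε < w) :
    (temperedKernel δ s 0 hs le_rfl zero_lt_one hs).opX q p *
      (temperedKernel δ r ε hr hε₀ hε hεr).opX q p
      = (temperedKernel δ w ε hw0 hε₀ hε hεw).opX q p := by
  subst hw
  exact WeakKernel.opX_mul_opX hp _ _ _ rfl rfl fun u hu =>
    integral_tempered_mul_tempered hs hr hu.1

theorem mul_natCast_add_one_pos {s : ℝ} (hs : 0 < s) (m : ℕ) : 0 < s * (m + 1) := by positivity

theorem lt_mul_natCast_add_one {s ε : ℝ} (hs : 0 < s) (hεs : ε < s) (m : ℕ) :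
    ε < s * (m + 1) := by
  have : (0 : ℝ) ≤ s * m := by positivity
  linarith

/-- Only the factor applied first carries the weight; the others act on continuous functions. This
gives every power of `I` acting on singular data as one explicit convolution. -/
theorem opT_tempered_pow_mul {q p δ s ε : ℝ} (hq : 0 ≤ q) (hs : 0 < s) (hε₀ : 0 ≤ ε)
    (hε : ε < 1) (hεs : ε < s) (m : ℕ) :
    (temperedKernel δ s 0 hs le_rfl zero_lt_one hs).opT q p ^ m *
      (temperedKernel δ s ε hs hε₀ hε hεs).opT q p
      = (temperedKernel δ (s * (m + 1)) ε (mul_natCast_add_one_pos hs m) hε₀ hε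
          (lt_mul_natCast_add_one hs hεs m)).opT q p := by
  induction m with
  | zero => simp
  | succ m ih =>
    rw [pow_succ', mul_assoc, ih]
    exact opT_tempered_mul hq _ _ _ _ _ (by push_cast; ring) _ _

theorem opX_tempered_pow_mul {q p δ s ε : ℝ} (hp : 0 ≤ p) (hs : 0 < s) (hε₀ : 0 ≤ ε)
    (hε : ε < 1) (hεs : ε < s) (m : ℕ) :
    (temperedKernel δ s 0 hs le_rfl zero_lt_one hs).opX q p ^ m *
      (temperedKernel δ s ε hs hε₀ hε hεs).opX q p
      = (temperedKernel δ (s * (m + 1)) ε (mul_natCast_add_one_pos hs m) hε₀ hε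
          (lt_mul_natCast_add_one hs hεs m)).opX q p := by
  induction m with
  | zero => simp
  | succ m ih =>
    rw [pow_succ', mul_assoc, ih]
    exact opX_tempered_mul hp _ _ _ _ _ (by push_cast; ring) _ _

/-! ### The integral `∫₀¹ θ ^ (s - 1) exp (z θ) dθ` -/

/-- The integral `∫₀¹ θ ^ (s - 1) exp (z θ) dθ`. -/
noncomputable def expMoment (s z : ℝ) : ℝ :=
  ∫ θ in (0 : ℝ)..1, θ ^ (s - 1) * Real.exp (z * θ)

theorem intervalIntegrable_rpow_unit {s : ℝ} (hs : 0 < s) (a b : ℝ) :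
    IntervalIntegrable (fun θ : ℝ => θ ^ (s - 1)) volume a b :=
  intervalIntegral.intervalIntegrable_rpow' (by linarith)

/-- The factors `1 / (s + k)` come from integrating the exponential series termwise. They are the
Gamma quotients that appear in the kernels `E`, `F₁` and `F₂`. -/
theorem hasSum_expMoment {s : ℝ} (hs : 0 < s) (z : ℝ) :
    HasSum (fun k : ℕ => z ^ k / (k.factorial * (s + k))) (expMoment s z) := by
  have h := intervalIntegral.hasSum_integral_of_dominated_convergence (μ := volume)
    (a := 0) (b := 1)
    (F := fun (k : ℕ) (θ : ℝ) => θ ^ (s - 1) * ((z * θ) ^ k / k.factorial))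
    (f := fun θ => θ ^ (s - 1) * Real.exp (z * θ))
    (fun k θ => |z| ^ k / k.factorial * θ ^ (s - 1)) ?_ ?_ ?_ ?_ ?_
  · rw [show (fun k : ℕ => z ^ k / (k.factorial * (s + k))) = fun k : ℕ =>
      ∫ θ in (0 : ℝ)..1, θ ^ (s - 1) * ((z * θ) ^ k / k.factorial) from funext fun k => ?_]
    · exact h
    have e : ∀ θ ∈ Ioc (0 : ℝ) 1, θ ^ (s - 1) * ((z * θ) ^ k / k.factorial)
        = z ^ k / k.factorial * θ ^ (s + k - 1) := by
      intro θ hθ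
      rw [show s + k - 1 = (s - 1) + k by ring, Real.rpow_add hθ.1, Real.rpow_natCast, mul_pow]
      ring
    rw [intervalIntegral.integral_of_le zero_le_one, setIntegral_congr_fun measurableSet_Ioc e,
      ← intervalIntegral.integral_of_le zero_le_one, intervalIntegral.integral_const_mul,
      integral_rpow (Or.inl (by have : (0 : ℝ) ≤ k := k.cast_nonneg; linarith))]
    have hk : s + (k : ℝ) ≠ 0 := by positivity
    rw [sub_add_cancel, Real.one_rpow, Real.zero_rpow hk]
    field_simp
    ring
  · intro k
    refine Measurable.aestronglyMeasurable ?_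
    fun_prop
  · intro k
    refine Filter.Eventually.of_forall fun θ hθ => ?_
    rw [uIoc_of_le zero_le_one] at hθ
    have w := Real.rpow_nonneg hθ.1.le (s - 1)
    rw [Real.norm_eq_abs, abs_mul, abs_of_nonneg w, abs_div, abs_pow, abs_mul,
      abs_of_nonneg hθ.1.le, Nat.abs_cast, mul_comm]
    have : |z| * θ ≤ |z| := mul_le_of_le_one_right (abs_nonneg z) hθ.2
    have h0 : 0 ≤ |z| * θ := mul_nonneg (abs_nonneg _) hθ.1.le
    gcongr
  · exact Filter.Eventually.of_forall fun _ _ =>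
      (Real.summable_pow_div_factorial |z|).mul_right _
  · simp_rw [tsum_mul_right]
    exact (intervalIntegrable_rpow_unit hs 0 1).const_mul _
  · refine Filter.Eventually.of_forall fun θ _ => HasSum.mul_left _ ?_
    rw [Real.exp_eq_exp_ℝ]
    exact NormedSpace.expSeries_div_hasSum_exp (z * θ)

theorem continuous_expMoment {s : ℝ} (hs : 0 < s) : Continuous (expMoment s) := by
  refine continuous_iff_continuousAt.2 fun z₀ => ?_
  refine intervalIntegral.continuousAt_of_dominated_interval
    (bound := fun θ => Real.exp (|z₀| + 1) * θ ^ (s - 1)) ?_ ?_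
    ((intervalIntegrable_rpow_unit hs 0 1).const_mul _) ?_
  · exact Filter.Eventually.of_forall fun z =>
      Measurable.aestronglyMeasurable (by fun_prop)
  · have : ∀ᶠ z in nhds z₀, |z| < |z₀| + 1 :=
      continuous_abs.continuousAt.eventually_lt continuousAt_const (by linarith)
    filter_upwards [this] with z hz
    refine Filter.Eventually.of_forall fun θ hθ => ?_
    rw [uIoc_of_le zero_le_one] at hθ
    have w := Real.rpow_nonneg hθ.1.le (s - 1)
    rw [Real.norm_eq_abs, abs_mul, abs_of_nonneg w, Real.abs_exp, mul_comm]
    gcongr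
    calc z * θ ≤ |z * θ| := le_abs_self _
      _ = |z| * θ := by rw [abs_mul, abs_of_nonneg hθ.1.le]
      _ ≤ |z| := mul_le_of_le_one_right (abs_nonneg z) hθ.2
      _ ≤ |z₀| + 1 := hz.le
  · exact Filter.Eventually.of_forall fun _ _ => by fun_prop

theorem expMoment_nonneg (s z : ℝ) : 0 ≤ expMoment s z :=
  intervalIntegral.integral_nonneg zero_le_one fun _ hθ =>
    mul_nonneg (Real.rpow_nonneg hθ.1 _) (Real.exp_nonneg _)

theorem expMoment_le {s z : ℝ} (hs : 0 < s) (hz : z ≤ 0) : expMoment s z ≤ 1 / s := by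
  have h : ∫ θ in (0 : ℝ)..1, θ ^ (s - 1) = 1 / s := by
    rw [integral_rpow (Or.inl (by linarith)), sub_add_cancel, Real.one_rpow,
      Real.zero_rpow hs.ne', sub_zero]
  rw [← h]
  refine intervalIntegral.integral_mono_on zero_le_one ?_ (intervalIntegrable_rpow_unit hs 0 1) ?_
  · exact (intervalIntegrable_rpow_unit hs 0 1).mul_continuousOn
      (Continuous.continuousOn (by fun_prop))
  · intro θ hθ
    exact mul_le_of_le_one_right (Real.rpow_nonneg hθ.1 _)
      (Real.exp_le_one_iff.2 (mul_nonpos_of_nonpos_of_nonneg hz hθ.1))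

/-- The convolution of a tempered kernel with the constant function `1`. -/
theorem conv_tempered_one {δ s t : ℝ} (hs : 0 < s) (ht : 0 ≤ t) :
    (temperedKernel δ s 0 hs le_rfl zero_lt_one hs).conv (fun _ => 1) t
      = t ^ s / Real.Gamma s * expMoment s (δ * t) := by
  rw [WeakKernel.conv_eq_rescaled _ _ ht, expMoment]
  simp only [temperedKernel, neg_zero, Real.rpow_zero, mul_one, sub_zero]
  rw [div_mul_eq_mul_div, mul_div_assoc]
  congr 1
  have := intervalIntegral.integral_comp_sub_left (a := 0) (b := 1)
    (fun θ : ℝ => θ ^ (s - 1) * Real.exp (δ * t * θ)) 1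
  rw [sub_self, sub_zero] at this
  rw [← this, ← intervalIntegral.integral_div]
  refine intervalIntegral.integral_congr fun θ _ => ?_
  rw [show δ * (t - t * θ) = δ * t * (1 - θ) by ring]
  ring

theorem conv_tempered_one' {δ s t : ℝ} (hs : 0 < s) :
    (temperedKernel δ s 0 hs le_rfl zero_lt_one hs).conv (fun _ => 1) t
      = ∫ η in (0 : ℝ)..t, η ^ (s - 1) * (Real.exp (δ * η) / Real.Gamma s) := by
  have := intervalIntegral.integral_comp_sub_left (a := 0) (b := t)
    (fun η : ℝ => η ^ (s - 1) * (Real.exp (δ * η) / Real.Gamma s)) t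
  rw [sub_self, sub_zero] at this
  rw [← this, WeakKernel.conv]
  simp [temperedKernel]

/-! ### The Prabhakar kernel -/

/-- Stated through `Γ(1 - β)` rather than `Γ(-β)`, so that all Gamma functions have positive
arguments. -/
theorem ascPochhammer_neg_eval_succ {β : ℝ} (hβ : β < 1) (m : ℕ) :
    (ascPochhammer ℝ (m + 1)).eval (-β) * Real.Gamma (1 - β) = -β * Real.Gamma (m + 1 - β) := by
  induction m with
  | zero => simp
  | succ m ih =>
    have h0 : (m : ℝ) + 1 - β ≠ 0 := by
      have : (0 : ℝ) ≤ m := m.cast_nonneg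
      linarith
    rw [ascPochhammer_succ_eval, mul_right_comm, ih]
    push_cast
    rw [show (m : ℝ) + 1 + 1 - β = (m + 1 - β) + 1 by ring, Real.Gamma_add_one h0]
    ring

/-- For `m ≥ 1` the coefficient `(-β)ₘ / Γ(m + 1 - β)` equals `(1 - m / (m - β)) / Γ(1 - β)`. The
first part gives the exponential series, the second gives `z` times the series of `expMoment (1 -
β)`. -/
theorem hasSum_prabhakar {β : ℝ} (hβ : β < 1) (z : ℝ) :
    HasSum (fun m : ℕ => (ascPochhammer ℝ m).eval (-β) / Real.Gamma (1 * m + (1 - β)) *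
        (z ^ m / (m.factorial : ℝ)))
      ((Real.exp z - z * expMoment (1 - β) z) / Real.Gamma (1 - β)) := by
  have hs : 0 < 1 - β := by linarith
  have hΓ := (Real.Gamma_pos_of_pos hs).ne'
  have h1 : HasSum (fun m : ℕ => z ^ m / (m.factorial : ℝ)) (Real.exp z) := by
    rw [Real.exp_eq_exp_ℝ]; exact NormedSpace.expSeries_div_hasSum_exp z
  have h2 := (hasSum_nat_add_iff' 1).2 h1
  have h3 := (hasSum_expMoment hs z).mul_left z
  refine (hasSum_nat_add_iff' 1).1 ?_
  have h4 := (h2.sub h3).div_const (Real.Gamma (1 - β))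
  simp only [Finset.range_one, Finset.sum_singleton] at h4 ⊢
  have e0 : ∀ m : ℕ, (ascPochhammer ℝ (m + 1)).eval (-β) /
      Real.Gamma (1 * ((m + 1 : ℕ) : ℝ) + (1 - β)) * (z ^ (m + 1) / ((m + 1).factorial : ℝ))
      = (z ^ (m + 1) / ((m + 1).factorial : ℝ)
        - z * (z ^ m / (m.factorial * (1 - β + m)))) / Real.Gamma (1 - β) := by
    intro m
    have hm : (0 : ℝ) ≤ m := m.cast_nonneg
    have hp : (0 : ℝ) < m + 1 - β := by linarith
    have hg := (Real.Gamma_pos_of_pos hp).ne'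
    have e := ascPochhammer_neg_eval_succ hβ m
    have e' : (ascPochhammer ℝ (m + 1)).eval (-β)
        = -β * Real.Gamma (m + 1 - β) / Real.Gamma (1 - β) := by
      rw [← e]; field_simp
    rw [e']
    push_cast [Nat.factorial_succ]
    rw [show (1 : ℝ) * (m + 1) + (1 - β) = (m + 1 - β) + 1 by ring, Real.Gamma_add_one hp.ne']
    have : (1 - β + m : ℝ) ≠ 0 := by linarith
    have : (m + 1 : ℝ) ≠ 0 := by positivity
    field_simp
    ring
  simp_rw [e0]
  refine (congrArg (HasSum _) ?_).mp h4
  simp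
  ring

theorem prabhakarML_eq {β : ℝ} (hβ : β < 1) (z : ℝ) :
    prabhakarML 1 (1 - β) (-β) z
      = (Real.exp z - z * expMoment (1 - β) z) / Real.Gamma (1 - β) :=
  (hasSum_prabhakar hβ z).tsum_eq

/-- The kernel of the Caputo-Prabhakar derivative with `α = 1`, `γ = β`. -/
noncomputable def prabhakarKernel (β δ : ℝ) (hβ : β < 1) : WeakKernel where
  s := 1 - β
  ε := 0
  e r := prabhakarML 1 (1 - β) (-β) (δ * r)
  s_pos := by linarith
  ε_nonneg := le_rfl
  ε_lt_one := zero_lt_one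
  ε_lt_s := by linarith
  cont := by
    simp_rw [prabhakarML_eq hβ]
    have := (continuous_expMoment (show 0 < 1 - β by linarith)).comp (continuous_const_mul δ)
    exact ((Real.continuous_exp.comp (continuous_const_mul δ)).sub
      ((continuous_const_mul δ).mul this)).div_const _

/-- This is the identity `(s - δ) ^ β / s = (s - δ) ^ (β - 1) (1 - δ / s)` on the Laplace side: a
tempered kernel of order `1 - β` minus `δ` times its primitive. -/
theorem prabhakarKernel_eq {β δ v : ℝ} (hβ : β < 1) (hv : 0 < v) :
    v ^ (1 - β - 1) * prabhakarML 1 (1 - β) (-β) (δ * v)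
      = v ^ (1 - β - 1) * (Real.exp (δ * v) / Real.Gamma (1 - β))
        - δ * (temperedKernel δ (1 - β) 0 (by linarith) le_rfl zero_lt_one (by linarith)).conv
            (fun _ => 1) v := by
  rw [prabhakarML_eq hβ, conv_tempered_one (by linarith) hv.le]
  have : v ^ (1 - β) = v ^ (1 - β - 1) * v := by
    nth_rw 3 [← Real.rpow_one v]
    rw [← Real.rpow_add hv, sub_add_cancel]
  rw [this]
  ring

theorem continuous_conv_one (k : WeakKernel) (q : ℝ) :
    Continuous (fun t => k.conv (fun _ => 1) (clamp q t)) :=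
  k.continuous_conv (Z := ℝ) (q := max q 0) (D := 1) (y := fun _ _ => 1) (T := fun t => clamp q t)
    (by fun_prop) (fun z => ⟨clamp_nonneg _ _, clamp_le _ _⟩) (by fun_prop) (by simp)

/-- The tempered part of the kernel has order `1 - β`, so convolving it with order `β` gives `exp (δ
u)`. The primitive part contributes `δ ∫₀ᵘ exp (δ (u - ζ)) dζ = exp (δ u) - 1`, and the difference
is `1`. -/
theorem integral_tempered_mul_prabhakar {β δ u : ℝ} (hβ₀ : 0 < β) (hβ : β < 1) (hu : 0 < u) :
    ∫ v in (0 : ℝ)..u, (u - v) ^ (β - 1) * (Real.exp (δ * (u - v)) / Real.Gamma β) *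
        (v ^ (1 - β - 1) * prabhakarML 1 (1 - β) (-β) (δ * v)) = 1 := by
  have hs : 0 < 1 - β := by linarith
  set kβ := temperedKernel δ β 0 hβ₀ le_rfl zero_lt_one hβ₀ with hkβ
  set kc := temperedKernel δ (1 - β) 0 hs le_rfl zero_lt_one hs with hkc
  have hc : ContinuousOn (kc.conv fun _ => 1) (Icc 0 u) :=
    (continuous_conv_one kc u).continuousOn.congr fun t ht => by
      simp only [clamp_of_mem ht]
  have i1 := kβ.intervalIntegrable_conv hu.le hc
  have e1 : ∫ v in (0 : ℝ)..u, (u - v) ^ (β - 1) * (Real.exp (δ * (u - v)) / Real.Gamma β) *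
        (v ^ (1 - β - 1) * prabhakarML 1 (1 - β) (-β) (δ * v))
      = ∫ v in (0 : ℝ)..u, ((u - v) ^ (β - 1) * (Real.exp (δ * (u - v)) / Real.Gamma β) *
          (v ^ (1 - β - 1) * (Real.exp (δ * v) / Real.Gamma (1 - β)))
        - δ * ((u - v) ^ (kβ.s - 1) * kβ.e (u - v) *
          (v ^ (-kβ.ε) * kc.conv (fun _ => 1) v))) := by
    refine intervalIntegral.integral_congr_ae (Filter.Eventually.of_forall fun v hv => ?_)
    rw [uIoc_of_le hu.le] at hv
    rw [prabhakarKernel_eq hβ hv.1, ← hkc]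
    simp only [hkβ, temperedKernel, neg_zero, Real.rpow_zero]
    ring
  have i2 : IntervalIntegrable (fun v : ℝ => (u - v) ^ (β - 1) *
      (Real.exp (δ * (u - v)) / Real.Gamma β) *
      (v ^ (1 - β - 1) * (Real.exp (δ * v) / Real.Gamma (1 - β)))) volume 0 u := by
    have := (WeakKernel.intervalIntegrable_weight hβ₀ hβ hu.le).const_mul
      (Real.exp (δ * u) / (Real.Gamma β * Real.Gamma (1 - β)))
    refine this.congr fun v _ => ?_
    rw [show δ * u = δ * (u - v) + δ * v by ring, Real.exp_add,
      show 1 - β - 1 = -β by ring]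
    ring
  rw [e1, intervalIntegral.integral_sub i2 (i1.const_mul δ), intervalIntegral.integral_const_mul,
    integral_tempered_mul_tempered hβ₀ hs hu]
  have e2 : kβ.conv (kc.conv fun _ => 1) u = ∫ ζ in (0 : ℝ)..u, Real.exp (δ * (u - ζ)) := by
    rw [kβ.conv_conv kc rfl hu.le continuousOn_const]
    rw [intervalIntegral.integral_of_le hu.le, intervalIntegral.integral_of_le hu.le,
      integral_Ioc_eq_integral_Ioo, integral_Ioc_eq_integral_Ioo]
    refine setIntegral_congr_fun measurableSet_Ioo fun ζ hζ => ?_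
    simp only [hkβ, hkc, temperedKernel]
    rw [integral_tempered_mul_tempered hβ₀ hs (by linarith [hζ.2])]
    simp
  have e3 : δ * ∫ ζ in (0 : ℝ)..u, Real.exp (δ * (u - ζ)) = Real.exp (δ * u) - 1 := by
    rw [← intervalIntegral.integral_const_mul]
    have hd : ∀ ζ ∈ uIcc 0 u, HasDerivAt (fun ζ => -Real.exp (δ * (u - ζ)))
        (δ * Real.exp (δ * (u - ζ))) ζ := by
      intro ζ _
      refine ((((hasDerivAt_id ζ).const_sub u).const_mul δ).exp).neg.congr_deriv ?_
      simp only [id]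
      ring
    rw [intervalIntegral.integral_eq_sub_of_hasDerivAt hd
      (Continuous.intervalIntegrable (by fun_prop) _ _)]
    simp
    ring
  rw [WeakKernel.conv] at e2
  rw [e2, e3]
  simp

theorem integral_prabhakar_mul_tempered {β δ u : ℝ} (hβ₀ : 0 < β) (hβ : β < 1) (hu : 0 < u) :
    ∫ v in (0 : ℝ)..u, (u - v) ^ (1 - β - 1) * prabhakarML 1 (1 - β) (-β) (δ * (u - v)) *
        (v ^ (β - 1) * (Real.exp (δ * v) / Real.Gamma β)) = 1 := by
  refine Eq.trans ?_ (integral_tempered_mul_prabhakar (δ := δ) hβ₀ hβ hu)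
  have := intervalIntegral.integral_comp_sub_left (a := 0) (b := u) (fun v : ℝ =>
    (u - v) ^ (β - 1) * (Real.exp (δ * (u - v)) / Real.Gamma β) *
        (v ^ (1 - β - 1) * prabhakarML 1 (1 - β) (-β) (δ * v))) u
  rw [sub_self, sub_zero] at this
  refine Eq.trans ?_ this
  refine intervalIntegral.integral_congr fun v _ => ?_
  simp only [sub_sub_cancel]
  ring

/-- The derivative of the Prabhakar kernel. -/
theorem hasDerivAt_prabhakarKernel {β δ r : ℝ} (hβ : β < 1) (hr : 0 < r) :
    HasDerivAt (fun v : ℝ => v ^ (1 - β - 1) * prabhakarML 1 (1 - β) (-β) (δ * v))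
      (-β * r ^ (-β - 1) * Real.exp (δ * r) / Real.Gamma (1 - β)) r := by
  have hs : 0 < 1 - β := by linarith
  have hd1 : HasDerivAt (fun v : ℝ => v ^ (1 - β - 1) * (Real.exp (δ * v) / Real.Gamma (1 - β)))
      ((1 - β - 1) * r ^ (1 - β - 1 - 1) * (Real.exp (δ * r) / Real.Gamma (1 - β))
        + r ^ (1 - β - 1) * (Real.exp (δ * r) * δ / Real.Gamma (1 - β))) r := by
    have h2 : HasDerivAt (fun v : ℝ => Real.exp (δ * v)) (Real.exp (δ * r) * δ) r := by
      simpa using ((hasDerivAt_id r).const_mul δ).exp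
    exact (Real.hasDerivAt_rpow_const (Or.inl hr.ne')).mul (h2.div_const _)
  have hd2 : HasDerivAt (fun v : ℝ => ∫ η in (0 : ℝ)..v,
      η ^ (1 - β - 1) * (Real.exp (δ * η) / Real.Gamma (1 - β)))
      (r ^ (1 - β - 1) * (Real.exp (δ * r) / Real.Gamma (1 - β))) r := by
    refine intervalIntegral.integral_hasDerivAt_right ?_ ?_ ?_
    · exact (intervalIntegrable_rpow_unit hs 0 r).mul_continuousOn
        (Continuous.continuousOn (by fun_prop))
    · exact Measurable.stronglyMeasurable (by fun_prop) |>.stronglyMeasurableAtFilter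
    · exact hd1.continuousAt
  have h : HasDerivAt (fun v : ℝ => v ^ (1 - β - 1) * (Real.exp (δ * v) / Real.Gamma (1 - β))
        - δ * ∫ η in (0 : ℝ)..v, η ^ (1 - β - 1) * (Real.exp (δ * η) / Real.Gamma (1 - β))) _ r :=
    hd1.sub (hd2.const_mul δ)
  have hev : (fun v : ℝ => v ^ (1 - β - 1) * prabhakarML 1 (1 - β) (-β) (δ * v)) =ᶠ[nhds r]
      (fun v : ℝ => v ^ (1 - β - 1) * (Real.exp (δ * v) / Real.Gamma (1 - β))
        - δ * ∫ η in (0 : ℝ)..v, η ^ (1 - β - 1) * (Real.exp (δ * η) / Real.Gamma (1 - β))) := by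
    filter_upwards [lt_mem_nhds hr] with v hv
    rw [prabhakarKernel_eq hβ hv, conv_tempered_one']
  refine HasDerivAt.congr_of_eventuallyEq ?_ hev
  -- The two terms with `δ r ^ (-β) exp (δ r)` cancel, which leaves the single power `r ^ (-β - 1)`.
  refine h.congr_deriv ?_
  rw [show 1 - β - 1 - 1 = -β - 1 by ring]
  ring

/-! ### Quasi-nilpotent elements and Neumann series -/

section Neumann

variable {A : Type*} [NormedRing A]

/-- Every geometric rescaling of the power series of `S` converges absolutely. -/
def QuasiNilpotent (S : A) : Prop :=
  ∀ c : ℝ, 0 ≤ c → Summable fun n : ℕ => c ^ n * ‖S ^ n‖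

theorem QuasiNilpotent.smul [NormedAlgebra ℝ A] {S : A} (h : QuasiNilpotent S) (a : ℝ) :
    QuasiNilpotent (a • S) := by
  intro c hc
  refine (h (c * |a|) (by positivity)).congr fun n => ?_
  rw [smul_pow, norm_smul, Real.norm_eq_abs, abs_pow, mul_pow, mul_assoc]

theorem QuasiNilpotent.summable_pow [CompleteSpace A] {S : A} (h : QuasiNilpotent S) :
    Summable fun n => S ^ n :=
  Summable.of_norm (by simpa using h 1 zero_le_one)

theorem choose_le_two_pow_mul (m j : ℕ) : ((m + j).choose m : ℝ) ≤ 2 ^ m * 2 ^ j := by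
  rw [← pow_add]
  exact_mod_cast Nat.choose_le_two_pow _ _

/-- The Neumann series of `1 - S - X` for commuting quasi-nilpotent elements. -/
theorem Commute.exists_hasSum_inverse_one_sub_sub [NormedAlgebra ℝ A] [CompleteSpace A]
    {S X : A} (h : Commute S X)
    (hS : QuasiNilpotent S) (hX : QuasiNilpotent X) :
    ∃ N : A, HasSum (fun i : ℕ × ℕ => ((i.1 + i.2).choose i.1 : ℝ) • (S ^ i.1 * X ^ i.2)) N ∧
      N * (1 - S - X) = 1 ∧ (1 - S - X) * N = 1 := by
  have hsum : Summable fun i : ℕ × ℕ =>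
      ((i.1 + i.2).choose i.1 : ℝ) • (S ^ i.1 * X ^ i.2) := by
    -- Quasi-nilpotence is used at `c = 2`, because the binomial coefficient is at most `2 ^ m * 2 ^
    -- j`.
    refine Summable.of_norm_bounded (Summable.mul_of_nonneg (hS 2 zero_le_two)
      (hX 2 zero_le_two) (fun n => by positivity) (fun n => by positivity)) ?_
    rintro ⟨m, j⟩
    rw [norm_smul, Real.norm_of_nonneg (Nat.cast_nonneg _)]
    calc ((m + j).choose m : ℝ) * ‖S ^ m * X ^ j‖
        ≤ (2 ^ m * 2 ^ j) * (‖S ^ m‖ * ‖X ^ j‖) := by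
          gcongr
          · exact choose_le_two_pow_mul m j
          · exact norm_mul_le _ _
      _ = _ := by ring
  obtain ⟨N, hN⟩ := hsum
  -- Summed along antidiagonals, the double series is the Neumann series of `S + X` by the binomial
  -- theorem.
  have h1 := (Finset.HasAntidiagonal.sigmaAntidiagonalEquivProd (A := ℕ)).hasSum_iff.2 hN
  have h2 : HasSum (fun n => (S + X) ^ n) N := by
    refine h1.sigma fun n => ?_
    rw [h.add_pow', ← Finset.sum_coe_sort]
    refine (hasSum_fintype (α := A) _).congr_fun fun i => ?_
    have hi := Finset.HasAntidiagonal.mem_antidiagonal.1 i.2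
    simp only [Function.comp, Finset.HasAntidiagonal.sigmaAntidiagonalEquivProd_apply]
    rw [hi, Nat.cast_smul_eq_nsmul]
  have h3 := h2.summable.tsum_pow_mul_one_sub
  have h4 := h2.summable.one_sub_mul_tsum_pow
  rw [h2.tsum_eq] at h3 h4
  exact ⟨N, hN, by rwa [sub_sub], by rwa [sub_sub]⟩

end Neumann

section NeumannOperator

variable {E : Type*} [NormedAddCommGroup E] [NormedSpace ℝ E] [CompleteSpace E]

/-- The inverse of `1 - a S - b X` as a double power series. -/
theorem Commute.exists_resolvent {S X : E →L[ℝ] E} (h : Commute S X)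
    (hS : QuasiNilpotent S) (hX : QuasiNilpotent X) (a b : ℝ) :
    ∃ N : E →L[ℝ] E, (∀ w, HasSum (fun i : ℕ × ℕ => ((i.1 + i.2).choose i.1 : ℝ) •
      (a ^ i.1 * b ^ i.2) • (S ^ i.1) ((X ^ i.2) w)) (N w)) ∧
      (∀ w, N (w - a • S w - b • X w) = w) ∧ ∀ w, N w - a • S (N w) - b • X (N w) = w := by
  obtain ⟨N, h1, h2, h3⟩ := Commute.exists_hasSum_inverse_one_sub_sub
    ((h.smul_left a).smul_right b) (hS.smul a) (hX.smul b)
  refine ⟨N, fun w => ?_, fun w => ?_, fun w => ?_⟩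
  · have h4 := h1.mapL (ContinuousLinearMap.apply ℝ E w)
    refine (congrArg (fun f => HasSum f _) (funext fun i => ?_)).mp h4
    rw [smul_pow, smul_pow, smul_mul_smul_comm]
    rfl
  · exact congrArg (fun T : E →L[ℝ] E => T w) h2
  · exact congrArg (fun T : E →L[ℝ] E => T w) h3

/-- The inverse of `1 - a S`. -/
theorem QuasiNilpotent.exists_inverse {S : E →L[ℝ] E} (hS : QuasiNilpotent S) (a : ℝ) :
    ∃ R : E →L[ℝ] E, (∀ w, HasSum (fun n : ℕ => a ^ n • (S ^ n) w) (R w)) ∧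
      (∀ w, R (w - a • S w) = w) ∧ (∀ w, R w - a • S (R w) = w) ∧
      ∀ T : E →L[ℝ] E, Commute S T → ∀ w, T (R w) = R (T w) := by
  have hq := hS.smul a
  have h1 : HasSum (fun n => (a • S) ^ n) (∑' n, (a • S) ^ n) := hq.summable_pow.hasSum
  have h2 := hq.summable_pow.tsum_pow_mul_one_sub
  have h3 := hq.summable_pow.one_sub_mul_tsum_pow
  set R := ∑' n, (a • S) ^ n
  have h4 : ∀ w, HasSum (fun n : ℕ => a ^ n • (S ^ n) w) (R w) := fun w => by
    have h5 := h1.mapL (ContinuousLinearMap.apply ℝ E w)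
    refine (congrArg (fun f => HasSum f _) (funext fun n => ?_)).mp h5
    rw [smul_pow]
    rfl
  refine ⟨R, h4, fun w => congrArg (fun T : E →L[ℝ] E => T w) h2,
    fun w => congrArg (fun T : E →L[ℝ] E => T w) h3, fun T hT w => ?_⟩
  refine ((h4 w).mapL T).unique ?_
  refine (congrArg (fun f => HasSum f _) (funext fun n => ?_)).mp (h4 (T w))
  rw [map_smul]
  exact congrArg (fun U : E →L[ℝ] E => a ^ n • U w) (hT.pow_left n).eq

end NeumannOperator

/-! ### A Mittag-Leffler type series -/

/-- Keep only the part of the Gamma integral over `(L, L + 1]`. As `L` is free, Gamma outgrows every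
geometric sequence. -/
theorem Gamma_ge {L z : ℝ} (hL : 0 < L) (hz : 1 ≤ z) :
    Real.exp (-(L + 1)) * L ^ (z - 1) ≤ Real.Gamma z := by
  rw [Real.Gamma_eq_integral (by linarith)]
  have hint := Real.GammaIntegral_convergent (show 0 < z by linarith)
  have hsub : Ioc L (L + 1) ⊆ Ioi 0 := fun x hx => hL.trans hx.1
  calc Real.exp (-(L + 1)) * L ^ (z - 1)
      = ∫ _ in Ioc L (L + 1), Real.exp (-(L + 1)) * L ^ (z - 1) := by simp
    _ ≤ ∫ x in Ioc L (L + 1), Real.exp (-x) * x ^ (z - 1) := by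
        refine setIntegral_mono_on (integrableOn_const (by simp)) (hint.mono_set hsub)
          measurableSet_Ioc fun x hx => ?_
        have hx0 : 0 < x := hsub hx
        gcongr
        · exact hx.2
        · exact hx.1.le
    _ ≤ ∫ x in Ioi 0, Real.exp (-x) * x ^ (z - 1) := by
        refine setIntegral_mono_set hint ?_ hsub.eventuallyLE
        refine (ae_restrict_iff' measurableSet_Ioi).2 (Filter.Eventually.of_forall fun x hx => ?_)
        exact mul_nonneg (Real.exp_nonneg _) (Real.rpow_nonneg (le_of_lt hx) _)

theorem summable_pow_div_Gamma {β : ℝ} (hβ : 0 < β) {r : ℝ} (hr : 0 ≤ r) :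
    Summable fun m : ℕ => r ^ m / Real.Gamma (β * (m + 1)) := by
  -- This choice makes `L ^ β = 2 (r + 1)`, so the terms are dominated by a geometric series of
  -- ratio `1 / 2`.
  set L : ℝ := (2 * (r + 1)) ^ (1 / β) with hLdef
  have hr2 : (0 : ℝ) < 2 * (r + 1) := by positivity
  have hL : 0 < L := Real.rpow_pos_of_pos hr2 _
  have hLβ : L ^ β = 2 * (r + 1) := by
    rw [hLdef, ← Real.rpow_mul hr2.le, one_div, inv_mul_cancel₀ hβ.ne', Real.rpow_one]
  refine Summable.of_norm_bounded_eventually_nat (g := fun m : ℕ =>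
    L / Real.exp (-(L + 1)) * (1 / 2) ^ m) (summable_geometric_two.mul_left _) ?_
  -- From `n₀` on, `β (m + 1) ≥ 1`, as `Gamma_ge` requires.
  obtain ⟨n₀, hn₀⟩ := exists_nat_ge (1 / β)
  filter_upwards [Filter.eventually_ge_atTop n₀] with m hm
  have hm' : (n₀ : ℝ) ≤ m := by exact_mod_cast hm
  have hz : 1 ≤ β * ((m : ℝ) + 1) := by
    have := (div_le_iff₀ hβ).1 hn₀
    nlinarith
  have hΓ := Gamma_ge hL hz
  have hpow : L ^ (β * ((m : ℝ) + 1) - 1) = (2 * (r + 1)) ^ (m + 1) / L := by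
    rw [Real.rpow_sub hL, Real.rpow_mul hL.le, hLβ, Real.rpow_one]
    norm_cast
  rw [hpow] at hΓ
  have he := Real.exp_pos (-(L + 1))
  have hpos : 0 < Real.exp (-(L + 1)) * ((2 * (r + 1)) ^ (m + 1) / L) := by positivity
  rw [Real.norm_of_nonneg (div_nonneg (pow_nonneg hr _) (hpos.le.trans hΓ))]
  calc r ^ m / Real.Gamma (β * (m + 1))
      ≤ r ^ m / (Real.exp (-(L + 1)) * ((2 * (r + 1)) ^ (m + 1) / L)) := by
        gcongr
    _ = L / Real.exp (-(L + 1)) * (r ^ m / (2 * (r + 1)) ^ (m + 1)) := by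
        field_simp
    _ ≤ L / Real.exp (-(L + 1)) * (1 / 2) ^ m := by
        gcongr
        rw [div_pow, one_pow, div_le_div_iff₀ (by positivity) (by positivity)]
        calc r ^ m * 2 ^ m = (2 * r) ^ m := by rw [mul_pow]; ring
          _ ≤ (2 * (r + 1)) ^ m := by gcongr; linarith
          _ ≤ (2 * (r + 1)) ^ (m + 1) := by
              refine pow_le_pow_right₀ (by linarith) (Nat.le_succ m)
          _ = 1 * (2 * (r + 1)) ^ (m + 1) := (one_mul _).symm

/-! ### Quasi-nilpotence of the convolution operators -/

namespace WeakKernel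

theorem integral_weight_zero {s : ℝ} (hs : 0 < s) :
    ∫ θ in (0 : ℝ)..1, (1 - θ) ^ (s - 1) * θ ^ (-(0 : ℝ)) = 1 / s := by
  have := integral_beta hs one_pos
  simp only [sub_self] at this
  simp only [neg_zero]
  rw [this, Real.Gamma_one, Real.Gamma_add_one hs.ne']
  have := (Real.Gamma_pos_of_pos hs).ne'
  field_simp

theorem norm_opT_tempered_le {q p δ s : ℝ} (hq : 0 ≤ q) (hδ : δ ≤ 0) (hs : 0 < s) :
    ‖(temperedKernel δ s 0 hs le_rfl zero_lt_one hs).opT q p‖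
      ≤ q ^ s / (Real.Gamma s * s) := by
  have hΓ := Real.Gamma_pos_of_pos hs
  refine ContinuousLinearMap.opNorm_le_bound _ (by positivity) fun y => ?_
  refine (BoundedContinuousFunction.norm_le (by positivity)).2 fun ⟨t, x⟩ => ?_
  rw [opT_apply, Real.norm_eq_abs]
  have ht := clamp_mem hq t
  have := abs_conv_le_const (temperedKernel δ s 0 hs le_rfl zero_lt_one hs)
    (y := fun η => y (η, clamp p x)) ht.1 ht.2 (C := 1 / Real.Gamma s) (by positivity)
    (norm_nonneg y) ?_ (fun η => y.norm_coe_le_norm _)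
  · refine this.trans (le_of_eq ?_)
    simp only [temperedKernel, sub_zero]
    rw [integral_weight_zero hs]
    field_simp
  · intro r hr
    simp only [temperedKernel]
    rw [abs_div, Real.abs_exp, abs_of_pos hΓ]
    gcongr
    exact Real.exp_le_one_iff.2 (mul_nonpos_of_nonpos_of_nonneg hδ hr.1)

/-- The power `m + 1` is convolution of order `β (m + 1)`, whose norm carries `Γ(β (m + 1))` in the
denominator. The sign of `δ` removes the exponential from the bound. -/
theorem quasiNilpotent_opT_tempered {q p δ β : ℝ} (hq : 0 ≤ q) (hδ : δ ≤ 0) (hβ : 0 < β) :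
    QuasiNilpotent ((temperedKernel δ β 0 hβ le_rfl zero_lt_one hβ).opT q p) := by
  intro c hc
  -- The zeroth power is the identity and not a convolution, so the formula for powers starts at
  -- exponent one.
  refine (summable_nat_add_iff 1).1 ?_
  have hqβ : 0 ≤ c * q ^ β := mul_nonneg hc (Real.rpow_nonneg hq _)
  refine Summable.of_nonneg_of_le (fun m => by positivity) (fun m => ?_)
    ((summable_pow_div_Gamma hβ hqβ).mul_left (c * q ^ β / β))
  rw [pow_succ _ m, pow_succ _ m, opT_tempered_pow_mul hq hβ le_rfl zero_lt_one hβ m]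
  have hs := mul_natCast_add_one_pos hβ m
  have hΓ := Real.Gamma_pos_of_pos hs
  calc c ^ m * c * _ ≤ c ^ m * c * (q ^ (β * (m + 1)) /
        (Real.Gamma (β * (m + 1)) * (β * (m + 1)))) := by
        gcongr
        exact norm_opT_tempered_le hq hδ hs
    _ ≤ c ^ m * c * (q ^ (β * (m + 1)) / (Real.Gamma (β * (m + 1)) * (β * 1))) := by
        gcongr
        have : (0 : ℝ) ≤ m := m.cast_nonneg
        linarith
    _ = c * q ^ β / β * ((c * q ^ β) ^ m / Real.Gamma (β * (m + 1))) := by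
        have : q ^ (β * ((m : ℝ) + 1)) = (q ^ β) ^ m * q ^ β := by
          rw [Real.rpow_mul hq, ← pow_succ]; norm_cast
        rw [this, mul_pow]
        field_simp

/-- Iterated kernel bound for a kernel without singularity. -/
theorem abs_opT_pow_le {q p M : ℝ} (hq : 0 ≤ q) (k : WeakKernel) (hs : k.s = 1) (hε : k.ε = 0)
    (hM : ∀ r ∈ Icc 0 q, |k.e r| ≤ M) (y : Field₂) (n : ℕ) (t x : ℝ) :
    |(opT q p k ^ n) y (t, x)| ≤ M ^ n * (clamp q t) ^ n / n.factorial * ‖y‖ := by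
  have hM0 : 0 ≤ M := (abs_nonneg _).trans (hM 0 ⟨le_rfl, hq⟩)
  induction n generalizing t x with
  | zero => simpa using y.norm_coe_le_norm (t, x)
  | succ n ih =>
    rw [pow_succ']
    change |opT q p k ((opT q p k ^ n) y) (t, x)| ≤ _
    have ht := clamp_mem hq t
    rw [opT_apply, conv]
    simp only [hs, hε, sub_self, neg_zero, Real.rpow_zero, one_mul]
    rw [← Real.norm_eq_abs]
    have hint : ∫ η in (0 : ℝ)..clamp q t, M * (M ^ n * η ^ n / n.factorial * ‖y‖)
        = M ^ (n + 1) * (clamp q t) ^ (n + 1) / (n + 1).factorial * ‖y‖ := by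
      have : ∀ η : ℝ, M * (M ^ n * η ^ n / n.factorial * ‖y‖)
          = M ^ (n + 1) / n.factorial * ‖y‖ * η ^ n := fun η => by ring
      simp_rw [this]
      rw [intervalIntegral.integral_const_mul, integral_pow]
      push_cast [Nat.factorial_succ]
      simp
      field_simp
    rw [← hint]
    refine intervalIntegral.norm_integral_le_of_norm_le ht.1
      (Filter.Eventually.of_forall fun η hη => ?_)
      (Continuous.intervalIntegrable (by fun_prop) _ _)
    rw [norm_mul, Real.norm_eq_abs, Real.norm_eq_abs]
    have h1 := ih η (clamp p x)
    rw [clamp_of_mem ⟨hη.1.le, hη.2.trans ht.2⟩] at h1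
    exact mul_le_mul (hM _ ⟨by linarith [hη.2], by linarith [hη.1, ht.2]⟩) h1 (abs_nonneg _) hM0

theorem quasiNilpotent_opT {q p : ℝ} (hq : 0 ≤ q) (k : WeakKernel) (hs : k.s = 1)
    (hε : k.ε = 0) : QuasiNilpotent (opT q p k) := by
  obtain ⟨M, hM0, hM⟩ := k.exists_bound q
  intro c hc
  refine Summable.of_nonneg_of_le (fun n => by positivity) (fun n => ?_)
    (Real.summable_pow_div_factorial (c * (M * q)))
  have : ‖opT q p k ^ n‖ ≤ M ^ n * q ^ n / n.factorial := by
    refine ContinuousLinearMap.opNorm_le_bound _ (by positivity) fun y => ?_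
    refine (BoundedContinuousFunction.norm_le (by positivity)).2 fun ⟨t, x⟩ => ?_
    refine (abs_opT_pow_le hq k hs hε hM y n t x).trans ?_
    have ht := clamp_mem hq t
    have := ht.1
    gcongr
    exact ht.2
  calc c ^ n * _ ≤ c ^ n * (M ^ n * q ^ n / n.factorial) := by gcongr
    _ = _ := by rw [mul_pow, mul_pow]; ring

theorem norm_swapField_le : ‖swapField‖ ≤ 1 :=
  ContinuousLinearMap.opNorm_le_bound _ zero_le_one fun y => by
    rw [one_mul]
    exact (BoundedContinuousFunction.norm_le (norm_nonneg _)).2 fun z => y.norm_coe_le_norm _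

/-- Conjugation by the involution `swapField` carries the norm estimates from `t` to `x`. -/
theorem opX_pow (q p : ℝ) (k : WeakKernel) (n : ℕ) :
    opX q p k ^ n = swapField * (opT p q k ^ n * swapField) := by
  induction n with
  | zero => simp [swapField_mul_self]
  | succ n ih =>
    rw [pow_succ, ih, opX, pow_succ]
    rw [show swapField * (opT p q k ^ n * swapField) * (swapField * (opT p q k * swapField))
      = swapField * (opT p q k ^ n * (swapField * swapField) * opT p q k * swapField) by
        simp only [mul_assoc], swapField_mul_self, mul_one]

theorem quasiNilpotent_opX {q p : ℝ} (hp : 0 ≤ p) (k : WeakKernel) (hs : k.s = 1)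
    (hε : k.ε = 0) : QuasiNilpotent (opX q p k) := by
  intro c hc
  refine Summable.of_nonneg_of_le (fun n => by positivity) (fun n => ?_)
    (quasiNilpotent_opT (p := q) hp k hs hε c hc)
  rw [opX_pow]
  gcongr
  calc ‖swapField * (opT p q k ^ n * swapField)‖
      ≤ ‖swapField‖ * (‖opT p q k ^ n‖ * ‖swapField‖) :=
        (ContinuousLinearMap.opNorm_comp_le swapField (opT p q k ^ n * swapField)).trans
          (mul_le_mul_of_nonneg_left
            (ContinuousLinearMap.opNorm_comp_le (opT p q k ^ n) swapField) (norm_nonneg _))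
    _ ≤ 1 * (‖opT p q k ^ n‖ * 1) := by
        gcongr <;> exact norm_swapField_le
    _ = _ := by ring

end WeakKernel

/-! ### Series representations of the Mittag-Leffler type kernels -/

theorem Gamma_natCast_add_one (n : ℕ) : Real.Gamma ((n : ℝ) + 1) = n.factorial :=
  Real.Gamma_nat_eq_factorial n

theorem Gamma_natCast_add_two (n : ℕ) : Real.Gamma ((n : ℝ) + 2) = (n + 1).factorial := by
  rw [← Gamma_natCast_add_one]; push_cast; ring_nf

/-- The majorant of the double series. -/
noncomputable def seriesBound (β A B : ℝ) (i : ℕ × ℕ) : ℝ :=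
  2 * ((2 * A) ^ i.1 / Real.Gamma (β * (i.1 + 1)) * ((2 * B) ^ i.2 / i.2.factorial))

theorem Gamma_mul_succ_pos {β : ℝ} (hβ : 0 < β) (m : ℕ) : 0 < Real.Gamma (β * (m + 1)) :=
  Real.Gamma_pos_of_pos (mul_natCast_add_one_pos hβ m)

theorem summable_seriesBound {β A B : ℝ} (hβ : 0 < β) (hA : 0 ≤ A) (hB : 0 ≤ B) :
    Summable (seriesBound β A B) := by
  refine (Summable.mul_of_nonneg (summable_pow_div_Gamma hβ (r := 2 * A) (by positivity))
    (Real.summable_pow_div_factorial (2 * B)) (fun m => ?_) (fun j => by positivity)).mul_left 2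
  have := Gamma_mul_succ_pos hβ m
  positivity

theorem abs_term_le_seriesBound {β A B c x y E : ℝ} {m j : ℕ} (hβ : 0 < β)
    (hc : |c| ≤ 2 * 2 ^ m * 2 ^ j / j.factorial) (hx : |x| ≤ A) (hy : |y| ≤ B) {D : ℝ}
    (hE : |E| ≤ D) :
    |c * x ^ m * y ^ j * (E / Real.Gamma (β * (m + 1)))| ≤ seriesBound β A B (m, j) * D := by
  have hΓ := Gamma_mul_succ_pos hβ m
  have hA : 0 ≤ A := (abs_nonneg _).trans hx
  have hB : 0 ≤ B := (abs_nonneg _).trans hy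
  have hD : 0 ≤ D := (abs_nonneg _).trans hE
  rw [abs_mul, abs_mul, abs_mul, abs_pow, abs_pow, abs_div, abs_of_pos hΓ, seriesBound]
  calc |c| * |x| ^ m * |y| ^ j * (|E| / Real.Gamma (β * (m + 1)))
      ≤ (2 * 2 ^ m * 2 ^ j / j.factorial) * A ^ m * B ^ j * (D / Real.Gamma (β * (m + 1))) := by
        gcongr
    _ = _ := by rw [mul_pow, mul_pow]; ring

/-- The sum over `k` is carried out first, which is legitimate by absolute convergence. The factor
`c m j` does not involve `k`; the Gamma quotient does, and its series in `z` sums to `G m`. Taking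
`σ = β` gives `exp z` (kernels `F₃`, `F₄`), and `σ = β + 1` gives `expMoment` (kernels `F₁`, `F₂`).
-/
theorem hasSum_trivariateML {β κ l μ σ D : ℝ} (hβ : 0 < β) (x y z : ℝ) {c : ℕ → ℕ → ℝ}
    (hc : ∀ m j : ℕ, Real.Gamma (m + j + κ) /
      (Real.Gamma (m + l) * Real.Gamma (j + 1) * Real.Gamma (j + μ)) = c m j)
    (hcb : ∀ m j : ℕ, |c m j| ≤ 2 * 2 ^ m * 2 ^ j / j.factorial)
    {G : ℕ → ℝ} (hD : ∀ m k : ℕ,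
      |Real.Gamma (β * (m + 1) + k) / Real.Gamma (β * m + k + σ)| ≤ D)
    (hG : ∀ m : ℕ, HasSum (fun k : ℕ => Real.Gamma (β * (m + 1) + k) /
      Real.Gamma (β * m + k + σ) * (z ^ k / k.factorial)) (G m)) :
    HasSum (fun i : ℕ × ℕ => c i.1 i.2 * x ^ i.1 * y ^ i.2 *
        (G i.1 / Real.Gamma (β * (i.1 + 1))))
      (trivariateML β 1 β 1 1 κ β 1 σ β β 1 l 1 1 1 1 1 μ x y z) := by
  set F : ℕ × ℕ × ℕ → ℝ := fun i =>
    (Real.Gamma (β * i.1 + 1 * i.2.2 + β) * Real.Gamma (1 * i.1 + 1 * i.2.1 + κ) *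
        (x ^ i.1 * y ^ i.2.1 * z ^ i.2.2)) /
      (Real.Gamma (β * i.1 + 1 * i.2.2 + σ) * Real.Gamma (β * i.1 + β) *
        Real.Gamma (1 * i.1 + l) * Real.Gamma (1 * i.2.2 + 1) *
        Real.Gamma (1 * i.2.1 + 1) * Real.Gamma (1 * i.2.1 + μ)) with hF
  have hFe : ∀ m j k : ℕ, F (m, j, k) = c m j * x ^ m * y ^ j *
      (1 / Real.Gamma (β * (m + 1))) * (Real.Gamma (β * (m + 1) + k) /
      Real.Gamma (β * m + k + σ) * (z ^ k / k.factorial)) := by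
    intro m j k
    simp only [hF, one_mul, ← hc]
    rw [show β * (m : ℝ) + k + β = β * (m + 1) + k by ring, Gamma_natCast_add_one k,
      show β * (m : ℝ) + β = β * (m + 1) by ring]
    ring
  have hsum : Summable F := by
    have hb := Summable.mul_of_nonneg
      (summable_seriesBound hβ (abs_nonneg x) (abs_nonneg y))
      ((Real.summable_pow_div_factorial |z|).mul_left D) (fun i => ?_) (fun k => ?_)
    · refine (Equiv.prodAssoc ℕ ℕ ℕ).summable_iff.1 (Summable.of_norm_bounded hb ?_)
      rintro ⟨⟨m, j⟩, k⟩
      simp only [Function.comp, Equiv.prodAssoc_apply, hFe, Real.norm_eq_abs]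
      rw [abs_mul]
      have h1 := abs_term_le_seriesBound hβ (hcb m j) (le_refl |x|) (le_refl |y|)
        (le_of_eq (abs_one : |(1 : ℝ)| = 1))
      rw [mul_one] at h1
      refine mul_le_mul h1 ?_ (abs_nonneg _) ((abs_nonneg _).trans h1)
      rw [abs_mul, abs_div (z ^ k), abs_pow, Nat.abs_cast]
      gcongr
      exact hD m k
    · have := Gamma_mul_succ_pos hβ i.1
      simp only [Pi.zero_apply, seriesBound]
      positivity
    · have : 0 ≤ D := (abs_nonneg _).trans (hD 0 0)
      simp only [Pi.zero_apply]
      positivity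
  have h1 := (Equiv.prodAssoc ℕ ℕ ℕ).hasSum_iff.2 hsum.hasSum
  refine h1.prod_fiberwise (g := fun i : ℕ × ℕ => c i.1 i.2 * x ^ i.1 * y ^ i.2 *
        (G i.1 / Real.Gamma (β * (i.1 + 1)))) ?_
  rintro ⟨m, j⟩
  simp only [Function.comp, Equiv.prodAssoc_apply, hFe]
  have := (hG m).mul_left (c m j * x ^ m * y ^ j * (1 / Real.Gamma (β * (m + 1))))
  rwa [show c m j * x ^ m * y ^ j * (1 / Real.Gamma (β * (m + 1))) * G m
    = c m j * x ^ m * y ^ j * (G m / Real.Gamma (β * (m + 1))) by ring] at this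

theorem Gamma_ratio_self {β : ℝ} (hβ : 0 < β) (m k : ℕ) :
    Real.Gamma (β * (m + 1) + k) / Real.Gamma (β * m + k + β) = 1 := by
  rw [show β * (m : ℝ) + k + β = β * (m + 1) + k by ring]
  exact div_self (Real.Gamma_pos_of_pos (by positivity)).ne'

theorem Gamma_ratio_succ {β : ℝ} (hβ : 0 < β) (m k : ℕ) :
    Real.Gamma (β * (m + 1) + k) / Real.Gamma (β * m + k + (β + 1)) = 1 / (β * (m + 1) + k) := by
  have h : (0 : ℝ) < β * (m + 1) + k := by positivity
  rw [show β * (m : ℝ) + k + (β + 1) = (β * (m + 1) + k) + 1 by ring, Real.Gamma_add_one h.ne']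
  have := (Real.Gamma_pos_of_pos h).ne'
  field_simp

theorem hasSum_trivariateML_self {β κ l μ : ℝ} (hβ : 0 < β) (x y z : ℝ) {c : ℕ → ℕ → ℝ}
    (hc : ∀ m j : ℕ, Real.Gamma (m + j + κ) /
      (Real.Gamma (m + l) * Real.Gamma (j + 1) * Real.Gamma (j + μ)) = c m j)
    (hcb : ∀ m j : ℕ, |c m j| ≤ 2 * 2 ^ m * 2 ^ j / j.factorial) :
    HasSum (fun i : ℕ × ℕ => c i.1 i.2 * x ^ i.1 * y ^ i.2 *
        (Real.exp z / Real.Gamma (β * (i.1 + 1))))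
      (trivariateML β 1 β 1 1 κ β 1 β β β 1 l 1 1 1 1 1 μ x y z) := by
  refine hasSum_trivariateML hβ x y z hc hcb (G := fun _ => Real.exp z) (D := 1) ?_ ?_
  · intro m k
    rw [Gamma_ratio_self hβ, abs_one]
  · intro m
    simp only [Gamma_ratio_self hβ, one_mul]
    rw [Real.exp_eq_exp_ℝ]
    exact NormedSpace.expSeries_div_hasSum_exp z

theorem abs_Gamma_ratio_succ_le {β : ℝ} (hβ : 0 < β) (m k : ℕ) :
    |Real.Gamma (β * (m + 1) + k) / Real.Gamma (β * m + k + (β + 1))| ≤ 1 / β := by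
  have h : (0 : ℝ) < β * (m + 1) + k := by positivity
  rw [Gamma_ratio_succ hβ, abs_of_pos (by positivity)]
  have h1 : (0 : ℝ) ≤ β * m := by positivity
  have h2 : (0 : ℝ) ≤ k := by positivity
  gcongr
  linarith

theorem hasSum_Gamma_ratio_succ {β : ℝ} (hβ : 0 < β) (z : ℝ) (m : ℕ) :
    HasSum (fun k : ℕ => Real.Gamma (β * (m + 1) + k) /
      Real.Gamma (β * m + k + (β + 1)) * (z ^ k / k.factorial)) (expMoment (β * (m + 1)) z) := by
  have h := hasSum_expMoment (mul_natCast_add_one_pos hβ m) z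
  refine (congrArg (fun f => HasSum f _) (funext fun k => ?_)).mp h
  rw [Gamma_ratio_succ hβ]
  have : (0 : ℝ) < β * (m + 1) + k := by positivity
  field_simp

theorem hasSum_trivariateML_succ {β κ l μ : ℝ} (hβ : 0 < β) (x y z : ℝ) {c : ℕ → ℕ → ℝ}
    (hc : ∀ m j : ℕ, Real.Gamma (m + j + κ) /
      (Real.Gamma (m + l) * Real.Gamma (j + 1) * Real.Gamma (j + μ)) = c m j)
    (hcb : ∀ m j : ℕ, |c m j| ≤ 2 * 2 ^ m * 2 ^ j / j.factorial) :
    HasSum (fun i : ℕ × ℕ => c i.1 i.2 * x ^ i.1 * y ^ i.2 *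
        (expMoment (β * (i.1 + 1)) z / Real.Gamma (β * (i.1 + 1))))
      (trivariateML β 1 β 1 1 κ β 1 (β + 1) β β 1 l 1 1 1 1 1 μ x y z) :=
  hasSum_trivariateML hβ x y z hc hcb (G := fun m => expMoment (β * (m + 1)) z)
    (abs_Gamma_ratio_succ_le hβ) (hasSum_Gamma_ratio_succ hβ z)

theorem hasSum_bivariateML {β : ℝ} (hβ : 0 < β) (x z : ℝ) :
    HasSum (fun m : ℕ => x ^ m * (expMoment (β * (m + 1)) z / Real.Gamma (β * (m + 1))))
      (Real.Gamma β * bivariateML β 1 β 0 1 β 1 (β + 1) β β 1 1 x z) := by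
  have hΓ := (Real.Gamma_pos_of_pos hβ).ne'
  rw [bivariateML, ← tsum_mul_left]
  set F : ℕ × ℕ → ℝ := fun i => Real.Gamma β *
    ((Real.Gamma (β * i.1 + 1 * i.2 + β) * Real.Gamma (0 * i.1 + 1)) /
      (Real.Gamma β * Real.Gamma 1 * Real.Gamma (β * i.1 + 1 * i.2 + (β + 1))) *
      (x ^ i.1 / Real.Gamma (β * i.1 + β)) * (z ^ i.2 / Real.Gamma (1 * i.2 + 1))) with hF
  have hFe : ∀ m k : ℕ, F (m, k) = x ^ m / Real.Gamma (β * (m + 1)) *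
      (Real.Gamma (β * (m + 1) + k) / Real.Gamma (β * m + k + (β + 1)) *
        (z ^ k / k.factorial)) := by
    intro m k
    simp only [hF, one_mul, zero_mul, zero_add, Real.Gamma_one, mul_one]
    rw [show β * (m : ℝ) + k + β = β * (m + 1) + k by ring, Gamma_natCast_add_one k,
      show β * (m : ℝ) + β = β * (m + 1) by ring]
    field_simp
  have hsum : Summable F := by
    refine Summable.of_norm_bounded (Summable.mul_of_nonneg
      (summable_pow_div_Gamma hβ (abs_nonneg x))
      ((Real.summable_pow_div_factorial |z|).mul_left (1 / β)) (fun m => ?_)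
      (fun k => by simp only [Pi.zero_apply]; positivity)) ?_
    · have := Gamma_mul_succ_pos hβ m
      simp only [Pi.zero_apply]
      positivity
    · rintro ⟨m, k⟩
      rw [hFe, Real.norm_eq_abs, abs_mul, abs_mul, abs_div, abs_div (z ^ k), abs_pow, abs_pow,
        Nat.abs_cast, abs_of_pos (Gamma_mul_succ_pos hβ m)]
      have := Gamma_mul_succ_pos hβ m
      gcongr
      exact abs_Gamma_ratio_succ_le hβ m k
  refine hsum.hasSum.prod_fiberwise fun m => ?_
  simp only [hFe]
  have := (hasSum_Gamma_ratio_succ hβ z m).mul_left (x ^ m / Real.Gamma (β * (m + 1)))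
  rwa [div_mul_eq_mul_div, mul_div_assoc] at this

/-! ### The coefficients -/

/-- Splitting off the first row of a double series. -/
theorem HasSum.of_first_row {f : ℕ × ℕ → ℝ} {S₀ S₁ : ℝ} (h₀ : HasSum (fun j => f (0, j)) S₀)
    (h₁ : HasSum (fun i : ℕ × ℕ => f (i.1 + 1, i.2)) S₁) : HasSum f (S₀ + S₁) := by
  have i0 : Function.Injective (fun j : ℕ => ((0, j) : ℕ × ℕ)) := fun a b h => by simpa using h
  have i1 : Function.Injective (fun i : ℕ × ℕ => ((i.1 + 1, i.2) : ℕ × ℕ)) := by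
    rintro ⟨a, b⟩ ⟨c, d⟩ h
    simpa using h
  have a0 := i0.hasSum_range_iff (f := f) |>.2 h₀
  have a1 := i1.hasSum_range_iff (f := f) |>.2 h₁
  refine HasSum.add_isCompl (isCompl_iff.2 ⟨?_, ?_⟩) a0 a1
  · rw [Set.disjoint_left]
    rintro _ ⟨j, rfl⟩ ⟨i, hi⟩
    simp at hi
  · refine codisjoint_iff.2 (Set.eq_univ_iff_forall.2 ?_)
    rintro ⟨_ | m, j⟩
    · exact Or.inl ⟨j, rfl⟩
    · exact Or.inr ⟨(m, j), rfl⟩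

/-- Splitting off the first column of a double series. -/
theorem HasSum.of_first_col {f : ℕ × ℕ → ℝ} {S₀ S₁ : ℝ} (h₀ : HasSum (fun m => f (m, 0)) S₀)
    (h₁ : HasSum (fun i : ℕ × ℕ => f (i.1, i.2 + 1)) S₁) : HasSum f (S₀ + S₁) := by
  refine (Equiv.prodComm ℕ ℕ).hasSum_iff.1 (HasSum.of_first_row h₀ ?_)
  exact (Equiv.prodComm ℕ ℕ).hasSum_iff.1 h₁

theorem choose_add_one_le (m j i : ℕ) : ((m + j + 1).choose i : ℝ) ≤ 2 * 2 ^ m * 2 ^ j := by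
  have : ((m + j + 1).choose i : ℝ) ≤ 2 ^ (m + j + 1) := by
    exact_mod_cast Nat.choose_le_two_pow _ _
  rw [pow_succ, pow_add] at this
  linarith

/-- At integers the Gamma functions are factorials. In all four cases the coefficient becomes a
binomial coefficient of the series `N`, with `m` or `j` shifted by one where a first row or column
is split off, over the factorial left by integrating in `x`. -/
theorem coeff₁_eq (m j : ℕ) : Real.Gamma ((m : ℝ) + j + 2) /
    (Real.Gamma (m + 2) * Real.Gamma (j + 1) * Real.Gamma (j + 1))
      = (m + j + 1).choose (m + 1) / j.factorial := by
  have h := Gamma_natCast_add_two (m + j)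
  push_cast at h
  rw [h, Gamma_natCast_add_two, Gamma_natCast_add_one,
    Nat.cast_choose ℝ (show m + 1 ≤ m + j + 1 by lia), show m + j + 1 - (m + 1) = j by lia]
  field_simp

theorem coeff₂_eq (m j : ℕ) : Real.Gamma ((m : ℝ) + j + 2) /
    (Real.Gamma (m + 1) * Real.Gamma (j + 1) * Real.Gamma (j + 2))
      = (m + j + 1).choose m / j.factorial := by
  have h := Gamma_natCast_add_two (m + j)
  push_cast at h
  rw [h, Gamma_natCast_add_two, Gamma_natCast_add_one, Gamma_natCast_add_one,
    Nat.cast_choose ℝ (show m ≤ m + j + 1 by lia), show m + j + 1 - m = j + 1 by lia]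
  field_simp

theorem coeff₃_eq (m j : ℕ) : Real.Gamma ((m : ℝ) + j + 2) /
    (Real.Gamma (m + 2) * Real.Gamma (j + 1) * Real.Gamma (j + 2))
      = (m + j + 1).choose (m + 1) / (j + 1).factorial := by
  have h := Gamma_natCast_add_two (m + j)
  push_cast at h
  rw [h, Gamma_natCast_add_two, Gamma_natCast_add_one, Gamma_natCast_add_two,
    Nat.cast_choose ℝ (show m + 1 ≤ m + j + 1 by lia), show m + j + 1 - (m + 1) = j by lia]
  field_simp

theorem coeff₄_eq (m j : ℕ) : Real.Gamma ((m : ℝ) + j + 1) /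
    (Real.Gamma (m + 1) * Real.Gamma (j + 1) * Real.Gamma (j + 1))
      = (m + j).choose m / j.factorial := by
  have h := Gamma_natCast_add_one (m + j)
  push_cast at h
  rw [h, Gamma_natCast_add_one, Gamma_natCast_add_one,
    Nat.cast_choose ℝ (show m ≤ m + j by lia), show m + j - m = j by lia]
  field_simp

theorem abs_choose_div_le (m j i : ℕ) :
    |((m + j + 1).choose i : ℝ) / j.factorial| ≤ 2 * 2 ^ m * 2 ^ j / j.factorial := by
  rw [abs_of_nonneg (by positivity)]
  gcongr
  exact choose_add_one_le m j i

theorem abs_choose_div_succ_le (m j i : ℕ) :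
    |((m + j + 1).choose i : ℝ) / (j + 1).factorial| ≤ 2 * 2 ^ m * 2 ^ j / j.factorial := by
  rw [abs_of_nonneg (by positivity)]
  have : (j.factorial : ℝ) ≤ (j + 1).factorial := by
    exact_mod_cast Nat.factorial_le (Nat.le_succ j)
  gcongr
  exact choose_add_one_le m j i

theorem abs_choose_self_div_le (m j : ℕ) :
    |((m + j).choose m : ℝ) / j.factorial| ≤ 2 * 2 ^ m * 2 ^ j / j.factorial := by
  rw [abs_of_nonneg (by positivity)]
  gcongr
  have := choose_le_two_pow_mul m j
  have : (0 : ℝ) ≤ 2 ^ m * 2 ^ j := by positivity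
  linarith

/-! ### The kernels `E`, `F₁`, ..., `F₄` as single and double series -/

namespace TelegraphProblem

/-- The standing assumptions on the parameters. -/
structure Admissible (P : TelegraphProblem) : Prop where
  q_pos : 0 < P.q
  p_pos : 0 < P.p
  α_eq : P.α = 1
  β_pos : 0 < P.β
  β_lt_one : P.β < 1
  γ_eq : P.γ = P.β
  δ_neg : P.δ < 0

variable {P : TelegraphProblem}

theorem Admissible.hasSum_kernelE (h : P.Admissible) (t : ℝ) :
    HasSum (fun m : ℕ => (P.a * t ^ P.β) ^ m *
      (expMoment (P.β * (m + 1)) (P.δ * t) / Real.Gamma (P.β * (m + 1))))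
      (Real.Gamma P.γ * P.kernelE t) := by
  have := hasSum_bivariateML h.β_pos (P.a * t ^ P.β) (P.δ * t)
  rw [kernelE, h.γ_eq, h.α_eq, Real.rpow_one]
  exact this

theorem Admissible.hasSum_kernelF₁ (h : P.Admissible) (t x : ℝ) :
    HasSum (fun i : ℕ × ℕ => ((i.1 + i.2 + 1).choose (i.1 + 1) : ℝ) / i.2.factorial *
      (P.a * t ^ P.β) ^ i.1 * (P.b * x) ^ i.2 *
      (expMoment (P.β * (i.1 + 1)) (P.δ * t) / Real.Gamma (P.β * (i.1 + 1))))
      (P.kernelF₁ t x) := by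
  rw [kernelF₁, h.γ_eq, h.α_eq, Real.rpow_one]
  exact hasSum_trivariateML_succ (κ := 2) (l := 2) (μ := 1)
    (c := fun m j => ((m + j + 1).choose (m + 1) : ℝ) / j.factorial)
    h.β_pos _ _ _ coeff₁_eq fun m j => abs_choose_div_le m j (m + 1)

theorem Admissible.hasSum_kernelF₂ (h : P.Admissible) (t x : ℝ) :
    HasSum (fun i : ℕ × ℕ => ((i.1 + i.2 + 1).choose i.1 : ℝ) / i.2.factorial *
      (P.a * t ^ P.β) ^ i.1 * (P.b * x) ^ i.2 *
      (expMoment (P.β * (i.1 + 1)) (P.δ * t) / Real.Gamma (P.β * (i.1 + 1))))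
      (P.kernelF₂ t x) := by
  rw [kernelF₂, h.γ_eq, h.α_eq, Real.rpow_one]
  exact hasSum_trivariateML_succ (κ := 2) (l := 1) (μ := 2)
    (c := fun m j => ((m + j + 1).choose m : ℝ) / j.factorial)
    h.β_pos _ _ _ coeff₂_eq fun m j => abs_choose_div_le m j m

theorem Admissible.hasSum_kernelF₃ (h : P.Admissible) (t x : ℝ) :
    HasSum (fun i : ℕ × ℕ => ((i.1 + i.2 + 1).choose (i.1 + 1) : ℝ) / (i.2 + 1).factorial *
      (P.a * t ^ P.β) ^ i.1 * (P.b * x) ^ i.2 *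
      (Real.exp (P.δ * t) / Real.Gamma (P.β * (i.1 + 1))))
      (P.kernelF₃ t x) := by
  rw [kernelF₃, h.γ_eq, h.α_eq, Real.rpow_one]
  exact hasSum_trivariateML_self (κ := 2) (l := 2) (μ := 2)
    (c := fun m j => ((m + j + 1).choose (m + 1) : ℝ) / (j + 1).factorial)
    h.β_pos _ _ _ coeff₃_eq
    fun m j => abs_choose_div_succ_le m j (m + 1)

theorem Admissible.hasSum_kernelF₄ (h : P.Admissible) (t x : ℝ) :
    HasSum (fun i : ℕ × ℕ => ((i.1 + i.2).choose i.1 : ℝ) / i.2.factorial *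
      (P.a * t ^ P.β) ^ i.1 * (P.b * x) ^ i.2 *
      (Real.exp (P.δ * t) / Real.Gamma (P.β * (i.1 + 1))))
      (P.kernelF₄ t x) := by
  rw [kernelF₄, h.γ_eq, h.α_eq, Real.rpow_one]
  exact hasSum_trivariateML_self (κ := 1) (l := 1) (μ := 1)
    (c := fun m j => ((m + j).choose m : ℝ) / j.factorial)
    h.β_pos _ _ _ coeff₄_eq fun m j => abs_choose_self_div_le m j

end TelegraphProblem

/-! ### Lifting continuous functions on the rectangle -/

/-- The bounded continuous extension of a function continuous on `[0,q] × [0,p]`. -/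
noncomputable def liftField {q p : ℝ} (hq : 0 ≤ q) (hp : 0 ≤ p) (g : ℝ → ℝ → ℝ)
    (hg : ContinuousOn (fun z : ℝ × ℝ => g z.1 z.2) (Icc 0 q ×ˢ Icc 0 p)) : Field₂ :=
  BoundedContinuousFunction.ofNormedAddCommGroup
    (fun z : ℝ × ℝ => g (clamp q z.1) (clamp p z.2))
    (hg.comp_continuous (f := fun z : ℝ × ℝ => (clamp q z.1, clamp p z.2)) (by fun_prop)
      fun z => ⟨clamp_mem hq z.1, clamp_mem hp z.2⟩)
    ((isCompact_Icc.prod isCompact_Icc).exists_bound_of_continuousOn hg).choose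
    fun z => ((isCompact_Icc.prod isCompact_Icc).exists_bound_of_continuousOn hg).choose_spec
      (clamp q z.1, clamp p z.2) ⟨clamp_mem hq z.1, clamp_mem hp z.2⟩

theorem liftField_apply {q p : ℝ} (hq : 0 ≤ q) (hp : 0 ≤ p) (g : ℝ → ℝ → ℝ)
    (hg : ContinuousOn (fun z : ℝ × ℝ => g z.1 z.2) (Icc 0 q ×ˢ Icc 0 p)) (t x : ℝ) :
    liftField hq hp g hg (t, x) = g (clamp q t) (clamp p x) := rfl

theorem liftField_of_mem {q p : ℝ} (hq : 0 ≤ q) (hp : 0 ≤ p) (g : ℝ → ℝ → ℝ)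
    (hg : ContinuousOn (fun z : ℝ × ℝ => g z.1 z.2) (Icc 0 q ×ˢ Icc 0 p)) {t x : ℝ}
    (ht : t ∈ Icc 0 q) (hx : x ∈ Icc 0 p) :
    liftField hq hp g hg (t, x) = g t x := by
  rw [liftField_apply, clamp_of_mem ht, clamp_of_mem hx]

/-! ### Termwise integration -/

/-- Dominated convergence with the singular factor `w` kept apart, so that only the continuous
factors need uniform summable bounds. -/
theorem hasSum_integral_weight {ι : Type*} [Countable ι] {t : ℝ} (ht : 0 ≤ t) {w : ℝ → ℝ}
    (hw : IntervalIntegrable w volume 0 t) {g : ι → ℝ → ℝ} {S : ℝ → ℝ} {B : ι → ℝ}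
    (hg : ∀ i, ContinuousOn (g i) (Icc 0 t)) (hB : ∀ i, ∀ η ∈ Icc 0 t, |g i η| ≤ B i)
    (hBs : Summable B) (hS : ∀ η ∈ Icc 0 t, HasSum (fun i => g i η) (S η)) :
    HasSum (fun i => ∫ η in (0 : ℝ)..t, w η * g i η) (∫ η in (0 : ℝ)..t, w η * S η) := by
  have hsub : ∀ η ∈ uIoc 0 t, η ∈ Icc 0 t := fun η hη => by
    rw [uIoc_of_le ht] at hη; exact Ioc_subset_Icc_self hη
  refine intervalIntegral.hasSum_integral_of_dominated_convergence
    (fun i η => ‖w η‖ * B i) (fun i => ?_) (fun i => ?_) ?_ ?_ ?_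
  · have := hw.mul_continuousOn (g := g i) (by rw [uIcc_of_le ht]; exact hg i)
    exact (intervalIntegrable_iff.1 this).aestronglyMeasurable
  · refine Filter.Eventually.of_forall fun η hη => ?_
    rw [norm_mul]
    exact mul_le_mul_of_nonneg_left (hB i η (hsub η hη)) (norm_nonneg _)
  · exact Filter.Eventually.of_forall fun η _ => hBs.mul_left _
  · simp_rw [tsum_mul_left]
    exact hw.norm.mul_const _
  · exact Filter.Eventually.of_forall fun η hη => (hS η (hsub η hη)).mul_left _

/-! ### Iterated integrals as tempered convolutions -/

theorem conv_space_eq {ε : ℝ} (j : ℕ) {hs : (0 : ℝ) < 1 * (j + 1)} {hε₀ : 0 ≤ ε} {hε : ε < 1}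
    {hεs : ε < 1 * ((j : ℝ) + 1)} (y : ℝ → ℝ) (x : ℝ) :
    (temperedKernel 0 (1 * (j + 1)) ε hs hε₀ hε hεs).conv y x
      = ∫ ξ in (0 : ℝ)..x, (x - ξ) ^ j / j.factorial * (ξ ^ (-ε) * y ξ) := by
  refine intervalIntegral.integral_congr fun ξ _ => ?_
  simp only [temperedKernel, one_mul, zero_mul, Real.exp_zero, Gamma_natCast_add_one,
    add_sub_cancel_right, Real.rpow_natCast]
  ring

theorem rpow_mul_succ_sub_one {β r : ℝ} (hr : 0 < r) (m : ℕ) :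
    r ^ (β * (m + 1) - 1) = r ^ (β - 1) * (r ^ β) ^ m := by
  rw [← Real.rpow_natCast, ← Real.rpow_mul hr.le, ← Real.rpow_add hr]
  congr 1
  ring

theorem conv_time_eq {β δ ε : ℝ} (m : ℕ) {hs : 0 < β * ((m : ℝ) + 1)} {hε₀ : 0 ≤ ε}
    {hε : ε < 1} {hεs : ε < β * ((m : ℝ) + 1)} (y : ℝ → ℝ) {t : ℝ} (ht : 0 ≤ t) :
    (temperedKernel δ (β * (m + 1)) ε hs hε₀ hε hεs).conv y t
      = ∫ η in (0 : ℝ)..t, (t - η) ^ (β - 1) * (η ^ (-ε) * y η) *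
          (((t - η) ^ β) ^ m * (Real.exp (δ * (t - η)) / Real.Gamma (β * (m + 1)))) := by
  -- The point `η = t` is removed because the power of `t - η` splits only for a positive base.
  rw [WeakKernel.conv, intervalIntegral.integral_of_le ht, intervalIntegral.integral_of_le ht,
    integral_Ioc_eq_integral_Ioo, integral_Ioc_eq_integral_Ioo]
  refine setIntegral_congr_fun measurableSet_Ioo fun η hη => ?_
  simp only [temperedKernel]
  rw [rpow_mul_succ_sub_one (by linarith [hη.2])]
  ring

/-- The iterated fractional integral of the constant `1`. -/
noncomputable def timeMoment (β δ : ℝ) (m : ℕ) (t : ℝ) : ℝ :=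
  t ^ β * (t ^ β) ^ m * (expMoment (β * (m + 1)) (δ * t) / Real.Gamma (β * (m + 1)))

theorem conv_time_one {β δ : ℝ} (m : ℕ) {hs : 0 < β * ((m : ℝ) + 1)} {t : ℝ} (ht : 0 ≤ t) :
    (temperedKernel δ (β * (m + 1)) 0 hs le_rfl zero_lt_one hs).conv (fun _ => 1) t
      = timeMoment β δ m t := by
  rw [conv_tempered_one hs ht, timeMoment, Real.rpow_mul ht]
  have : (t ^ β) ^ ((m : ℝ) + 1) = t ^ β * (t ^ β) ^ m := by
    rw [← pow_succ']; norm_cast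
  rw [this]
  ring

/-! ### The operators `I` and `X`, their powers, and the resolvent `N` -/

namespace TelegraphProblem

/-- Integration from `0` in the variable `x`, with weight `x ^ (-ε)`. -/
noncomputable def spaceInt (P : TelegraphProblem) (ε : ℝ) (hε₀ : 0 ≤ ε) (hε : ε < 1) :
    Field₂ →L[ℝ] Field₂ :=
  (temperedKernel 0 1 ε one_pos hε₀ hε hε).opX P.q P.p

/-- The inverse of the Prabhakar derivative, with weight `t ^ (-ε)`. -/
noncomputable def fracInt (P : TelegraphProblem) (hβ : 0 < P.β) (ε : ℝ) (hε₀ : 0 ≤ ε)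
    (hε : ε < 1) (hεβ : ε < P.β) : Field₂ →L[ℝ] Field₂ :=
  (temperedKernel P.δ P.β ε hβ hε₀ hε hεβ).opT P.q P.p

variable {P : TelegraphProblem}

namespace Admissible

/-- Integration in `x`. -/
noncomputable def X (_ : P.Admissible) : Field₂ →L[ℝ] Field₂ := P.spaceInt 0 le_rfl zero_lt_one

/-- The fractional integral in `t`. -/
noncomputable def I (h : P.Admissible) : Field₂ →L[ℝ] Field₂ :=
  P.fracInt h.β_pos 0 le_rfl zero_lt_one h.β_pos

theorem q_nonneg (h : P.Admissible) : 0 ≤ P.q := h.q_pos.le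

theorem p_nonneg (h : P.Admissible) : 0 ≤ P.p := h.p_pos.le

theorem commute_I_X (h : P.Admissible) : Commute h.I h.X :=
  WeakKernel.commute_opT_opX h.q_nonneg h.p_nonneg _ _

theorem quasiNilpotent_I (h : P.Admissible) : QuasiNilpotent h.I :=
  WeakKernel.quasiNilpotent_opT_tempered h.q_nonneg h.δ_neg.le h.β_pos

theorem quasiNilpotent_X (h : P.Admissible) : QuasiNilpotent h.X :=
  WeakKernel.quasiNilpotent_opX h.p_nonneg _ rfl rfl

theorem exists_resolvent (h : P.Admissible) : ∃ N : Field₂ →L[ℝ] Field₂,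
    (∀ w, HasSum (fun i : ℕ × ℕ => ((i.1 + i.2).choose i.1 : ℝ) •
      (P.a ^ i.1 * P.b ^ i.2) • (h.I ^ i.1) ((h.X ^ i.2) w)) (N w)) ∧
    (∀ w, N (w - P.a • h.I w - P.b • h.X w) = w) ∧
    ∀ w, N w - P.a • h.I (N w) - P.b • h.X (N w) = w :=
  h.commute_I_X.exists_resolvent h.quasiNilpotent_I h.quasiNilpotent_X P.a P.b

/-- The inverse of `1 - a I - b X`. -/
noncomputable def N (h : P.Admissible) : Field₂ →L[ℝ] Field₂ := h.exists_resolvent.choose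

theorem N_apply_sub (h : P.Admissible) (w : Field₂) :
    h.N (w - P.a • h.I w - P.b • h.X w) = w :=
  h.exists_resolvent.choose_spec.2.1 w

theorem N_sub (h : P.Admissible) (w : Field₂) :
    h.N w - P.a • h.I (h.N w) - P.b • h.X (h.N w) = w :=
  h.exists_resolvent.choose_spec.2.2 w

theorem hasSum_N (h : P.Admissible) (w : Field₂) (z : ℝ × ℝ) :
    HasSum (fun i : ℕ × ℕ => ((i.1 + i.2).choose i.1 : ℝ) *
      (P.a ^ i.1 * P.b ^ i.2 * (h.I ^ i.1) ((h.X ^ i.2) w) z)) (h.N w z) :=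
  (h.exists_resolvent.choose_spec.1 w).mapL (BoundedContinuousFunction.evalCLM ℝ z)

/-- Cauchy's formula for repeated integration, where the innermost of the `j + 1` integrals carries
the weight. -/
theorem X_pow_succ_apply (h : P.Admissible) {ε : ℝ} (hε₀ : 0 ≤ ε) (hε : ε < 1) (j : ℕ)
    (w : Field₂) (t x : ℝ) :
    (h.X ^ j) (P.spaceInt ε hε₀ hε w) (t, x) = ∫ ξ in (0 : ℝ)..clamp P.p x,
      (clamp P.p x - ξ) ^ j / j.factorial * (ξ ^ (-ε) * w (clamp P.q t, ξ)) := by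
  have := opX_tempered_pow_mul (q := P.q) (p := P.p) (δ := 0) h.p_nonneg one_pos hε₀ hε hε j
  change ((h.X ^ j) * P.spaceInt ε hε₀ hε) w (t, x) = _
  rw [X, spaceInt, spaceInt, this, WeakKernel.opX_apply, conv_space_eq]

theorem I_pow_mul_fracInt (h : P.Admissible) {ε : ℝ} (hε₀ : 0 ≤ ε) (hε : ε < 1) (hεβ : ε < P.β)
    (m : ℕ) : h.I ^ m * P.fracInt h.β_pos ε hε₀ hε hεβ =
      (temperedKernel P.δ (P.β * (m + 1)) ε (mul_natCast_add_one_pos h.β_pos m) hε₀ hε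
        (lt_mul_natCast_add_one h.β_pos hεβ m)).opT P.q P.p :=
  opT_tempered_pow_mul h.q_nonneg h.β_pos hε₀ hε hεβ m

theorem I_pow_succ_apply (h : P.Admissible) {ε : ℝ} (hε₀ : 0 ≤ ε) (hε : ε < 1) (hεβ : ε < P.β)
    (m : ℕ) (w : Field₂) (t x : ℝ) :
    (h.I ^ m) (P.fracInt h.β_pos ε hε₀ hε hεβ w) (t, x) = ∫ η in (0 : ℝ)..clamp P.q t,
      (clamp P.q t - η) ^ (P.β - 1) * (η ^ (-ε) * w (η, clamp P.p x)) *
      (((clamp P.q t - η) ^ P.β) ^ m *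
        (Real.exp (P.δ * (clamp P.q t - η)) / Real.Gamma (P.β * (m + 1)))) := by
  change ((h.I ^ m) * P.fracInt h.β_pos ε hε₀ hε hεβ) w (t, x) = _
  rw [h.I_pow_mul_fracInt, WeakKernel.opT_apply, conv_time_eq _ _ (clamp_nonneg _ _)]

/-- Iterated integrals in `x` of a function independent of `x`. -/
theorem X_pow_apply_of_const (h : P.Admissible) {w : Field₂} {y : ℝ → ℝ}
    (hw : ∀ t ∈ Icc 0 P.q, ∀ x ∈ Icc 0 P.p, w (t, x) = y t) (j : ℕ) {t x : ℝ}
    (ht : t ∈ Icc 0 P.q) (hx : x ∈ Icc 0 P.p) :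
    (h.X ^ j) w (t, x) = x ^ j / j.factorial * y t := by
  cases j with
  | zero => simp [hw t ht x hx]
  | succ j =>
    rw [pow_succ]
    change (h.X ^ j) (P.spaceInt 0 _ _ w) (t, x) = _
    rw [h.X_pow_succ_apply, clamp_of_mem ht, clamp_of_mem hx]
    have e : ∫ ξ in (0 : ℝ)..x, (x - ξ) ^ j / j.factorial * (ξ ^ (-(0 : ℝ)) * w (t, ξ))
        = ∫ ξ in (0 : ℝ)..x, (y t / j.factorial) * (x - ξ) ^ j := by
      refine intervalIntegral.integral_congr fun ξ hξ => ?_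
      rw [uIcc_of_le hx.1] at hξ
      simp only [neg_zero, Real.rpow_zero, one_mul]
      rw [hw t ht ξ ⟨hξ.1, hξ.2.trans hx.2⟩]
      ring
    have e2 := intervalIntegral.integral_comp_sub_left (a := 0) (b := x) (fun ξ : ℝ => ξ ^ j) x
    rw [e, intervalIntegral.integral_const_mul, e2, integral_pow]
    push_cast [Nat.factorial_succ]
    simp
    field_simp

/-- `I` acts on each line `x = const` separately, so a factor that depends on `x` alone passes
through it. -/
theorem I_congr (h : P.Admissible) {w w' : Field₂} {t x c : ℝ} (ht : t ∈ Icc 0 P.q)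
    (hw : ∀ η ∈ Icc 0 P.q, w (η, clamp P.p x) = c * w' (η, clamp P.p x)) :
    h.I w (t, x) = c * h.I w' (t, x) := by
  rw [I, fracInt, WeakKernel.opT_apply, WeakKernel.opT_apply, ← WeakKernel.conv_const_mul]
  refine WeakKernel.conv_congr _ (clamp_nonneg _ _) fun η hη => hw η ⟨hη.1, hη.2.trans ?_⟩
  rw [clamp_of_mem ht]
  exact ht.2

theorem I_pow_congr (h : P.Admissible) {w w' : Field₂} {x c : ℝ} (hx : x ∈ Icc 0 P.p)
    (hw : ∀ η ∈ Icc 0 P.q, w (η, x) = c * w' (η, x)) (m : ℕ) {t : ℝ} (ht : t ∈ Icc 0 P.q) :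
    (h.I ^ m) w (t, x) = c * (h.I ^ m) w' (t, x) := by
  induction m generalizing t with
  | zero => exact hw t ht
  | succ m ih =>
    rw [pow_succ']
    change h.I ((h.I ^ m) w) (t, x) = c * h.I ((h.I ^ m) w') (t, x)
    refine h.I_congr ht fun η hη => ?_
    rw [clamp_of_mem hx]
    exact ih hη

theorem I_pow_succ_one (h : P.Admissible) (m : ℕ) {t x : ℝ} (ht : t ∈ Icc 0 P.q) :
    (h.I ^ (m + 1)) 1 (t, x) = timeMoment P.β P.δ m t := by
  rw [pow_succ]
  change ((h.I ^ m) * P.fracInt h.β_pos 0 le_rfl zero_lt_one h.β_pos) 1 (t, x) = _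
  rw [h.I_pow_mul_fracInt, WeakKernel.opT_apply, clamp_of_mem ht]
  exact conv_time_one m ht.1

/-- Iterated fractional integrals of a function independent of `t`. -/
theorem I_pow_succ_apply_of_const (h : P.Admissible) {w : Field₂} {x c : ℝ}
    (hx : x ∈ Icc 0 P.p) (hw : ∀ η ∈ Icc 0 P.q, w (η, x) = c) (m : ℕ) {t : ℝ}
    (ht : t ∈ Icc 0 P.q) :
    (h.I ^ (m + 1)) w (t, x) = c * timeMoment P.β P.δ m t := by
  rw [h.I_pow_congr (w' := 1) (c := c) hx (fun η hη => by rw [hw η hη]; simp) (m + 1) ht,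
    h.I_pow_succ_one m ht]

/-! ### The four series in terms of the operators -/

/-- The row `m = 0` involves no `I` and sums to the exponential; the rows `m + 1` contain `a t ^ β`
as a common factor and form `F₁`. -/
theorem N_one (h : P.Admissible) {t x : ℝ} (ht : t ∈ Icc 0 P.q) (hx : x ∈ Icc 0 P.p) :
    h.N 1 (t, x) = Real.exp (P.b * x) + P.a * t ^ P.β * P.kernelF₁ t x := by
  have hX : ∀ (j : ℕ), ∀ η ∈ Icc 0 P.q,
      (h.X ^ j) (1 : Field₂) (η, x) = x ^ j / j.factorial * (1 : Field₂) (η, x) := fun j η hη =>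
    h.X_pow_apply_of_const (y := fun _ => 1) (fun _ _ _ _ => rfl) j hη hx
  refine (h.hasSum_N 1 (t, x)).unique (HasSum.of_first_row ?_ ?_)
  · have h0 : HasSum (fun j : ℕ => (P.b * x) ^ j / (j.factorial : ℝ)) (Real.exp (P.b * x)) := by
      rw [Real.exp_eq_exp_ℝ]; exact NormedSpace.expSeries_div_hasSum_exp _
    refine (congrArg (fun f => HasSum f _) (funext fun j => ?_)).mp h0
    change _ = ((0 + j).choose 0 : ℝ) * (P.a ^ 0 * P.b ^ j * (h.X ^ j) 1 (t, x))
    rw [hX j t ht, BoundedContinuousFunction.coe_one, Pi.one_apply]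
    simp only [Nat.choose_zero_right, Nat.cast_one, pow_zero, mul_pow]
    ring
  · refine (congrArg (fun f => HasSum f _) (funext fun i => ?_)).mp
      ((h.hasSum_kernelF₁ t x).mul_left (P.a * t ^ P.β))
    rw [h.I_pow_congr hx (hX i.2) (i.1 + 1) ht, h.I_pow_succ_one i.1 ht, timeMoment,
      show i.1 + 1 + i.2 = i.1 + i.2 + 1 by lia, mul_pow, mul_pow, pow_succ P.a]
    ring

theorem timeTerm_le (h : P.Admissible) {t r : ℝ} (ht : t ≤ P.q) (hr : r ∈ Icc 0 t) :
    r ^ P.β ≤ P.q ^ P.β ∧ |Real.exp (P.δ * r)| ≤ 1 := by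
  refine ⟨Real.rpow_le_rpow hr.1 (hr.2.trans ht) h.β_pos.le, ?_⟩
  rw [Real.abs_exp]
  exact Real.exp_le_one_iff.2 (mul_nonpos_of_nonpos_of_nonneg h.δ_neg.le hr.1)

/-- Here `X ^ j (X w)` is `x ^ (j + 1) / (j + 1)!` times `y`. The row `m = 0` is therefore the
exponential series without its constant term, and the other rows sum under the integral sign to
`F₃`. -/
theorem N_X (h : P.Admissible) {w : Field₂} {y : ℝ → ℝ}
    (hw : ∀ t ∈ Icc 0 P.q, ∀ x ∈ Icc 0 P.p, w (t, x) = y t) {t x : ℝ}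
    (ht : t ∈ Icc 0 P.q) (hx : x ∈ Icc 0 P.p) :
    P.b * h.N (h.X w) (t, x) = (Real.exp (P.b * x) - 1) * y t + P.a * P.b * x *
      ∫ η in (0 : ℝ)..t, (t - η) ^ (P.β - 1) * y η * P.kernelF₃ (t - η) x := by
  have hX : ∀ (j : ℕ), ∀ η ∈ Icc 0 P.q, (h.X ^ j) (h.X w) (η, x)
      = x ^ (j + 1) / (j + 1).factorial * w (η, x) := fun j η hη => by
    rw [hw η hη x hx, ← h.X_pow_apply_of_const hw (j + 1) hη hx, pow_succ]
    rfl
  refine ((h.hasSum_N (h.X w) (t, x)).mul_left P.b).unique (HasSum.of_first_row ?_ ?_)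
  · have h0 : HasSum (fun j : ℕ => (P.b * x) ^ j / (j.factorial : ℝ)) (Real.exp (P.b * x)) := by
      rw [Real.exp_eq_exp_ℝ]; exact NormedSpace.expSeries_div_hasSum_exp _
    have h1 := ((hasSum_nat_add_iff' 1).2 h0).mul_right (y t)
    simp only [Finset.range_one, Finset.sum_singleton, pow_zero, Nat.factorial_zero, Nat.cast_one,
      div_one] at h1
    refine (congrArg (fun f => HasSum f _) (funext fun j => ?_)).mp h1
    change _ = P.b * (((0 + j).choose 0 : ℝ) * (P.a ^ 0 * P.b ^ j * (h.X ^ j) (h.X w) (t, x)))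
    rw [hX j t ht, hw t ht x hx]
    simp only [Nat.choose_zero_right, Nat.cast_one, pow_zero, mul_pow]
    ring
  · have hwi : IntervalIntegrable (fun η => (t - η) ^ (P.β - 1) * y η) volume 0 t := by
      have := (WeakKernel.intervalIntegrable_weight h.β_pos zero_lt_one ht.1).mul_continuousOn
        (g := fun η => w (η, x)) (w.continuous.comp (by fun_prop)).continuousOn
      refine this.congr fun η hη => ?_
      rw [uIoc_of_le ht.1] at hη
      simp only [neg_zero, Real.rpow_zero, mul_one]
      rw [hw η ⟨hη.1.le, hη.2.trans ht.2⟩ x hx]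
    have hsum := hasSum_integral_weight ht.1 hwi
      (g := fun (i : ℕ × ℕ) η => ((i.1 + i.2 + 1).choose (i.1 + 1) : ℝ) / (i.2 + 1).factorial *
        (P.a * (t - η) ^ P.β) ^ i.1 * (P.b * x) ^ i.2 *
        (Real.exp (P.δ * (t - η)) / Real.Gamma (P.β * (i.1 + 1))))
      (S := fun η => P.kernelF₃ (t - η) x)
      (B := fun i => seriesBound P.β (|P.a| * P.q ^ P.β) (|P.b| * P.p) i * 1) ?_ ?_ ?_ ?_
    · refine (congrArg (fun f => HasSum f _) (funext fun i => ?_)).mp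
        (hsum.mul_left (P.a * P.b * x))
      rw [h.I_pow_congr hx (hX i.2) (i.1 + 1) ht, pow_succ h.I]
      change _ = P.b * (_ * (_ * (_ * (h.I ^ i.1) (P.fracInt _ 0 _ _ _ w) (t, x))))
      rw [h.I_pow_succ_apply, clamp_of_mem ht, clamp_of_mem hx]
      rw [show i.1 + 1 + i.2 = i.1 + i.2 + 1 by lia]
      have e : ∀ η ∈ uIcc 0 t, (t - η) ^ (P.β - 1) * y η *
          (((i.1 + i.2 + 1).choose (i.1 + 1) : ℝ) / (i.2 + 1).factorial *
        (P.a * (t - η) ^ P.β) ^ i.1 * (P.b * x) ^ i.2 *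
        (Real.exp (P.δ * (t - η)) / Real.Gamma (P.β * (i.1 + 1))))
        = (((i.1 + i.2 + 1).choose (i.1 + 1) : ℝ) / (i.2 + 1).factorial * P.a ^ i.1 *
          (P.b * x) ^ i.2) * ((t - η) ^ (P.β - 1) * (η ^ (-(0 : ℝ)) * w (η, x)) *
            (((t - η) ^ P.β) ^ i.1 * (Real.exp (P.δ * (t - η)) /
              Real.Gamma (P.β * (i.1 + 1))))) := by
        intro η hη
        rw [uIcc_of_le ht.1] at hη
        rw [hw η ⟨hη.1, hη.2.trans ht.2⟩ x hx, mul_pow]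
        simp only [neg_zero, Real.rpow_zero]
        ring
      rw [intervalIntegral.integral_congr e, intervalIntegral.integral_const_mul]
      ring
    · intro i
      refine Continuous.continuousOn ?_
      have : Continuous fun η : ℝ => (t - η) ^ P.β :=
        Continuous.rpow_const (by fun_prop) fun _ => Or.inr h.β_pos.le
      fun_prop
    · rintro ⟨m, j⟩ η hη
      have hr : t - η ∈ Icc 0 t := ⟨by linarith [hη.2], by linarith [hη.1]⟩
      obtain ⟨b1, b2⟩ := h.timeTerm_le ht.2 hr
      refine abs_term_le_seriesBound h.β_pos (abs_choose_div_succ_le m j (m + 1)) ?_ ?_ b2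
      · rw [abs_mul, abs_of_nonneg (Real.rpow_nonneg hr.1 _)]
        gcongr
      · rw [abs_mul, abs_of_nonneg hx.1]
        gcongr
        exact hx.2
    · have := Real.rpow_nonneg h.q_nonneg P.β
      have := h.p_nonneg
      exact (summable_seriesBound h.β_pos (by positivity) (by positivity)).mul_right 1
    · intro η _
      exact h.hasSum_kernelF₃ (t - η) x

end Admissible

end TelegraphProblem

/-! ### The resolvent on the trace and on the source -/

namespace TelegraphProblem

variable {P : TelegraphProblem}

namespace Admissible

theorem abs_expMoment_le (h : P.Admissible) (m : ℕ) {t : ℝ} (ht : 0 ≤ t) :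
    |expMoment (P.β * (m + 1)) (P.δ * t)| ≤ 1 / P.β := by
  have hβ := h.β_pos
  rw [abs_of_nonneg (expMoment_nonneg _ _)]
  refine (expMoment_le (mul_natCast_add_one_pos hβ m)
    (mul_nonpos_of_nonpos_of_nonneg h.δ_neg.le ht)).trans ?_
  have : P.β ≤ P.β * (m + 1) := by
    have : 0 ≤ P.β * m := by positivity
    linarith
  gcongr

theorem summable_bound (h : P.Admissible) :
    Summable (seriesBound P.β (|P.a| * P.q ^ P.β) (|P.b| * P.p)) := by
  have := Real.rpow_nonneg h.q_nonneg P.β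
  have := h.p_nonneg
  exact summable_seriesBound h.β_pos (by positivity) (by positivity)

theorem abs_time_le (h : P.Admissible) {t : ℝ} (ht : t ∈ Icc 0 P.q) :
    |P.a * t ^ P.β| ≤ |P.a| * P.q ^ P.β := by
  rw [abs_mul, abs_of_nonneg (Real.rpow_nonneg ht.1 _)]
  have := Real.rpow_le_rpow ht.1 ht.2 h.β_pos.le
  gcongr

theorem abs_space_le {x : ℝ} (hx : x ∈ Icc 0 P.p) : |P.b * x| ≤ |P.b| * P.p := by
  rw [abs_mul, abs_of_nonneg hx.1]
  gcongr
  exact hx.2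

theorem I_pow_X_pow_I (h : P.Admissible) (m j : ℕ) (w : Field₂) :
    (h.I ^ m) ((h.X ^ j) (h.I w)) = (h.I ^ (m + 1)) ((h.X ^ j) w) := by
  have : h.I ^ m * (h.X ^ j * h.I) = h.I ^ (m + 1) * h.X ^ j := by
    rw [← (h.commute_I_X.pow_right j).eq, ← mul_assoc, pow_succ]
  exact congrArg (fun T : Field₂ →L[ℝ] Field₂ => T w) this

/-- The column `j = 0` involves no integration in `x`, so it is `y x` times the series `E`; the
remaining columns are convolutions of `y` in `x`, with kernel `F₂`. -/
theorem N_I (h : P.Admissible) {w : Field₂} {y : ℝ → ℝ}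
    (hw : ∀ t ∈ Icc 0 P.q, ∀ x ∈ Icc 0 P.p, w (t, x) = y x) {t x : ℝ}
    (ht : t ∈ Icc 0 P.q) (hx : x ∈ Icc 0 P.p) :
    P.a * h.N (h.I w) (t, x) = P.a * Real.Gamma P.γ * t ^ P.β * y x * P.kernelE t
      + P.a * P.b * t ^ P.β * ∫ ξ in (0 : ℝ)..x, y ξ * P.kernelF₂ t (x - ξ) := by
  refine ((h.hasSum_N (h.I w) (t, x)).mul_left P.a).unique (HasSum.of_first_col ?_ ?_)
  · have h0 := (h.hasSum_kernelE t).mul_left (P.a * t ^ P.β * y x)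
    rw [show P.a * t ^ P.β * y x * (Real.Gamma P.γ * P.kernelE t)
      = P.a * Real.Gamma P.γ * t ^ P.β * y x * P.kernelE t by ring] at h0
    refine (congrArg (fun f => HasSum f _) (funext fun m => ?_)).mp h0
    change _ = P.a * (((m + 0).choose m : ℝ) * (P.a ^ m * P.b ^ 0 *
      (h.I ^ m) ((h.X ^ 0) (h.I w)) (t, x)))
    rw [h.I_pow_X_pow_I, h.I_pow_succ_apply_of_const (w := (h.X ^ 0) w) hx
        (fun η hη => by simpa using hw η hη x hx) m ht, timeMoment, mul_pow]
    simp
    ring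
  · have hyi : IntervalIntegrable y volume 0 x := by
      have : Continuous fun ξ => w (t, ξ) := w.continuous.comp (by fun_prop)
      refine (this.intervalIntegrable 0 x).congr fun ξ hξ => ?_
      rw [uIoc_of_le hx.1] at hξ
      exact hw t ht ξ ⟨hξ.1.le, hξ.2.trans hx.2⟩
    have hsum := hasSum_integral_weight hx.1 hyi
      (g := fun (i : ℕ × ℕ) ξ => ((i.1 + i.2 + 1).choose i.1 : ℝ) / i.2.factorial *
        (P.a * t ^ P.β) ^ i.1 * (P.b * (x - ξ)) ^ i.2 *
        (expMoment (P.β * (i.1 + 1)) (P.δ * t) / Real.Gamma (P.β * (i.1 + 1))))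
      (S := fun ξ => P.kernelF₂ t (x - ξ))
      (B := fun i => seriesBound P.β (|P.a| * P.q ^ P.β) (|P.b| * P.p) i * (1 / P.β))
      (fun i => Continuous.continuousOn (by fun_prop)) ?_ (h.summable_bound.mul_right _)
      (fun ξ _ => h.hasSum_kernelF₂ t (x - ξ))
    · refine (congrArg (fun f => HasSum f _) (funext fun i => ?_)).mp
        (hsum.mul_left (P.a * P.b * t ^ P.β))
      have e : ∀ η ∈ Icc 0 P.q, (h.X ^ (i.2 + 1)) w (η, x)
          = ∫ ξ in (0 : ℝ)..x, (x - ξ) ^ i.2 / i.2.factorial * y ξ := by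
        intro η hη
        rw [pow_succ]
        change (h.X ^ i.2) (P.spaceInt 0 _ _ w) (η, x) = _
        rw [h.X_pow_succ_apply, clamp_of_mem hη, clamp_of_mem hx]
        refine intervalIntegral.integral_congr fun ξ hξ => ?_
        rw [uIcc_of_le hx.1] at hξ
        simp only [neg_zero, Real.rpow_zero, one_mul]
        rw [hw η hη ξ ⟨hξ.1, hξ.2.trans hx.2⟩]
      rw [h.I_pow_X_pow_I, h.I_pow_succ_apply_of_const hx e i.1 ht, timeMoment]
      have e2 : ∀ ξ : ℝ, y ξ * (((i.1 + i.2 + 1).choose i.1 : ℝ) / i.2.factorial *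
        (P.a * t ^ P.β) ^ i.1 * (P.b * (x - ξ)) ^ i.2 *
        (expMoment (P.β * (i.1 + 1)) (P.δ * t) / Real.Gamma (P.β * (i.1 + 1))))
        = (((i.1 + i.2 + 1).choose i.1 : ℝ) * (P.a * t ^ P.β) ^ i.1 * P.b ^ i.2 *
        (expMoment (P.β * (i.1 + 1)) (P.δ * t) / Real.Gamma (P.β * (i.1 + 1)))) *
          ((x - ξ) ^ i.2 / i.2.factorial * y ξ) := fun ξ => by
        rw [mul_pow P.b]
        ring
      simp_rw [e2]
      rw [intervalIntegral.integral_const_mul, mul_pow, pow_succ P.b]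
      rw [show i.1 + (i.2 + 1) = i.1 + i.2 + 1 by lia]
      ring
    · rintro ⟨m, j⟩ ξ hξ
      exact abs_term_le_seriesBound h.β_pos (abs_choose_div_le m j m) (h.abs_time_le ht)
        (abs_space_le ⟨by linarith [hξ.2], by linarith [hξ.1, hx.2]⟩)
        (h.abs_expMoment_le m ht.1)

/-- Every term of the series already contains one integral in each variable, so no row or column is
split off. The series is summed under the integral in `ξ` first and then under the integral in `η`.
-/
theorem N_source (h : P.Admissible) {ε₁ ε₂ : ℝ} (hε₁₀ : 0 ≤ ε₁) (hε₁ : ε₁ < 1)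
    (hε₁β : ε₁ < P.β) (hε₂₀ : 0 ≤ ε₂) (hε₂ : ε₂ < 1) {w : Field₂}
    (hw : ∀ z ∈ P.domain, P.f z.1 z.2 = z.1 ^ (-ε₁) * z.2 ^ (-ε₂) * w z) {t x : ℝ}
    (ht : t ∈ Icc 0 P.q) (hx : x ∈ Icc 0 P.p) :
    h.N (P.fracInt h.β_pos ε₁ hε₁₀ hε₁ hε₁β (P.spaceInt ε₂ hε₂₀ hε₂ w)) (t, x)
      = ∫ η in (0 : ℝ)..t, ∫ ξ in (0 : ℝ)..x,
        (t - η) ^ (P.β - 1) * P.f η ξ * P.kernelF₄ (t - η) (x - ξ) := by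
  have hp := h.p_pos
  set Z : ℕ → ℝ → ℝ := fun j η => ∫ ξ in (0 : ℝ)..x, (ξ ^ (-ε₂) * w (η, ξ)) * (x - ξ) ^ j with hZ
  have hwt : IntervalIntegrable (fun ξ : ℝ => ξ ^ (-ε₂)) volume 0 x :=
    intervalIntegral.intervalIntegrable_rpow' (by linarith)
  have hwi : ∀ η, IntervalIntegrable (fun ξ => ξ ^ (-ε₂) * w (η, ξ)) volume 0 x := fun η =>
    hwt.mul_continuousOn (w.continuous.comp (by fun_prop)).continuousOn
  have hZX : ∀ j, ∀ η ∈ Icc 0 P.q,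
      (h.X ^ j) (P.spaceInt ε₂ hε₂₀ hε₂ w) (η, x) = Z j η / j.factorial := by
    intro j η hη
    rw [h.X_pow_succ_apply, clamp_of_mem hη, clamp_of_mem hx, hZ,
      ← intervalIntegral.integral_div]
    refine intervalIntegral.integral_congr fun ξ _ => ?_
    ring
  set K : ℝ := ‖w‖ * ∫ ξ in (0 : ℝ)..x, ξ ^ (-ε₂) with hK
  have hK0 : 0 ≤ K := mul_nonneg (norm_nonneg _)
    (intervalIntegral.integral_nonneg hx.1 fun ξ hξ => Real.rpow_nonneg hξ.1 _)
  -- Since `(x - ξ) ^ j ≤ p ^ j`, moving `p ^ j` into the factor `(b p) ^ j` leaves a quotient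
  -- bounded independently of `j`, and `seriesBound` applies to the rest.
  have hZb : ∀ j η, |Z j η / P.p ^ j| ≤ K := by
    intro j η
    rw [abs_div, abs_of_pos (pow_pos hp j), div_le_iff₀ (pow_pos hp j), hK,
      ← intervalIntegral.integral_const_mul, ← intervalIntegral.integral_mul_const,
      ← Real.norm_eq_abs]
    refine intervalIntegral.norm_integral_le_of_norm_le hx.1
      (Filter.Eventually.of_forall fun ξ hξ => ?_) ((hwt.const_mul _).mul_const _)
    have h1 : 0 ≤ x - ξ := by linarith [hξ.2]
    have h2 := w.norm_coe_le_norm (η, ξ)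
    have h3 := Real.rpow_nonneg hξ.1.le (-ε₂)
    rw [norm_mul, norm_mul, Real.norm_of_nonneg h3, Real.norm_of_nonneg (pow_nonneg h1 j),
      mul_comm (ξ ^ (-ε₂))]
    have h4 : x - ξ ≤ P.p := by linarith [hξ.1, hx.2]
    gcongr
  have hwη : IntervalIntegrable (fun η => (t - η) ^ (P.β - 1) * η ^ (-ε₁)) volume 0 t :=
    WeakKernel.intervalIntegrable_weight h.β_pos hε₁ ht.1
  have hinner : ∀ η ∈ Icc 0 t, HasSum (fun i : ℕ × ℕ =>
      ((i.1 + i.2).choose i.1 : ℝ) / i.2.factorial * (P.a * (t - η) ^ P.β) ^ i.1 *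
        (P.b * P.p) ^ i.2 * (Real.exp (P.δ * (t - η)) / Real.Gamma (P.β * (i.1 + 1))) *
        (Z i.2 η / P.p ^ i.2))
      (∫ ξ in (0 : ℝ)..x, (ξ ^ (-ε₂) * w (η, ξ)) * P.kernelF₄ (t - η) (x - ξ)) := by
    intro η hη
    have hr : t - η ∈ Icc 0 t := ⟨by linarith [hη.2], by linarith [hη.1]⟩
    have hsum := hasSum_integral_weight hx.1 (hwi η)
      (g := fun (i : ℕ × ℕ) ξ => ((i.1 + i.2).choose i.1 : ℝ) / i.2.factorial *
        (P.a * (t - η) ^ P.β) ^ i.1 * (P.b * (x - ξ)) ^ i.2 *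
        (Real.exp (P.δ * (t - η)) / Real.Gamma (P.β * (i.1 + 1))))
      (S := fun ξ => P.kernelF₄ (t - η) (x - ξ))
      (B := fun i => seriesBound P.β (|P.a| * P.q ^ P.β) (|P.b| * P.p) i * 1)
      (fun i => Continuous.continuousOn (by fun_prop)) ?_ (h.summable_bound.mul_right _)
      (fun ξ _ => h.hasSum_kernelF₄ (t - η) (x - ξ))
    · refine (congrArg (fun f => HasSum f _) (funext fun i => ?_)).mp hsum
      have e2 : ∀ ξ : ℝ, (ξ ^ (-ε₂) * w (η, ξ)) * (((i.1 + i.2).choose i.1 : ℝ) /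
        i.2.factorial * (P.a * (t - η) ^ P.β) ^ i.1 * (P.b * (x - ξ)) ^ i.2 *
        (Real.exp (P.δ * (t - η)) / Real.Gamma (P.β * (i.1 + 1))))
        = (((i.1 + i.2).choose i.1 : ℝ) /
        i.2.factorial * (P.a * (t - η) ^ P.β) ^ i.1 * P.b ^ i.2 *
        (Real.exp (P.δ * (t - η)) / Real.Gamma (P.β * (i.1 + 1)))) *
          ((ξ ^ (-ε₂) * w (η, ξ)) * (x - ξ) ^ i.2) := fun ξ => by
        rw [mul_pow P.b]
        ring
      simp_rw [e2]
      rw [intervalIntegral.integral_const_mul, mul_pow P.b]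
      have : P.p ^ i.2 ≠ 0 := (pow_pos hp _).ne'
      field_simp
      rfl
    · rintro ⟨m, j⟩ ξ hξ
      exact abs_term_le_seriesBound h.β_pos (abs_choose_self_div_le m j)
        (h.abs_time_le ⟨hr.1, hr.2.trans ht.2⟩)
        (abs_space_le ⟨by linarith [hξ.2], by linarith [hξ.1, hx.2]⟩)
        (h.timeTerm_le ht.2 hr).2
  have houter := hasSum_integral_weight ht.1 hwη
    (B := fun i => seriesBound P.β (|P.a| * P.q ^ P.β) (|P.b| * P.p) i * 1 * K)
    (fun i => ?_) ?_ ((h.summable_bound.mul_right _).mul_right _) hinner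
  · have e3 : ∫ η in (0 : ℝ)..t, ∫ ξ in (0 : ℝ)..x,
        (t - η) ^ (P.β - 1) * P.f η ξ * P.kernelF₄ (t - η) (x - ξ)
        = ∫ η in (0 : ℝ)..t, ((t - η) ^ (P.β - 1) * η ^ (-ε₁)) *
          ∫ ξ in (0 : ℝ)..x, (ξ ^ (-ε₂) * w (η, ξ)) * P.kernelF₄ (t - η) (x - ξ) := by
      rw [intervalIntegral.integral_of_le ht.1, intervalIntegral.integral_of_le ht.1,
        integral_Ioc_eq_integral_Ioo, integral_Ioc_eq_integral_Ioo]
      refine setIntegral_congr_fun measurableSet_Ioo fun η hη => ?_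
      rw [← intervalIntegral.integral_const_mul, intervalIntegral.integral_of_le hx.1,
        intervalIntegral.integral_of_le hx.1, integral_Ioc_eq_integral_Ioo,
        integral_Ioc_eq_integral_Ioo]
      refine setIntegral_congr_fun measurableSet_Ioo fun ξ hξ => ?_
      rw [hw (η, ξ) ⟨⟨hη.1, hη.2.trans_le ht.2⟩, ⟨hξ.1, hξ.2.trans_le hx.2⟩⟩]
      ring
    rw [e3]
    refine (h.hasSum_N _ (t, x)).unique ?_
    refine (congrArg (fun f => HasSum f _) (funext fun i => ?_)).mp houter
    have hcomm : (h.X ^ i.2) (P.fracInt h.β_pos ε₁ hε₁₀ hε₁ hε₁β (P.spaceInt ε₂ hε₂₀ hε₂ w))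
        = P.fracInt h.β_pos ε₁ hε₁₀ hε₁ hε₁β ((h.X ^ i.2) (P.spaceInt ε₂ hε₂₀ hε₂ w)) := by
      have := ((WeakKernel.commute_opT_opX h.q_nonneg h.p_nonneg
        (temperedKernel P.δ P.β ε₁ h.β_pos hε₁₀ hε₁ hε₁β)
        (temperedKernel 0 1 0 one_pos le_rfl zero_lt_one zero_lt_one)).pow_right i.2).eq
      exact (congrArg (fun T : Field₂ →L[ℝ] Field₂ => T (P.spaceInt ε₂ hε₂₀ hε₂ w)) this).symm
    rw [hcomm, h.I_pow_succ_apply, clamp_of_mem ht, clamp_of_mem hx,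
      ← intervalIntegral.integral_const_mul, ← intervalIntegral.integral_const_mul]
    refine intervalIntegral.integral_congr fun η hη => ?_
    rw [uIcc_of_le ht.1] at hη
    rw [hZX i.2 η ⟨hη.1, hη.2.trans ht.2⟩, mul_pow, mul_pow]
    have : P.p ^ i.2 ≠ 0 := (pow_pos hp _).ne'
    have e : P.p ^ i.2 * (Z i.2 η / P.p ^ i.2) = Z i.2 η := mul_div_cancel₀ _ this
    generalize Z i.2 η / P.p ^ i.2 = v at e ⊢
    rw [← e]
    ring
  · have c1 : Continuous fun η : ℝ => (t - η) ^ P.β :=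
      Continuous.rpow_const (by fun_prop) fun _ => Or.inr h.β_pos.le
    have c2 : ContinuousOn (Z i.2) (Icc 0 t) := by
      have : ContinuousOn (fun η => (h.X ^ i.2) (P.spaceInt ε₂ hε₂₀ hε₂ w) (η, x) *
          i.2.factorial) (Icc 0 t) :=
        ((((h.X ^ i.2) (P.spaceInt ε₂ hε₂₀ hε₂ w)).continuous.comp
          (by fun_prop : Continuous fun η : ℝ => (η, x))).mul continuous_const).continuousOn
      refine this.congr fun η hη => ?_
      simp only
      rw [hZX i.2 η ⟨hη.1, hη.2.trans ht.2⟩]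
      field_simp
    exact ContinuousOn.mul (Continuous.continuousOn (by fun_prop)) (c2.div_const _)
  · rintro ⟨m, j⟩ η hη
    have hr : t - η ∈ Icc 0 t := ⟨by linarith [hη.2], by linarith [hη.1]⟩
    rw [abs_mul]
    have b1 := abs_term_le_seriesBound h.β_pos (abs_choose_self_div_le m j)
        (h.abs_time_le ⟨hr.1, hr.2.trans ht.2⟩)
        (abs_space_le ⟨h.p_nonneg, le_rfl⟩) (h.timeTerm_le ht.2 hr).2
    exact mul_le_mul b1 (hZb j η) (abs_nonneg _) ((abs_nonneg _).trans b1)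

end Admissible

/-! ### The representation formula in operator form -/

/-- The standing assumptions on the parameters and on `φ`, `M`, `f`. -/
structure RegularData (P : TelegraphProblem) (ε₁ ε₂ : ℝ) (f₁ : ℝ → ℝ → ℝ) : Prop
    extends P.Admissible where
  φ_cont : ContinuousOn P.φ (Icc 0 P.q)
  M_cont : ContinuousOn P.M (Icc 0 P.q)
  ε₁_nonneg : 0 ≤ ε₁
  ε₁_lt : ε₁ < P.β
  ε₂_nonneg : 0 ≤ ε₂
  ε₂_lt : ε₂ < 1
  f₁_cont : ContinuousOn (fun z : ℝ × ℝ => f₁ z.1 z.2) P.closedDomain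
  f_eq : ∀ z ∈ P.domain, P.f z.1 z.2 = z.1 ^ (-ε₁) * z.2 ^ (-ε₂) * f₁ z.1 z.2

namespace RegularData

variable {ε₁ ε₂ : ℝ} {f₁ : ℝ → ℝ → ℝ}

theorem ε₁_lt_one (h : P.RegularData ε₁ ε₂ f₁) : ε₁ < 1 := h.ε₁_lt.trans h.β_lt_one

/-- The function `φ` on the rectangle. -/
noncomputable def φField (h : P.RegularData ε₁ ε₂ f₁) : Field₂ :=
  liftField h.q_nonneg h.p_nonneg (fun t _ => P.φ t)
    (h.φ_cont.comp continuousOn_fst fun _ hz => hz.1)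

/-- The function `f₁` on the rectangle. -/
noncomputable def fField (h : P.RegularData ε₁ ε₂ f₁) : Field₂ :=
  liftField h.q_nonneg h.p_nonneg f₁ h.f₁_cont

/-- A function of `x` on the rectangle. -/
noncomputable def traceField (h : P.RegularData ε₁ ε₂ f₁) (τ : ℝ → ℝ)
    (hτ : ContinuousOn τ (Icc 0 P.p)) : Field₂ :=
  liftField h.q_nonneg h.p_nonneg (fun _ x => τ x) (hτ.comp continuousOn_snd fun _ hz => hz.2)

/-- The weighted integral in `x`. -/
noncomputable def XW (h : P.RegularData ε₁ ε₂ f₁) : Field₂ →L[ℝ] Field₂ :=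
  P.spaceInt ε₂ h.ε₂_nonneg h.ε₂_lt

/-- The weighted fractional integral in `t`. -/
noncomputable def IW (h : P.RegularData ε₁ ε₂ f₁) : Field₂ →L[ℝ] Field₂ :=
  P.fracInt h.β_pos ε₁ h.ε₁_nonneg h.ε₁_lt_one h.ε₁_lt

/-- The source term. -/
noncomputable def source (h : P.RegularData ε₁ ε₂ f₁) : Field₂ := h.IW (h.XW h.fField)

/-- The representation formula, in terms of the operators. -/
noncomputable def goursatField (h : P.RegularData ε₁ ε₂ f₁) (w : Field₂) : Field₂ :=
  w + h.φField + P.b • h.N (h.X h.φField) + P.a • h.N (h.I w) - P.φ 0 • h.N 1 + h.N h.source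

theorem source_integral (h : P.RegularData ε₁ ε₂ f₁) {t x : ℝ} (ht : t ∈ Icc 0 P.q)
    (hx : x ∈ Icc 0 P.p) :
    h.N h.source (t, x) = ∫ η in (0 : ℝ)..t, ∫ ξ in (0 : ℝ)..x,
        (t - η) ^ (P.β - 1) * P.f η ξ * P.kernelF₄ (t - η) (x - ξ) := by
  refine h.N_source h.ε₁_nonneg h.ε₁_lt_one h.ε₁_lt h.ε₂_nonneg h.ε₂_lt ?_ ht hx
  rintro ⟨η, ξ⟩ hz
  have e : h.fField (η, ξ) = f₁ η ξ := liftField_of_mem h.q_nonneg h.p_nonneg f₁ h.f₁_cont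
    (Ioo_subset_Icc_self hz.1) (Ioo_subset_Icc_self hz.2)
  rw [h.f_eq (η, ξ) hz, e]

theorem N_X_φ (h : P.RegularData ε₁ ε₂ f₁) {t x : ℝ} (ht : t ∈ Icc 0 P.q)
    (hx : x ∈ Icc 0 P.p) :
    P.b * h.N (h.X h.φField) (t, x) = (Real.exp (P.b * x) - 1) * P.φ t + P.a * P.b * x *
      ∫ η in (0 : ℝ)..t, (t - η) ^ (P.β - 1) * P.φ η * P.kernelF₃ (t - η) x :=
  h.N_X (fun _ hs _ hy => liftField_of_mem _ _ (fun t _ => P.φ t) _ hs hy) ht hx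

theorem N_I_trace (h : P.RegularData ε₁ ε₂ f₁) {τ : ℝ → ℝ} (hτ : ContinuousOn τ (Icc 0 P.p))
    {t x : ℝ} (ht : t ∈ Icc 0 P.q) (hx : x ∈ Icc 0 P.p) :
    P.a * h.N (h.I (h.traceField τ hτ)) (t, x)
      = P.a * Real.Gamma P.γ * t ^ P.β * τ x * P.kernelE t
      + P.a * P.b * t ^ P.β * ∫ ξ in (0 : ℝ)..x, τ ξ * P.kernelF₂ t (x - ξ) :=
  h.N_I (fun _ hs _ hy => liftField_of_mem _ _ (fun _ x => τ x) _ hs hy) ht hx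

/-- The term `φ(t)` and the part `(exp (b x) - 1) φ(t)` of `b N X φ` add up to `exp (b x) φ(t)`, and
`-φ(0) N 1` supplies the matching `-φ(0) exp (b x)`. -/
theorem goursat_eq (h : P.RegularData ε₁ ε₂ f₁) {τ : ℝ → ℝ} (hτ : ContinuousOn τ (Icc 0 P.p))
    {t x : ℝ} (ht : t ∈ Icc 0 P.q) (hx : x ∈ Icc 0 P.p) :
    P.goursat τ t x = h.goursatField (h.traceField τ hτ) (t, x) := by
  have e1 := h.N_X_φ ht hx
  have e2 := h.N_I_trace hτ ht hx
  have e3 := h.N_one ht hx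
  have e4 := h.source_integral ht hx
  have e5 : h.φField (t, x) = P.φ t := liftField_of_mem _ _ (fun t _ => P.φ t) _ ht hx
  have e6 : h.traceField τ hτ (t, x) = τ x := liftField_of_mem _ _ (fun _ x => τ x) _ ht hx
  simp only [goursatField, BoundedContinuousFunction.coe_add, BoundedContinuousFunction.coe_sub,
    BoundedContinuousFunction.coe_smul, Pi.add_apply, Pi.sub_apply, smul_eq_mul]
  rw [e1, e2, e3, e4, e5, e6, goursat]
  ring

end RegularData

end TelegraphProblem

/-! ### Fields determined by their values on the rectangle -/

/-- The field depends only on the projection of its argument to the rectangle. -/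
def IsClamped (q p : ℝ) (w : Field₂) : Prop :=
  ∀ t x, w (t, x) = w (clamp q t, clamp p x)

namespace IsClamped

variable {q p : ℝ} {w v : Field₂}

theorem add (hw : IsClamped q p w) (hv : IsClamped q p v) : IsClamped q p (w + v) :=
  fun t x => congrArg₂ (· + ·) (hw t x) (hv t x)

theorem sub (hw : IsClamped q p w) (hv : IsClamped q p v) : IsClamped q p (w - v) :=
  fun t x => congrArg₂ (· - ·) (hw t x) (hv t x)

theorem smul (c : ℝ) (hw : IsClamped q p w) : IsClamped q p (c • w) :=
  fun t x => congrArg (c * ·) (hw t x)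

theorem one : IsClamped q p 1 := fun _ _ => rfl

theorem opT (k : WeakKernel) (w : Field₂) : IsClamped q p (k.opT q p w) := fun t x => by
  rw [WeakKernel.opT_apply, WeakKernel.opT_apply, clamp_clamp, clamp_clamp]

theorem opX (k : WeakKernel) (w : Field₂) : IsClamped q p (k.opX q p w) := fun t x => by
  rw [WeakKernel.opX_apply, WeakKernel.opX_apply, clamp_clamp, clamp_clamp]

theorem liftField (hq : 0 ≤ q) (hp : 0 ≤ p) (g : ℝ → ℝ → ℝ)
    (hg : ContinuousOn (fun z : ℝ × ℝ => g z.1 z.2) (Icc 0 q ×ˢ Icc 0 p)) :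
    IsClamped q p (liftField hq hp g hg) := fun t x => by
  rw [liftField_apply, liftField_apply, clamp_clamp, clamp_clamp]

/-- Clamping makes equality on the rectangle an equality of fields, to which operators can be
applied. -/
theorem ext (hq : 0 ≤ q) (hp : 0 ≤ p) (hw : IsClamped q p w) (hv : IsClamped q p v)
    (h : ∀ t ∈ Icc 0 q, ∀ x ∈ Icc 0 p, w (t, x) = v (t, x)) : w = v :=
  BoundedContinuousFunction.ext fun ⟨t, x⟩ => by
    rw [hw t x, hv t x, h _ (clamp_mem hq t) _ (clamp_mem hp x)]

end IsClamped

/-! ### Integration in one variable -/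

theorem hasDerivAt_integral_weight {ε : ℝ} (hε : ε < 1) {w : ℝ → ℝ} (hw : Continuous w) {t : ℝ}
    (ht : 0 < t) :
    HasDerivAt (fun t => ∫ s in (0 : ℝ)..t, s ^ (-ε) * w s) (t ^ (-ε) * w t) t := by
  have hc : ContinuousOn (fun s : ℝ => s ^ (-ε) * w s) (Ioi 0) :=
    (ContinuousOn.rpow_const continuousOn_id fun s hs => Or.inl (ne_of_gt hs)).mul
      hw.continuousOn
  refine intervalIntegral.integral_hasDerivAt_right ?_
    (hc.stronglyMeasurableAtFilter isOpen_Ioi t ht) (hc.continuousAt (Ioi_mem_nhds ht))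
  exact (intervalIntegral.intervalIntegrable_rpow' (by linarith)).mul_continuousOn hw.continuousOn

theorem clamp_eventuallyEq {q t : ℝ} (ht : t ∈ Ioo 0 q) : clamp q =ᶠ[nhds t] id := by
  filter_upwards [Ioo_mem_nhds ht.1 ht.2] with s hs
  exact clamp_of_mem (Ioo_subset_Icc_self hs)

/-! ### The Prabhakar operator `K` and the equation for `u - u(0,·)` -/

namespace TelegraphProblem

/-- Integration in `t` with weight `t ^ (-ε)`. -/
noncomputable def timeInt (P : TelegraphProblem) (ε : ℝ) (hε₀ : 0 ≤ ε) (hε : ε < 1) :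
    Field₂ →L[ℝ] Field₂ :=
  (temperedKernel 0 1 ε one_pos hε₀ hε hε).opT P.q P.p

variable {P : TelegraphProblem} {ε : ℝ}

theorem conv_weight {hε₀ : 0 ≤ ε} {hε : ε < 1} (y : ℝ → ℝ) (t : ℝ) :
    (temperedKernel 0 1 ε one_pos hε₀ hε hε).conv y t = ∫ s in (0 : ℝ)..t, s ^ (-ε) * y s := by
  refine intervalIntegral.integral_congr fun s _ => ?_
  simp [temperedKernel]

theorem timeInt_apply (hε₀ : 0 ≤ ε) (hε : ε < 1) (w : Field₂) (t x : ℝ) :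
    P.timeInt ε hε₀ hε w (t, x)
      = ∫ s in (0 : ℝ)..clamp P.q t, s ^ (-ε) * w (s, clamp P.p x) :=
  conv_weight _ _

theorem spaceInt_apply (hε₀ : 0 ≤ ε) (hε : ε < 1) (w : Field₂) (t x : ℝ) :
    P.spaceInt ε hε₀ hε w (t, x)
      = ∫ s in (0 : ℝ)..clamp P.p x, s ^ (-ε) * w (clamp P.q t, s) :=
  conv_weight _ _

theorem hasDerivAt_timeInt (hε₀ : 0 ≤ ε) (hε : ε < 1) (w : Field₂) {t x : ℝ}
    (ht : t ∈ Ioo 0 P.q) (hx : x ∈ Icc 0 P.p) :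
    HasDerivAt (fun s => P.timeInt ε hε₀ hε w (s, x)) (t ^ (-ε) * w (t, x)) t := by
  have h := hasDerivAt_integral_weight hε
    (w.continuous.comp (by fun_prop : Continuous fun s : ℝ => (s, x))) ht.1
  refine h.congr_of_eventuallyEq ?_
  filter_upwards [clamp_eventuallyEq ht] with s hs
  rw [timeInt_apply, hs, clamp_of_mem hx]
  rfl

theorem hasDerivAt_spaceInt (hε₀ : 0 ≤ ε) (hε : ε < 1) (w : Field₂) {t x : ℝ}
    (ht : t ∈ Icc 0 P.q) (hx : x ∈ Ioo 0 P.p) :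
    HasDerivAt (fun y => P.spaceInt ε hε₀ hε w (t, y)) (x ^ (-ε) * w (t, x)) x := by
  have h := hasDerivAt_integral_weight hε
    (w.continuous.comp (by fun_prop : Continuous fun y : ℝ => (t, y))) hx.1
  refine h.congr_of_eventuallyEq ?_
  filter_upwards [clamp_eventuallyEq hx] with y hy
  rw [spaceInt_apply, hy, clamp_of_mem ht]
  rfl

namespace Admissible

/-- Integration in `t`. -/
noncomputable def J (_ : P.Admissible) : Field₂ →L[ℝ] Field₂ := P.timeInt 0 le_rfl zero_lt_one

/-- The convolution with the kernel of the Caputo-Prabhakar derivative. -/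
noncomputable def K (h : P.Admissible) : Field₂ →L[ℝ] Field₂ :=
  (prabhakarKernel P.β P.δ h.β_lt_one).opT P.q P.p

theorem I_K (h : P.Admissible) (w : Field₂) : h.I (h.K w) = h.J w := by
  have : h.I * h.K = h.J := WeakKernel.opT_mul_opT h.q_nonneg _ _ _ rfl rfl fun u hu => by
    refine (integral_tempered_mul_prabhakar (δ := P.δ) h.β_pos h.β_lt_one hu.1).trans ?_
    simp [temperedKernel]
  exact congrArg (fun T : Field₂ →L[ℝ] Field₂ => T w) this

theorem K_fracInt (h : P.Admissible) (hε₀ : 0 ≤ ε) (hε : ε < 1) (hεβ : ε < P.β) (w : Field₂) :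
    h.K (P.fracInt h.β_pos ε hε₀ hε hεβ w) = P.timeInt ε hε₀ hε w := by
  have : h.K * P.fracInt h.β_pos ε hε₀ hε hεβ = P.timeInt ε hε₀ hε :=
    WeakKernel.opT_mul_opT h.q_nonneg _ _ _ rfl rfl fun u hu => by
      refine (integral_prabhakar_mul_tempered (δ := P.δ) h.β_pos h.β_lt_one hu.1).trans ?_
      simp [temperedKernel]
  exact congrArg (fun T : Field₂ →L[ℝ] Field₂ => T w) this

theorem K_I (h : P.Admissible) (w : Field₂) : h.K (h.I w) = h.J w :=
  h.K_fracInt le_rfl zero_lt_one h.β_pos w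

theorem K_X (h : P.Admissible) (w : Field₂) : h.K (h.X w) = h.X (h.K w) :=
  congrArg (fun T : Field₂ →L[ℝ] Field₂ => T w)
    (WeakKernel.commute_opT_opX h.q_nonneg h.p_nonneg _ _).eq

theorem isClamped_I (h : P.Admissible) (w : Field₂) : IsClamped P.q P.p (h.I w) := .opT _ _

theorem isClamped_K (h : P.Admissible) (w : Field₂) : IsClamped P.q P.p (h.K w) := .opT _ _

theorem isClamped_J (h : P.Admissible) (w : Field₂) : IsClamped P.q P.p (h.J w) := .opT _ _

theorem isClamped_X (h : P.Admissible) (w : Field₂) : IsClamped P.q P.p (h.X w) := .opX _ _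

/-- Differentiation in `t` gives `w = 0` for interior `t`, continuity extends this to the ends, and
clamping to the whole plane. -/
theorem J_injective (h : P.Admissible) {w : Field₂} (hw : IsClamped P.q P.p w) (h0 : h.J w = 0) :
    w = 0 := by
  refine hw.ext h.q_nonneg h.p_nonneg (fun _ _ => rfl) fun t ht x hx => ?_
  have hopen : EqOn (fun t => w (t, x)) (fun _ => 0) (Ioo 0 P.q) := fun s hs => by
    have := hasDerivAt_timeInt le_rfl zero_lt_one w hs hx
    have h2 : HasDerivAt (fun s => P.timeInt 0 le_rfl zero_lt_one w (s, x)) 0 s := by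
      have e : (fun s => P.timeInt 0 le_rfl zero_lt_one w (s, x)) = fun _ => 0 :=
        funext fun s => congrArg (fun v : Field₂ => v (s, x)) h0
      rw [e]
      exact hasDerivAt_const _ _
    simpa using this.unique h2
  have hcl := hopen.closure (w.continuous.comp (by fun_prop : Continuous fun s : ℝ => (s, x)))
    continuous_const
  rw [closure_Ioo h.q_pos.ne] at hcl
  exact hcl ht

theorem K_injective (h : P.Admissible) {w : Field₂} (hw : IsClamped P.q P.p w) (h0 : h.K w = 0) :
    w = 0 := by
  refine h.J_injective hw ?_
  rw [← h.I_K, h0, map_zero]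

/-- The bridge between the pointwise definition of the derivative and `K`: only the values on one
line `x = const` matter. -/
theorem primitive_eq (h : P.Admissible) {u : ℝ → ℝ} {w : Field₂} {t x : ℝ} (ht : t ∈ Icc 0 P.q)
    (hx : x ∈ Icc 0 P.p) (hw : ∀ s ∈ Icc 0 P.q, w (s, x) = u s - u 0) :
    caputoPrabhakarPrimitive P.α P.β P.γ P.δ u t = h.K w (t, x) := by
  rw [K, WeakKernel.opT_apply, clamp_of_mem ht, clamp_of_mem hx, caputoPrabhakarPrimitive,
    prabhakarIntegral, h.α_eq, h.γ_eq]
  refine intervalIntegral.integral_congr fun s hs => ?_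
  rw [uIcc_of_le ht.1] at hs
  simp [prabhakarKernel, hw s ⟨hs.1, hs.2.trans ht.2⟩]

end Admissible

namespace RegularData

variable {ε₁ ε₂ : ℝ} {f₁ : ℝ → ℝ → ℝ}

/-- The weighted integral in `t`. -/
noncomputable def JW (h : P.RegularData ε₁ ε₂ f₁) : Field₂ →L[ℝ] Field₂ :=
  P.timeInt ε₁ h.ε₁_nonneg h.ε₁_lt_one

theorem K_IW (h : P.RegularData ε₁ ε₂ f₁) (w : Field₂) : h.K (h.IW w) = h.JW w :=
  h.K_fracInt _ _ _ w

theorem IW_XW (h : P.RegularData ε₁ ε₂ f₁) (w : Field₂) : h.IW (h.XW w) = h.XW (h.IW w) :=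
  congrArg (fun T : Field₂ →L[ℝ] Field₂ => T w)
    (WeakKernel.commute_opT_opX h.q_nonneg h.p_nonneg _ _).eq

theorem isClamped_φField (h : P.RegularData ε₁ ε₂ f₁) : IsClamped P.q P.p h.φField :=
  .liftField _ _ _ _

theorem isClamped_traceField (h : P.RegularData ε₁ ε₂ f₁) (τ : ℝ → ℝ)
    (hτ : ContinuousOn τ (Icc 0 P.p)) : IsClamped P.q P.p (h.traceField τ hτ) :=
  .liftField _ _ _ _

theorem isClamped_source (h : P.RegularData ε₁ ε₂ f₁) : IsClamped P.q P.p h.source := .opT _ _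

/-- The right hand side of the integral equation for `u - u(0,·)`. -/
noncomputable def load (h : P.RegularData ε₁ ε₂ f₁) (w : Field₂) : Field₂ :=
  h.φField - P.a • h.I h.φField + P.a • h.I w - P.φ 0 • 1 + h.source

/-- The inverse property of `N` at `φ` gives `N (φ - a I φ) = φ + b N X φ`, which explains the form
of the terms in `φ`. -/
theorem goursatField_eq (h : P.RegularData ε₁ ε₂ f₁) (w : Field₂) :
    h.goursatField w = w + h.N (h.load w) := by
  have h1 := h.N_apply_sub h.φField
  rw [map_sub, map_sub, map_smul, map_smul] at h1
  rw [goursatField, load, map_add, map_sub, map_add, map_sub, map_smul, map_smul, map_smul]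
  nth_rw 1 [← h1]
  abel

/-- Both one-sided inverse properties of `N` are needed: this one for existence, and the one in
`eq_goursatField` for uniqueness. -/
theorem goursatField_sub (h : P.RegularData ε₁ ε₂ f₁) (w : Field₂) :
    (h.goursatField w - w) - P.a • h.I (h.goursatField w - w)
      - P.b • h.X (h.goursatField w - w) = h.load w := by
  rw [goursatField_eq, add_sub_cancel_left, h.N_sub]

theorem eq_goursatField (h : P.RegularData ε₁ ε₂ f₁) {v w : Field₂}
    (hv : v - P.a • h.I v - P.b • h.X v = h.load w) : w + v = h.goursatField w := by
  rw [goursatField_eq, ← hv, h.N_apply_sub]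

end RegularData

end TelegraphProblem

/-! ### Auxiliary facts on boundary values and mixed differences -/

theorem WeakKernel.opT_congr (k : WeakKernel) {q p : ℝ} {w v : Field₂} {t x y : ℝ}
    (ht : t ∈ Icc 0 q) (hx : x ∈ Icc 0 p) (hy : y ∈ Icc 0 p)
    (hwv : ∀ s ∈ Icc 0 q, w (s, x) = v (s, y)) : k.opT q p w (t, x) = k.opT q p v (t, y) := by
  rw [opT_apply, opT_apply, clamp_of_mem ht, clamp_of_mem hx, clamp_of_mem hy]
  exact k.conv_congr ht.1 fun s hs => hwv s ⟨hs.1, hs.2.trans ht.2⟩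

theorem WeakKernel.opT_zero_left (k : WeakKernel) {q p : ℝ} (hq : 0 ≤ q) (w : Field₂) (x : ℝ) :
    k.opT q p w (0, x) = 0 := by
  rw [opT_apply, clamp_zero hq, conv_zero]

theorem WeakKernel.opX_zero_right (k : WeakKernel) {q p : ℝ} (hp : 0 ≤ p) (w : Field₂) (t : ℝ) :
    k.opX q p w (t, 0) = 0 := by
  rw [opX_apply, clamp_zero hp, conv_zero]

/-- A continuous function with vanishing mixed differences in an open rectangle is a sum of
functions of one variable in the closed rectangle. -/
theorem eq_of_mixed_difference_eq_zero {q p : ℝ} (hq : 0 < q) (hp : 0 < p) {Q : ℝ × ℝ → ℝ}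
    (hQ : Continuous Q)
    (h : ∀ t ∈ Ioo 0 q, ∀ s ∈ Ioo 0 q, ∀ x ∈ Ioo 0 p, ∀ y ∈ Ioo 0 p,
      Q (t, x) - Q (s, x) - Q (t, y) + Q (s, y) = 0) {t x : ℝ} (ht : t ∈ Icc 0 q)
    (hx : x ∈ Icc 0 p) : Q (t, x) - Q (0, x) - Q (t, 0) + Q (0, 0) = 0 := by
  have hcl : closure (Ioo 0 q ×ˢ Ioo 0 p) = Icc 0 q ×ˢ Icc 0 p := by
    rw [closure_prod_eq, closure_Ioo hq.ne, closure_Ioo hp.ne]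
  have step : EqOn (fun z : ℝ × ℝ => Q z - Q (0, z.2) - Q (z.1, 0) + Q (0, 0)) (fun _ => 0)
      (Ioo 0 q ×ˢ Ioo 0 p) := by
    rintro ⟨t, x⟩ ⟨ht, hx⟩
    have : EqOn (fun z : ℝ × ℝ => Q (t, x) - Q (z.1, x) - Q (t, z.2) + Q z) (fun _ => 0)
        (Ioo 0 q ×ˢ Ioo 0 p) := fun z hz => h t ht z.1 hz.1 x hx z.2 hz.2
    -- The base point `(s, y)` is moved to the corner first; a second closure then moves `(t, x)` to
    -- the boundary.
    have := this.closure (by fun_prop) continuous_const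
    rw [hcl] at this
    exact this (x := (0, 0)) ⟨⟨le_rfl, hq.le⟩, ⟨le_rfl, hp.le⟩⟩
  have := step.closure (by fun_prop) continuous_const
  rw [hcl] at this
  exact this (x := (t, x)) ⟨ht, hx⟩

/-! ### Every regular solution satisfies the representation formula -/

namespace TelegraphProblem

variable {P : TelegraphProblem} {ε₁ ε₂ : ℝ} {f₁ : ℝ → ℝ → ℝ} {u : ℝ → ℝ → ℝ}

theorem IsRegularSolution.continuousOn_trace (hu : P.IsRegularSolution u) (hq : 0 ≤ P.q) :
    ContinuousOn (u 0) (Icc 0 P.p) :=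
  hu.continuousOn.comp (f := fun x : ℝ => ((0 : ℝ), x)) (by fun_prop)
    fun _ hx => ⟨⟨le_rfl, hq⟩, hx⟩

namespace RegularData

/-- A function continuous on the rectangle, minus its trace. -/
noncomputable def increment (h : P.RegularData ε₁ ε₂ f₁) (hu : P.IsRegularSolution u) : Field₂ :=
  liftField h.q_nonneg h.p_nonneg u hu.continuousOn
    - h.traceField (u 0) (hu.continuousOn_trace h.q_nonneg)

theorem lift_apply (h : P.RegularData ε₁ ε₂ f₁) (hu : P.IsRegularSolution u) {t x : ℝ}
    (ht : t ∈ Icc 0 P.q) (hx : x ∈ Icc 0 P.p) :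
    liftField h.q_nonneg h.p_nonneg u hu.continuousOn (t, x) = u t x :=
  liftField_of_mem _ _ _ _ ht hx

theorem traceField_apply (h : P.RegularData ε₁ ε₂ f₁) {τ : ℝ → ℝ}
    (hτ : ContinuousOn τ (Icc 0 P.p)) {t x : ℝ} (ht : t ∈ Icc 0 P.q) (hx : x ∈ Icc 0 P.p) :
    h.traceField τ hτ (t, x) = τ x :=
  liftField_of_mem _ _ (fun _ x => τ x) _ ht hx

theorem φField_apply (h : P.RegularData ε₁ ε₂ f₁) {t x : ℝ} (ht : t ∈ Icc 0 P.q)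
    (hx : x ∈ Icc 0 P.p) : h.φField (t, x) = P.φ t :=
  liftField_of_mem _ _ (fun t _ => P.φ t) _ ht hx

theorem fField_apply (h : P.RegularData ε₁ ε₂ f₁) {t x : ℝ} (ht : t ∈ Icc 0 P.q)
    (hx : x ∈ Icc 0 P.p) : h.fField (t, x) = f₁ t x :=
  liftField_of_mem _ _ f₁ h.f₁_cont ht hx

theorem increment_apply (h : P.RegularData ε₁ ε₂ f₁) (hu : P.IsRegularSolution u) {t x : ℝ}
    (ht : t ∈ Icc 0 P.q) (hx : x ∈ Icc 0 P.p) : h.increment hu (t, x) = u t x - u 0 x := by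
  rw [← h.lift_apply hu ht hx, ← h.traceField_apply (hu.continuousOn_trace h.q_nonneg) ht hx]
  rfl

theorem hasDerivAt_K_increment (h : P.RegularData ε₁ ε₂ f₁) (hu : P.IsRegularSolution u) {t x : ℝ}
    (ht : t ∈ Ioo 0 P.q) (hx : x ∈ Ioo 0 P.p) :
    HasDerivAt (fun s => h.K (h.increment hu) (s, x)) (P.D u t x) t := by
  refine (hu.differentiable_primitive (t, x) ⟨ht, hx⟩).hasDerivAt.congr_of_eventuallyEq ?_
  filter_upwards [Ioo_mem_nhds ht.1 ht.2] with s hs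
  exact (h.primitive_eq (Ioo_subset_Icc_self hs) (Ioo_subset_Icc_self hx)
    fun r hr => h.increment_apply hu hr (Ioo_subset_Icc_self hx)).symm

/-- The part of the primitive of the equation without the term in `b`. -/
noncomputable def balance (h : P.RegularData ε₁ ε₂ f₁) (hu : P.IsRegularSolution u) : Field₂ :=
  h.K (h.increment hu) - P.a • h.J (liftField h.q_nonneg h.p_nonneg u hu.continuousOn)
    - h.JW (h.XW h.fField)

theorem hasDerivAt_balance (h : P.RegularData ε₁ ε₂ f₁) (hu : P.IsRegularSolution u) {t x : ℝ}
    (ht : t ∈ Ioo 0 P.q) (hx : x ∈ Ioo 0 P.p) :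
    HasDerivAt (fun s => h.balance hu (s, x))
      (P.D u t x - P.a * u t x - t ^ (-ε₁) * h.XW h.fField (t, x)) t := by
  have hx' := Ioo_subset_Icc_self hx
  have h1 := h.hasDerivAt_K_increment hu ht hx
  have h2 := hasDerivAt_timeInt le_rfl zero_lt_one
    (liftField h.q_nonneg h.p_nonneg u hu.continuousOn) ht hx'
  rw [neg_zero, Real.rpow_zero, one_mul, h.lift_apply hu (Ioo_subset_Icc_self ht) hx'] at h2
  exact (h1.sub (h2.const_mul P.a)).sub
    (hasDerivAt_timeInt h.ε₁_nonneg h.ε₁_lt_one (h.XW h.fField) ht hx')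

/-- The differential equation enters here: it says that the `t`-derivative of `balance` has
`x`-derivative `b D u`. -/
theorem hasDerivAt_rate (h : P.RegularData ε₁ ε₂ f₁) (hu : P.IsRegularSolution u) {t x : ℝ}
    (ht : t ∈ Ioo 0 P.q) (hx : x ∈ Ioo 0 P.p) :
    HasDerivAt (fun y => P.D u t y - P.a * u t y - t ^ (-ε₁) * h.XW h.fField (t, y))
      (P.b * P.D u t x) x := by
  have ht' := Ioo_subset_Icc_self ht
  have hz : (t, x) ∈ P.domain := ⟨ht, hx⟩
  have h1 := (hu.differentiable_D_x (t, x) hz).hasDerivAt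
  have h2 := (hu.differentiable_x (t, x) hz).hasDerivAt
  have h3 := hasDerivAt_spaceInt h.ε₂_nonneg h.ε₂_lt h.fField ht' hx
  rw [h.fField_apply ht' (Ioo_subset_Icc_self hx)] at h3
  refine ((h1.sub (h2.const_mul P.a)).sub (h3.const_mul (t ^ (-ε₁)))).congr_deriv ?_
  have := hu.equation (t, x) hz
  rw [h.f_eq (t, x) hz] at this
  linear_combination this

/-- The equation is integrated over the rectangle with opposite corners `(s, y)` and `(t, x)`. This
rectangle is compact inside the domain, where `D u` is continuous and Fubini applies; nothing is
known about `D u` at the boundary. On both sides only values of continuous fields remain, so the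
result extends to the closed rectangle. -/
theorem balance_sub (h : P.RegularData ε₁ ε₂ f₁) (hu : P.IsRegularSolution u) {t s x y : ℝ}
    (ht : t ∈ Ioo 0 P.q) (hs : s ∈ Ioo 0 P.q) (hx : x ∈ Ioo 0 P.p) (hy : y ∈ Ioo 0 P.p) :
    (h.balance hu - P.b • h.X (h.K (h.increment hu))) (t, x)
      - (h.balance hu - P.b • h.X (h.K (h.increment hu))) (s, x)
      - (h.balance hu - P.b • h.X (h.K (h.increment hu))) (t, y)
      + (h.balance hu - P.b • h.X (h.K (h.increment hu))) (s, y) = 0 := by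
  have hI : uIcc s t ⊆ Ioo 0 P.q := ordConnected_Ioo.uIcc_subset hs ht
  have hI' : uIcc y x ⊆ Ioo 0 P.p := ordConnected_Ioo.uIcc_subset hy hx
  have hDt : ∀ z ∈ Ioo 0 P.p, ContinuousOn (fun r => P.D u r z) (Ioo 0 P.q) := fun z hz =>
    hu.continuousOn_D.comp (f := fun r : ℝ => (r, z)) (by fun_prop) fun r hr => ⟨hr, hz⟩
  have hDx : ∀ r ∈ Ioo 0 P.q, ContinuousOn (fun z => P.D u r z) (Ioo 0 P.p) := fun r hr =>
    hu.continuousOn_D.comp (f := fun z : ℝ => (r, z)) (by fun_prop) fun z hz => ⟨hr, hz⟩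
  have hrate : ∀ z ∈ Ioo 0 P.p, IntervalIntegrable
      (fun r => P.D u r z - P.a * u r z - r ^ (-ε₁) * h.XW h.fField (r, z)) volume s t := by
    intro z hz
    refine ContinuousOn.intervalIntegrable ?_
    refine (((hDt z hz).mono hI).sub (continuousOn_const.mul ?_)).sub (ContinuousOn.mul ?_ ?_)
    · exact hu.continuousOn.comp (f := fun r : ℝ => (r, z)) (by fun_prop) fun r hr =>
        ⟨Ioo_subset_Icc_self (hI hr), Ioo_subset_Icc_self hz⟩
    · exact ContinuousOn.rpow_const continuousOn_id fun r hr => Or.inl (hI hr).1.ne'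
    · exact ((h.XW h.fField).continuous.comp (by fun_prop : Continuous fun r : ℝ => (r, z))).continuousOn
  have e1 : ∀ z ∈ Ioo 0 P.p, h.balance hu (t, z) - h.balance hu (s, z)
      = ∫ r in s..t, (P.D u r z - P.a * u r z - r ^ (-ε₁) * h.XW h.fField (r, z)) := fun z hz =>
    (intervalIntegral.integral_eq_sub_of_hasDerivAt
      (fun r hr => h.hasDerivAt_balance hu (hI hr) hz) (hrate z hz)).symm
  have e2 : ∀ r ∈ uIcc s t, (P.D u r x - P.a * u r x - r ^ (-ε₁) * h.XW h.fField (r, x))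
      - (P.D u r y - P.a * u r y - r ^ (-ε₁) * h.XW h.fField (r, y))
      = ∫ z in y..x, P.b * P.D u r z := fun r hr =>
    (intervalIntegral.integral_eq_sub_of_hasDerivAt
      (fun z hz => h.hasDerivAt_rate hu (hI hr) (hI' hz))
      (((hDx r (hI hr)).mono hI').intervalIntegrable.const_mul _)).symm
  have e3 : ∀ z ∈ uIcc y x, h.K (h.increment hu) (t, z) - h.K (h.increment hu) (s, z)
      = ∫ r in s..t, P.D u r z := fun z hz =>
    (intervalIntegral.integral_eq_sub_of_hasDerivAt
      (fun r hr => h.hasDerivAt_K_increment hu (hI hr) (hI' hz))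
      ((hDt z (hI' hz)).mono hI).intervalIntegrable).symm
  have hXd : ∀ r ∈ Ioo 0 P.q, h.X (h.K (h.increment hu)) (r, x)
      - h.X (h.K (h.increment hu)) (r, y) = ∫ z in y..x, h.K (h.increment hu) (r, z) := by
    intro r hr
    refine (intervalIntegral.integral_eq_sub_of_hasDerivAt
      (f := fun z => h.X (h.K (h.increment hu)) (r, z))
      (f' := fun z => h.K (h.increment hu) (r, z)) (fun z hz => ?_) ?_).symm
    · have := hasDerivAt_spaceInt le_rfl zero_lt_one (h.K (h.increment hu))
        (Ioo_subset_Icc_self hr) (hI' hz)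
      rwa [neg_zero, Real.rpow_zero, one_mul] at this
    · exact ((h.K (h.increment hu)).continuous.comp
        (by fun_prop : Continuous fun z : ℝ => (r, z))).intervalIntegrable _ _
  have hswap : ∫ r in s..t, ∫ z in y..x, P.D u r z = ∫ z in y..x, ∫ r in s..t, P.D u r z := by
    refine intervalIntegral_intervalIntegral_swap ?_
    have hc : ContinuousOn (Function.uncurry fun r z => P.D u r z) (uIcc s t ×ˢ uIcc y x) :=
      hu.continuousOn_D.mono (prod_mono hI hI')
    exact (hc.integrableOn_compact (isCompact_uIcc.prod isCompact_uIcc)).mono_set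
      (prod_mono uIoc_subset_uIcc uIoc_subset_uIcc)
  have main : (h.balance hu (t, x) - h.balance hu (s, x))
      - (h.balance hu (t, y) - h.balance hu (s, y))
      = P.b * ((h.X (h.K (h.increment hu)) (t, x) - h.X (h.K (h.increment hu)) (t, y))
        - (h.X (h.K (h.increment hu)) (s, x) - h.X (h.K (h.increment hu)) (s, y))) := by
    have hKi : ∀ r : ℝ, IntervalIntegrable (fun z => h.K (h.increment hu) (r, z)) volume y x :=
      fun r => ((h.K (h.increment hu)).continuous.comp
        (by fun_prop : Continuous fun z : ℝ => (r, z))).intervalIntegrable _ _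
    rw [e1 x hx, e1 y hy, ← intervalIntegral.integral_sub (hrate x hx) (hrate y hy),
      intervalIntegral.integral_congr e2]
    simp only [intervalIntegral.integral_const_mul]
    rw [hswap, ← intervalIntegral.integral_congr e3, hXd t ht, hXd s hs,
      intervalIntegral.integral_sub (hKi t) (hKi s)]
  simp only [BoundedContinuousFunction.coe_sub, BoundedContinuousFunction.coe_smul, Pi.sub_apply,
    smul_eq_mul]
  linear_combination main

/-- Vanishing mixed differences reduce the integrated equation to its values on `t = 0`, where
everything vanishes, and on `x = 0`, where the boundary condition gives `φ`. As `J = K I` and the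
weighted analogue holds for the source, both sides are `K` of something, and `K` is injective on
clamped fields. -/
theorem load_of_isRegularSolution (h : P.RegularData ε₁ ε₂ f₁) (hu : P.IsRegularSolution u) :
    h.increment hu - P.a • h.I (h.increment hu) - P.b • h.X (h.increment hu)
      = h.load (h.traceField (u 0) (hu.continuousOn_trace h.q_nonneg)) := by
  set V := h.increment hu with hV
  set U := liftField h.q_nonneg h.p_nonneg u hu.continuousOn with hU
  set τ := h.traceField (u 0) (hu.continuousOn_trace h.q_nonneg) with hτ
  have hVU : V = U - τ := rfl
  have h0q : (0 : ℝ) ∈ Icc 0 P.q := ⟨le_rfl, h.q_nonneg⟩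
  have h0p : (0 : ℝ) ∈ Icc 0 P.p := ⟨le_rfl, h.p_nonneg⟩
  have hUc : IsClamped P.q P.p U := .liftField _ _ _ _
  have hτc : IsClamped P.q P.p τ := h.isClamped_traceField _ _
  have hVc : IsClamped P.q P.p V := hUc.sub hτc
  have key : h.K V - P.a • h.J U - h.JW (h.XW h.fField) - P.b • h.X (h.K V)
      = h.K (h.φField - P.φ 0 • 1) - P.a • h.J h.φField := by
    refine IsClamped.ext h.q_nonneg h.p_nonneg
      ((((h.isClamped_K _).sub ((h.isClamped_J _).smul _)).sub (.opT _ _)).sub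
        ((h.isClamped_X _).smul _)) ((h.isClamped_K _).sub ((h.isClamped_J _).smul _))
      fun t ht x hx => ?_
    have := eq_of_mixed_difference_eq_zero h.q_pos h.p_pos
      (h.balance hu - P.b • h.X (h.K (h.increment hu))).continuous
      (fun t ht s hs x hx y hy => h.balance_sub hu ht hs hx hy) ht hx
    have z1 : ∀ w y, h.K w (0, y) = 0 := fun w y => WeakKernel.opT_zero_left _ h.q_nonneg _ _
    have z2 : ∀ w y, h.J w (0, y) = 0 := fun w y => WeakKernel.opT_zero_left _ h.q_nonneg _ _
    have z3 : ∀ w y, h.JW w (0, y) = 0 := fun w y => WeakKernel.opT_zero_left _ h.q_nonneg _ _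
    have z4 : ∀ w s, h.X w (s, 0) = 0 := fun w y => WeakKernel.opX_zero_right _ h.p_nonneg _ _
    have z5 : ∀ y, h.X (h.K V) (0, y) = 0 := fun y => by rw [← h.K_X, z1]
    have z6 : h.JW (h.XW h.fField) (t, 0) = 0 := by
      have : h.JW (h.XW h.fField) (t, 0) = h.JW 0 (t, 0) := WeakKernel.opT_congr _ ht h0p h0p
        fun s _ => WeakKernel.opX_zero_right _ h.p_nonneg _ _
      rw [this, map_zero]
      rfl
    have z7 : h.K V (t, 0) = h.K (h.φField - P.φ 0 • 1) (t, x) :=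
      WeakKernel.opT_congr _ ht h0p hx fun s hs => by
        rw [h.increment_apply hu hs h0p, hu.boundary s hs, hu.boundary 0 h0q,
          ← h.φField_apply hs hx]
        simp
    have z8 : h.J U (t, 0) = h.J h.φField (t, x) :=
      WeakKernel.opT_congr _ ht h0p hx fun s hs => by
        rw [h.lift_apply hu hs h0p, hu.boundary s hs, h.φField_apply hs hx]
    simp only [balance, BoundedContinuousFunction.coe_sub, BoundedContinuousFunction.coe_smul,
      Pi.sub_apply, smul_eq_mul] at this ⊢
    rw [← hV, ← hU, z1, z1, z2, z2, z3, z3, z4, z5, z5, z6, z7, z8] at this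
    linear_combination this
  have hK : h.K (V - P.a • h.I V - P.b • h.X V - h.load τ) = 0 := by
    have hsrc : h.K h.source = h.JW (h.XW h.fField) := h.K_IW _
    have hJV : h.J V = h.J U - h.J τ := by rw [hVU, map_sub]
    rw [load, map_sub, map_sub, map_sub, map_add, map_sub, map_add, map_sub, map_smul, map_smul,
      map_smul, map_smul, map_smul, h.K_I, h.K_I, h.K_I, h.K_X, hsrc, hJV]
    rw [map_sub, map_smul] at key
    rw [smul_sub]
    rw [sub_eq_sub_iff_add_eq_add] at key
    rw [sub_eq_zero]
    generalize h.K V = a at *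
    have := congrArg (fun w => w - P.a • h.J h.φField + h.JW (h.XW h.fField) + P.a • h.J τ) key
    rw [← sub_eq_zero] at this ⊢
    rw [← this]
    abel
  rw [← sub_eq_zero]
  refine h.K_injective ?_ hK
  refine ((hVc.sub ((h.isClamped_I _).smul _)).sub ((h.isClamped_X _).smul _)).sub ?_
  exact (((h.isClamped_φField.sub ((h.isClamped_I _).smul _)).add
    ((h.isClamped_I _).smul _)).sub (IsClamped.one.smul _)).add h.isClamped_source

theorem eq_goursat_of_isRegularSolution (h : P.RegularData ε₁ ε₂ f₁)
    (hu : P.IsRegularSolution u) {t x : ℝ} (ht : t ∈ Icc 0 P.q) (hx : x ∈ Icc 0 P.p) :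
    u t x = P.goursat (u 0) t x := by
  rw [h.goursat_eq (hu.continuousOn_trace h.q_nonneg) ht hx,
    ← h.eq_goursatField (h.load_of_isRegularSolution hu), ← h.lift_apply hu ht hx, increment,
    add_sub_cancel]

end RegularData

end TelegraphProblem

/-! ### Differentiability of weakly singular convolutions -/

namespace WeakKernel

variable {k : WeakKernel}

theorem conv_one_eq (hε : k.ε = 0) (t : ℝ) :
    k.conv (fun _ => 1) t = ∫ r in (0 : ℝ)..t, r ^ (k.s - 1) * k.e r := by
  have := intervalIntegral.integral_comp_sub_left (a := 0) (b := t)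
    (fun r : ℝ => r ^ (k.s - 1) * k.e r) t
  rw [sub_self, sub_zero] at this
  rw [← this, conv]
  simp [hε]

theorem continuousOn_kernel (k : WeakKernel) :
    ContinuousOn (fun r : ℝ => r ^ (k.s - 1) * k.e r) (Ioi 0) :=
  (ContinuousOn.rpow_const continuousOn_id fun _ hr => Or.inl (ne_of_gt hr)).mul
    k.cont.continuousOn

theorem hasDerivAt_conv_one (hε : k.ε = 0) {t : ℝ} (ht : 0 < t) :
    HasDerivAt (k.conv fun _ => 1) (t ^ (k.s - 1) * k.e t) t := by
  rw [show (k.conv fun _ => 1) = _ from funext (conv_one_eq hε)]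
  refine intervalIntegral.integral_hasDerivAt_right ?_
    (k.continuousOn_kernel.stronglyMeasurableAtFilter isOpen_Ioi t ht)
    (k.continuousOn_kernel.continuousAt (Ioi_mem_nhds ht))
  exact (intervalIntegrable_rpow_unit k.s_pos 0 t).mul_continuousOn k.cont.continuousOn

/-- Near `t₀` the argument may be clamped at `|t₀| + 1`, so that `continuous_conv` applies. -/
theorem continuousOn_conv (k : WeakKernel) {g : ℝ → ℝ} (hg : Continuous g) {D : ℝ}
    (hD : ∀ r, |g r| ≤ D) : ContinuousOn (k.conv g) (Ici 0) := by
  have hc : Continuous fun t : ℝ => k.conv g (max t 0) := by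
    refine continuous_iff_continuousAt.2 fun t₀ => ?_
    have h1 : Continuous fun t : ℝ => k.conv g (clamp (|t₀| + 1) t) :=
      k.continuous_conv (Z := ℝ) (q := |t₀| + 1) (D := D) (y := fun _ => g)
        (T := fun t => clamp (|t₀| + 1) t) (by fun_prop) (fun z => clamp_mem (by positivity) _)
        (by fun_prop) (fun _ => hD)
    refine h1.continuousAt.congr ?_
    filter_upwards [gt_mem_nhds (show t₀ < |t₀| + 1 by linarith [le_abs_self t₀])] with t ht
    rw [clamp, min_eq_right ht.le, max_comm]
  exact hc.continuousOn.congr fun t ht => (congrArg (k.conv g) (max_eq_left ht)).symm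

/-- Integration is convolution with the constant kernel `1`. Both orders of composition have the
same kernel, by reflecting the inner variable. -/
theorem conv_integral (hε : k.ε = 0) {g : ℝ → ℝ} (hg : Continuous g) {t : ℝ}
    (ht : 0 ≤ t) :
    k.conv (fun ξ => ∫ s in (0 : ℝ)..ξ, g s) t = ∫ s in (0 : ℝ)..t, k.conv g s := by
  set J := temperedKernel 0 1 0 one_pos le_rfl zero_lt_one one_pos with hJ
  have hJ' : ∀ y : ℝ → ℝ, J.conv y = fun ξ => ∫ s in (0 : ℝ)..ξ, y s := fun y =>
    funext fun ξ => by
      refine (TelegraphProblem.conv_weight y ξ).trans ?_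
      simp
  rw [← hJ', show (∫ s in (0 : ℝ)..t, k.conv g s) = J.conv (k.conv g) t by rw [hJ'],
    k.conv_conv J hε ht hg.continuousOn, J.conv_conv k rfl ht hg.continuousOn]
  refine intervalIntegral.integral_congr fun ζ _ => ?_
  rw [hε]
  congr 1
  have := intervalIntegral.integral_comp_sub_left (a := 0) (b := t - ζ)
    (fun v : ℝ => v ^ (k.s - 1) * k.e v) (t - ζ)
  rw [sub_self, sub_zero] at this
  simpa [J, temperedKernel] using this

/-- The derivative is moved onto `g`; the value `C` at the origin contributes the kernel itself. -/
theorem hasDerivAt_conv_primitive (hε : k.ε = 0) {g : ℝ → ℝ} (hg : Continuous g) {D : ℝ}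
    (hD : ∀ r, |g r| ≤ D) (C : ℝ) {t : ℝ} (ht : 0 < t) :
    HasDerivAt (k.conv fun ξ => C + ∫ s in (0 : ℝ)..ξ, g s)
      (C * (t ^ (k.s - 1) * k.e t) + k.conv g t) t := by
  have hc := k.continuousOn_conv hg hD
  have hG : Continuous fun ξ => ∫ s in (0 : ℝ)..ξ, g s :=
    intervalIntegral.continuous_primitive (fun a b => hg.intervalIntegrable a b) 0
  have h2 : HasDerivAt (fun t => ∫ s in (0 : ℝ)..t, k.conv g s) (k.conv g t) t := by
    refine intervalIntegral.integral_hasDerivAt_right ?_ ?_ ?_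
    · refine ContinuousOn.intervalIntegrable (hc.mono ?_)
      rw [uIcc_of_le ht.le]
      exact Icc_subset_Ici_self
    · exact (hc.mono Ioi_subset_Ici_self).stronglyMeasurableAtFilter isOpen_Ioi t ht
    · exact hc.continuousAt (Ici_mem_nhds ht)
  refine (((hasDerivAt_conv_one hε ht).const_mul C).add h2).congr_of_eventuallyEq ?_
  filter_upwards [lt_mem_nhds ht] with s hs
  rw [k.conv_add hs.le continuousOn_const hG.continuousOn, conv_integral hε hg hs.le,
    show (fun _ : ℝ => C) = fun _ => C * 1 by simp, k.conv_const_mul]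
  rfl

end WeakKernel

/-- Differentiation under the integral sign, away from the singularity of the kernel. -/
theorem hasDerivAt_integral_comp_sub {κ κ' v : ℝ → ℝ} {c t₀ : ℝ}
    (hκ : ∀ r, 0 < r → HasDerivAt κ (κ' r) r) (hκ' : ContinuousOn κ' (Ioi 0)) (hc : 0 ≤ c)
    (hv : ContinuousOn v (Icc 0 c)) (ht : c < t₀) :
    HasDerivAt (fun t => ∫ ξ in (0 : ℝ)..c, κ (t - ξ) * v ξ)
      (∫ ξ in (0 : ℝ)..c, κ' (t₀ - ξ) * v ξ) t₀ ∧
    ContinuousAt (fun t => ∫ ξ in (0 : ℝ)..c, κ' (t - ξ) * v ξ) t₀ := by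
  -- Half the gap: for `t` within `r` of `t₀`, the argument `t - ξ` stays at least `r` away from the
  -- singularity.
  set r := (t₀ - c) / 2 with hr
  have hr0 : 0 < r := by rw [hr]; linarith
  have hκc : ContinuousOn κ (Ioi 0) := fun s hs => (hκ s hs).continuousAt.continuousWithinAt
  obtain ⟨C, hC⟩ := isCompact_Icc.exists_bound_of_continuousOn
    (hκ'.mono fun s (hs : s ∈ Icc r (t₀ + r)) => hr0.trans_le hs.1)
  have hmem : ∀ t ∈ Metric.ball t₀ r, ∀ ξ ∈ Icc 0 c, t - ξ ∈ Icc r (t₀ + r) := by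
    intro t ht ξ hξ
    rw [Metric.mem_ball, Real.dist_eq, abs_lt] at ht
    have : t₀ - c = 2 * r := by rw [hr]; ring
    constructor <;> linarith [ht.1, ht.2, hξ.1, hξ.2]
  have hvi : IntervalIntegrable v volume 0 c :=
    ContinuousOn.intervalIntegrable (by rwa [uIcc_of_le hc])
  have hcont : ∀ f : ℝ → ℝ, ContinuousOn f (Ioi 0) → ∀ t ∈ Metric.ball t₀ r,
      IntervalIntegrable (fun ξ => f (t - ξ) * v ξ) volume 0 c := by
    intro f hf t ht
    refine ContinuousOn.intervalIntegrable ?_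
    rw [uIcc_of_le hc]
    exact (hf.comp (by fun_prop) fun ξ hξ => hr0.trans_le (hmem t ht ξ hξ).1).mul hv
  have hball := Metric.ball_mem_nhds t₀ hr0
  have hsub : ∀ ξ ∈ uIoc 0 c, ξ ∈ Icc 0 c := fun ξ hξ => by
    rw [uIoc_of_le hc] at hξ
    exact Ioc_subset_Icc_self hξ
  have hbd : ∀ t ∈ Metric.ball t₀ r, ∀ ξ ∈ uIoc 0 c, ‖κ' (t - ξ) * v ξ‖ ≤ C * ‖v ξ‖ := by
    intro t ht ξ hξ
    rw [norm_mul]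
    exact mul_le_mul_of_nonneg_right (hC _ (hmem t ht ξ (hsub ξ hξ))) (norm_nonneg _)
  constructor
  · refine (intervalIntegral.hasDerivAt_integral_of_dominated_loc_of_deriv_le
      (F := fun t ξ => κ (t - ξ) * v ξ) (F' := fun t ξ => κ' (t - ξ) * v ξ)
      (bound := fun ξ => C * ‖v ξ‖) hball ?_ (hcont κ hκc t₀ (Metric.mem_ball_self hr0)) ?_ ?_
      (hvi.norm.const_mul C) ?_).2
    · filter_upwards [hball] with t ht
      exact (intervalIntegrable_iff.1 (hcont κ hκc t ht)).aestronglyMeasurable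
    · exact (intervalIntegrable_iff.1
        (hcont κ' hκ' t₀ (Metric.mem_ball_self hr0))).aestronglyMeasurable
    · exact Filter.Eventually.of_forall fun ξ hξ t ht => hbd t ht ξ hξ
    · refine Filter.Eventually.of_forall fun ξ hξ t ht => ?_
      exact ((hκ _ (hr0.trans_le (hmem t ht ξ (hsub ξ hξ)).1)).comp_sub_const t ξ).mul_const _
  · refine intervalIntegral.continuousAt_of_dominated_interval (bound := fun ξ => C * ‖v ξ‖)
      ?_ ?_ (hvi.norm.const_mul C) ?_
    · filter_upwards [hball] with t ht
      exact (intervalIntegrable_iff.1 (hcont κ' hκ' t ht)).aestronglyMeasurable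
    · filter_upwards [hball] with t ht
      exact Filter.Eventually.of_forall fun ξ hξ => hbd t ht ξ hξ
    · refine Filter.Eventually.of_forall fun ξ hξ => ?_
      have h1 : ContinuousAt κ' (t₀ - ξ) := hκ'.continuousAt (Ioi_mem_nhds
        (hr0.trans_le (hmem t₀ (Metric.mem_ball_self hr0) ξ (hsub ξ hξ)).1))
      exact (ContinuousAt.comp (f := fun t => t - ξ) h1 (by fun_prop)).mul continuousAt_const

namespace WeakKernel

variable {k : WeakKernel}

/-- The convolution of a kernel that is `C¹` away from the origin with a function that is `C¹`
in the interior is `C¹` in the interior. -/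
theorem contDiff_conv (hε : k.ε = 0) {κ' : ℝ → ℝ}
    (hκ : ∀ r, 0 < r → HasDerivAt (fun r => r ^ (k.s - 1) * k.e r) (κ' r) r)
    (hκ' : ContinuousOn κ' (Ioi 0)) {q : ℝ} {y : ℝ → ℝ} (hy : ContinuousOn y (Icc 0 q))
    (hy' : ContDiffOn ℝ 1 y (Ioo 0 q)) {t₀ : ℝ} (ht₀ : t₀ ∈ Ioo 0 q) :
    DifferentiableAt ℝ (k.conv y) t₀ ∧ ContinuousAt (deriv (k.conv y)) t₀ := by
  -- The derivative of `y` may be unbounded at the ends of the interval, so it is used only on `[c,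
  -- T]`, which contains `t₀` in its interior.
  obtain ⟨c, hc0, hct⟩ := exists_between ht₀.1
  obtain ⟨T, htT, hTq⟩ := exists_between ht₀.2
  have hcT : c ≤ T := (hct.trans htT).le
  have hsubT : Icc c T ⊆ Ioo 0 q := fun s hs => ⟨hc0.trans_le hs.1, hs.2.trans_lt hTq⟩
  have hd : ContinuousOn (deriv y) (Ioo 0 q) :=
    hy'.continuousOn_deriv_of_isOpen isOpen_Ioo le_rfl
  set g : ℝ → ℝ := fun ξ => deriv y (projIcc c T hcT ξ) with hg
  have hgc : Continuous g := (hd.mono hsubT).comp_continuous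
    (continuous_subtype_val.comp continuous_projIcc) fun ξ => (projIcc c T hcT ξ).2
  obtain ⟨D, hD⟩ := isCompact_Icc.exists_bound_of_continuousOn (hd.mono hsubT)
  have hgD : ∀ r, |g r| ≤ D := fun r => hD _ (projIcc c T hcT r).2
  -- `G` is a `C¹` extension of `y` from `[c, T]`, with derivative frozen outside. It starts at `0`,
  -- and `C` is chosen so that `G c = y c`.
  set C := y c - ∫ s in (0 : ℝ)..c, g s with hC
  set G : ℝ → ℝ := fun ξ => C + ∫ s in (0 : ℝ)..ξ, g s with hG
  have hGc : Continuous G := continuous_const.add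
    (intervalIntegral.continuous_primitive (fun a b => hgc.intervalIntegrable a b) 0)
  have hGy : ∀ ξ ∈ Icc c T, y ξ = G ξ := by
    intro ξ hξ
    have e1 : ∫ s in c..ξ, g s = y ξ - y c := by
      have e2 : ∫ s in c..ξ, g s = ∫ s in c..ξ, deriv y s := by
        refine intervalIntegral.integral_congr fun s hs => ?_
        rw [uIcc_of_le hξ.1] at hs
        simp only [hg]
        rw [projIcc_of_mem hcT ⟨hs.1, hs.2.trans hξ.2⟩]
      rw [e2]
      refine intervalIntegral.integral_deriv_eq_sub (fun s hs => ?_) ?_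
      · rw [uIcc_of_le hξ.1] at hs
        exact (hy'.differentiableOn one_ne_zero).differentiableAt
          (isOpen_Ioo.mem_nhds (hsubT ⟨hs.1, hs.2.trans hξ.2⟩))
      · refine (hd.mono fun s hs => ?_).intervalIntegrable
        rw [uIcc_of_le hξ.1] at hs
        exact hsubT ⟨hs.1, hs.2.trans hξ.2⟩
    have e3 := intervalIntegral.integral_add_adjacent_intervals
      (hgc.intervalIntegrable (μ := volume) 0 c) (hgc.intervalIntegrable (μ := volume) c ξ)
    simp only [hG, hC]
    linarith
  have hcq : Icc 0 c ⊆ Icc 0 q := Icc_subset_Icc_right (hct.trans ht₀.2).le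
  have hv : ContinuousOn (fun ξ => y ξ - G ξ) (Icc 0 c) := (hy.mono hcq).sub hGc.continuousOn
  -- Since `y - G` vanishes on `[c, T]`, its convolution is an integral over `[0, c]` only, where
  -- the kernel is evaluated away from its singularity.
  have heq : ∀ t ∈ Ioo c T, k.conv y t
      = k.conv G t + ∫ ξ in (0 : ℝ)..c, ((t - ξ) ^ (k.s - 1) * k.e (t - ξ)) * (y ξ - G ξ) := by
    intro t ht
    have ht0 : 0 ≤ t := (hc0.trans ht.1).le
    have htq : Icc 0 t ⊆ Icc 0 q := Icc_subset_Icc_right (ht.2.trans hTq).le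
    have hyG : ContinuousOn (fun ξ => y ξ - G ξ) (Icc 0 t) := (hy.mono htq).sub hGc.continuousOn
    have e1 : k.conv y t = k.conv G t + k.conv (fun ξ => y ξ - G ξ) t := by
      rw [← k.conv_add ht0 hGc.continuousOn hyG]
      congr 1
      funext ξ
      ring
    have hi := k.intervalIntegrable_conv ht0 hyG
    have hcm : c ∈ uIcc 0 t := by
      rw [uIcc_of_le ht0]
      exact ⟨hc0.le, ht.1.le⟩
    have e2 := intervalIntegral.integral_add_adjacent_intervals
      (hi.mono_set (uIcc_subset_uIcc left_mem_uIcc hcm))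
      (hi.mono_set (uIcc_subset_uIcc hcm right_mem_uIcc))
    have e3 : ∫ ξ in c..t, (t - ξ) ^ (k.s - 1) * k.e (t - ξ) * (ξ ^ (-k.ε) * (y ξ - G ξ)) = 0 := by
      rw [intervalIntegral.integral_congr (g := fun _ => (0 : ℝ)) fun ξ hξ => ?_]
      · simp
      · rw [uIcc_of_le ht.1.le] at hξ
        simp [hGy ξ ⟨hξ.1, hξ.2.trans ht.2.le⟩]
    rw [e3, add_zero] at e2
    rw [e1]
    congr 1
    rw [conv, ← e2]
    simp [hε]
  have hmain : ∀ t ∈ Ioo c T, HasDerivAt (k.conv y) ((C * (t ^ (k.s - 1) * k.e t) + k.conv g t)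
      + ∫ ξ in (0 : ℝ)..c, κ' (t - ξ) * (y ξ - G ξ)) t := by
    intro t ht
    refine ((hasDerivAt_conv_primitive hε hgc hgD C (hc0.trans ht.1)).add
      (hasDerivAt_integral_comp_sub hκ hκ' hc0.le hv ht.1).1).congr_of_eventuallyEq ?_
    filter_upwards [Ioo_mem_nhds ht.1 ht.2] with s hs using heq s hs
  have hmem : t₀ ∈ Ioo c T := ⟨hct, htT⟩
  refine ⟨(hmain t₀ hmem).differentiableAt, ?_⟩
  have h1 : ContinuousAt (fun t => (C * (t ^ (k.s - 1) * k.e t) + k.conv g t)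
      + ∫ ξ in (0 : ℝ)..c, κ' (t - ξ) * (y ξ - G ξ)) t₀ := by
    refine ((continuousAt_const.mul ?_).add ?_).add
      (hasDerivAt_integral_comp_sub hκ hκ' hc0.le hv hct).2
    · exact k.continuousOn_kernel.continuousAt (Ioi_mem_nhds ht₀.1)
    · exact (k.continuousOn_conv hgc hgD).continuousAt (Ici_mem_nhds ht₀.1)
  refine h1.congr ?_
  filter_upwards [Ioo_mem_nhds hct htT] with t ht using ((hmain t ht).deriv).symm

end WeakKernel

theorem contDiff_prabhakar_conv {β δ : ℝ} (hβ : β < 1) {q : ℝ} {y : ℝ → ℝ}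
    (hy : ContinuousOn y (Icc 0 q)) (hy' : ContDiffOn ℝ 1 y (Ioo 0 q)) {t : ℝ}
    (ht : t ∈ Ioo 0 q) :
    DifferentiableAt ℝ ((prabhakarKernel β δ hβ).conv y) t ∧
      ContinuousAt (deriv ((prabhakarKernel β δ hβ).conv y)) t := by
  refine WeakKernel.contDiff_conv rfl (fun r hr => hasDerivAt_prabhakarKernel hβ hr) ?_ hy hy' ht
  refine ((continuousOn_const.mul ?_).mul (by fun_prop)).div_const _
  exact ContinuousOn.rpow_const continuousOn_id fun r hr => Or.inl (ne_of_gt hr)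

/-! ### The representation formula gives a regular solution -/

namespace TelegraphProblem

variable {P : TelegraphProblem}

namespace Admissible

/-- The inverse of `1 - a I`. -/
noncomputable def R (h : P.Admissible) : Field₂ →L[ℝ] Field₂ :=
  (h.quasiNilpotent_I.exists_inverse P.a).choose

theorem hasSum_R (h : P.Admissible) (w : Field₂) :
    HasSum (fun n : ℕ => P.a ^ n • (h.I ^ n) w) (h.R w) :=
  (h.quasiNilpotent_I.exists_inverse P.a).choose_spec.1 w

theorem R_apply_sub (h : P.Admissible) (w : Field₂) : h.R (w - P.a • h.I w) = w :=
  (h.quasiNilpotent_I.exists_inverse P.a).choose_spec.2.1 w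

theorem R_comm (h : P.Admissible) {T : Field₂ →L[ℝ] Field₂} (hT : Commute h.I T) (w : Field₂) :
    T (h.R w) = h.R (T w) :=
  (h.quasiNilpotent_I.exists_inverse P.a).choose_spec.2.2.2 T hT w

/-- The inverse of `1 - b X`. -/
noncomputable def S (h : P.Admissible) : Field₂ →L[ℝ] Field₂ :=
  (h.quasiNilpotent_X.exists_inverse P.b).choose

theorem hasSum_S (h : P.Admissible) (w : Field₂) :
    HasSum (fun n : ℕ => P.b ^ n • (h.X ^ n) w) (h.S w) :=
  (h.quasiNilpotent_X.exists_inverse P.b).choose_spec.1 w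

theorem S_apply_sub (h : P.Admissible) (w : Field₂) : h.S (w - P.b • h.X w) = w :=
  (h.quasiNilpotent_X.exists_inverse P.b).choose_spec.2.1 w

theorem S_sub (h : P.Admissible) (w : Field₂) : h.S w - P.b • h.X (h.S w) = w :=
  (h.quasiNilpotent_X.exists_inverse P.b).choose_spec.2.2.1 w

theorem S_comm (h : P.Admissible) {T : Field₂ →L[ℝ] Field₂} (hT : Commute h.X T) (w : Field₂) :
    T (h.S w) = h.S (T w) :=
  (h.quasiNilpotent_X.exists_inverse P.b).choose_spec.2.2.2 T hT w

theorem timeInt_S (h : P.Admissible) {ε : ℝ} (hε₀ : 0 ≤ ε) (hε : ε < 1) (w : Field₂) :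
    P.timeInt ε hε₀ hε (h.S w) = h.S (P.timeInt ε hε₀ hε w) :=
  h.S_comm (WeakKernel.commute_opT_opX h.q_nonneg h.p_nonneg _ _).symm w

theorem spaceInt_R (h : P.Admissible) {ε : ℝ} (hε₀ : 0 ≤ ε) (hε : ε < 1) (w : Field₂) :
    P.spaceInt ε hε₀ hε (h.R w) = h.R (P.spaceInt ε hε₀ hε w) :=
  h.R_comm (WeakKernel.commute_opT_opX h.q_nonneg h.p_nonneg _ _) w

/-- Multiplication by a function of `x` commutes with the resolvent in `t`. -/
theorem mul_R (h : P.Admissible) {m : Field₂} (hm : ∀ s t x, m (s, clamp P.p x) = m (t, x))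
    (w : Field₂) : m * h.R w = h.R (m * w) := by
  refine h.R_comm (T := ContinuousLinearMap.mul ℝ Field₂ m) ?_ w
  refine ContinuousLinearMap.ext fun y => BoundedContinuousFunction.ext fun ⟨t, x⟩ => ?_
  change h.I (m * y) (t, x) = m (t, x) * h.I y (t, x)
  rw [I, fracInt, WeakKernel.opT_apply, WeakKernel.opT_apply, ← WeakKernel.conv_const_mul]
  refine WeakKernel.conv_congr _ (clamp_nonneg _ _) fun η _ => ?_
  rw [BoundedContinuousFunction.coe_mul, Pi.mul_apply, hm η t x]

/-- This identifies the factor multiplying `τ(x)` in the formula, and hence the constant `A`. -/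
theorem R_one (h : P.Admissible) {t : ℝ} (ht : t ∈ Icc 0 P.q) (x : ℝ) :
    h.R 1 (t, x) = 1 + P.a * Real.Gamma P.γ * t ^ P.β * P.kernelE t := by
  have h1 : HasSum (fun n : ℕ => P.a ^ n * (h.I ^ n) 1 (t, x)) (h.R 1 (t, x)) :=
    (h.hasSum_R 1).mapL (BoundedContinuousFunction.evalCLM ℝ (t, x))
  refine h1.unique ?_
  rw [← hasSum_nat_add_iff' 1]
  have h2 := (h.hasSum_kernelE t).mul_left (P.a * t ^ P.β)
  have e : 1 + P.a * Real.Gamma P.γ * t ^ P.β * P.kernelE t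
      - ∑ i ∈ Finset.range 1, P.a ^ i * (h.I ^ i) 1 (t, x)
      = P.a * t ^ P.β * (Real.Gamma P.γ * P.kernelE t) := by
    simp
    ring
  rw [e]
  refine (congrArg (fun f => HasSum f _) (funext fun n => ?_)).mp h2
  rw [h.I_pow_succ_one n ht, timeMoment, mul_pow, pow_succ]
  ring

theorem S_apply_of_const (h : P.Admissible) {w : Field₂} {y : ℝ → ℝ}
    (hw : ∀ t ∈ Icc 0 P.q, ∀ x ∈ Icc 0 P.p, w (t, x) = y t) {t x : ℝ}
    (ht : t ∈ Icc 0 P.q) (hx : x ∈ Icc 0 P.p) :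
    h.S w (t, x) = Real.exp (P.b * x) * y t := by
  have h1 : HasSum (fun n : ℕ => P.b ^ n * (h.X ^ n) w (t, x)) (h.S w (t, x)) :=
    (h.hasSum_S w).mapL (BoundedContinuousFunction.evalCLM ℝ (t, x))
  refine h1.unique ?_
  have h0 : HasSum (fun j : ℕ => (P.b * x) ^ j / (j.factorial : ℝ)) (Real.exp (P.b * x)) := by
    rw [Real.exp_eq_exp_ℝ]; exact NormedSpace.expSeries_div_hasSum_exp _
  refine (congrArg (fun f => HasSum f _) (funext fun j => ?_)).mp (h0.mul_right (y t))
  rw [h.X_pow_apply_of_const hw j ht hx, mul_pow]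
  ring

/-- If `w` has an `x`-derivative, then so does `(1 - b X)⁻¹ w`. -/
theorem hasDerivAt_S (h : P.Admissible) {w : Field₂} {t x d : ℝ} (ht : t ∈ Ioo 0 P.q)
    (hx : x ∈ Ioo 0 P.p) (hd : HasDerivAt (fun y => w (t, y)) d x) :
    HasDerivAt (fun y => h.S w (t, y)) (d + P.b * h.S w (t, x)) x := by
  have h1 := hasDerivAt_spaceInt le_rfl zero_lt_one (h.S w) (Ioo_subset_Icc_self ht) hx
  rw [neg_zero, Real.rpow_zero, one_mul] at h1
  refine (hd.add (h1.const_mul P.b)).congr_of_eventuallyEq (Filter.Eventually.of_forall fun y => ?_)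
  have := congrArg (fun v : Field₂ => v (t, y)) (sub_eq_iff_eq_add.1 (h.S_sub w))
  exact this

end Admissible

namespace RegularData

variable {ε₁ ε₂ : ℝ} {f₁ : ℝ → ℝ → ℝ}

/-- The representation formula, with the dependence on `x` made explicit. -/
theorem goursatField_eq_space (h : P.RegularData ε₁ ε₂ f₁) {w : Field₂}
    (hw : ∀ s t x, w (s, clamp P.p x) = w (t, x)) :
    h.goursatField w = h.φField + (w - P.φ 0 • 1) * h.R 1
      + P.b • h.X (h.R (h.goursatField w - w)) + h.XW (h.R (h.IW h.fField)) := by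
  set m := w - P.φ 0 • (1 : Field₂) with hm
  have hmc : ∀ s t x, m (s, clamp P.p x) = m (t, x) := fun s t x =>
    congrArg (· - P.φ 0 * 1) (hw s t x)
  set V := h.goursatField w - w with hV
  have h1 := h.goursatField_sub w
  rw [← hV] at h1
  have hload : h.load w = (h.φField - P.φ 0 • 1) - P.a • h.I (h.φField - P.φ 0 • 1)
      + P.a • h.I m + h.XW (h.IW h.fField) := by
    rw [load, source, h.IW_XW, hm, map_sub, map_sub, smul_sub, smul_sub]
    abel
  -- Only the part in `I` is inverted. `R` commutes with `X`, so `b X V` stays an integral in `x`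
  -- and can be differentiated.
  have h2 : V - P.a • h.I V = (h.φField - P.φ 0 • 1) - P.a • h.I (h.φField - P.φ 0 • 1)
      + P.a • h.I m + h.XW (h.IW h.fField) + P.b • h.X V := by
    rw [← hload, ← h1]
    abel
  have h3 := congrArg h.R h2
  have h4 : h.R (P.a • h.I m) = m * h.R 1 - m := by
    have := h.R_apply_sub m
    rw [map_sub, sub_eq_iff_eq_add] at this
    rw [h.mul_R hmc, mul_one, this]
    abel
  have h5 : h.R (h.X V) = h.X (h.R V) := (h.spaceInt_R _ _ _).symm
  have h6 : h.R (h.XW (h.IW h.fField)) = h.XW (h.R (h.IW h.fField)) := (h.spaceInt_R _ _ _).symm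
  rw [h.R_apply_sub, map_add, map_add, map_add, h.R_apply_sub, h4, map_smul, h5, h6] at h3
  rw [sub_eq_iff_eq_add.1 hV.symm]
  nth_rw 1 [h3]
  rw [hm]
  abel

theorem trace_const (h : P.RegularData ε₁ ε₂ f₁) {τ : ℝ → ℝ} (hτ : ContinuousOn τ (Icc 0 P.p))
    (s t x : ℝ) : h.traceField τ hτ (s, clamp P.p x) = h.traceField τ hτ (t, x) :=
  congrArg τ (clamp_clamp _ _)

theorem goursat_zero (h : P.RegularData ε₁ ε₂ f₁) (τ : ℝ → ℝ) (x : ℝ) :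
    P.goursat τ 0 x = τ x := by
  simp [goursat, Real.zero_rpow h.β_pos.ne']

/-- At `x = 0` the integrals in `x` vanish, and `τ 0 = φ 0` removes the term `(τ - φ(0)) R 1`. -/
theorem goursat_boundary (h : P.RegularData ε₁ ε₂ f₁) {τ : ℝ → ℝ}
    (hτ : ContinuousOn τ (Icc 0 P.p)) (h0 : τ 0 = P.φ 0) {t : ℝ} (ht : t ∈ Icc 0 P.q) :
    P.goursat τ t 0 = P.φ t := by
  have h0p : (0 : ℝ) ∈ Icc 0 P.p := ⟨le_rfl, h.p_nonneg⟩
  rw [h.goursat_eq hτ ht h0p, h.goursatField_eq_space (h.trace_const hτ)]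
  have z1 : ∀ w s, h.X w (s, 0) = 0 := fun w y => WeakKernel.opX_zero_right _ h.p_nonneg _ _
  have z2 : ∀ w s, h.XW w (s, 0) = 0 := fun w y => WeakKernel.opX_zero_right _ h.p_nonneg _ _
  simp only [BoundedContinuousFunction.coe_add, BoundedContinuousFunction.coe_sub,
    BoundedContinuousFunction.coe_mul, BoundedContinuousFunction.coe_one,
    BoundedContinuousFunction.coe_smul, Pi.add_apply, Pi.sub_apply, Pi.mul_apply, smul_eq_mul,
    Pi.one_apply]
  rw [z1, z2, h.traceField_apply hτ ht h0p, h.φField_apply ht h0p, h0]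
  ring

/-- The `x`-derivative of the representation formula. -/
noncomputable def slope (h : P.RegularData ε₁ ε₂ f₁) (τ : ℝ → ℝ)
    (hτ : ContinuousOn τ (Icc 0 P.p)) (z : ℝ × ℝ) : ℝ :=
  deriv τ z.2 * h.R 1 z
    + P.b * h.R (h.goursatField (h.traceField τ hτ) - h.traceField τ hτ) z
    + z.2 ^ (-ε₂) * h.R (h.IW h.fField) z

theorem continuousOn_slope (h : P.RegularData ε₁ ε₂ f₁) {τ : ℝ → ℝ}
    (hτ : ContinuousOn τ (Icc 0 P.p)) (hτ' : ContDiffOn ℝ 1 τ (Ioo 0 P.p)) :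
    ContinuousOn (h.slope τ hτ) P.domain := by
  have h1 : ContinuousOn (fun z : ℝ × ℝ => deriv τ z.2) P.domain :=
    (hτ'.continuousOn_deriv_of_isOpen isOpen_Ioo le_rfl).comp continuousOn_snd fun _ hz => hz.2
  have h2 : ContinuousOn (fun z : ℝ × ℝ => z.2 ^ (-ε₂)) P.domain :=
    ContinuousOn.rpow_const continuousOn_snd fun z hz => Or.inl hz.2.1.ne'
  exact ((h1.mul (h.R 1).continuous.continuousOn).add
    (continuousOn_const.mul (BoundedContinuousFunction.continuous _).continuousOn)).add
    (h2.mul (BoundedContinuousFunction.continuous _).continuousOn)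

/-- `φ` does not depend on `x`, so subtracting it leaves the slope unchanged; the difference is the
field that appears in `rate`. -/
theorem hasDerivAt_goursatField_sub (h : P.RegularData ε₁ ε₂ f₁) {τ : ℝ → ℝ}
    (hτ : ContinuousOn τ (Icc 0 P.p)) (hτ' : ContDiffOn ℝ 1 τ (Ioo 0 P.p)) {t x : ℝ}
    (ht : t ∈ Ioo 0 P.q) (hx : x ∈ Ioo 0 P.p) :
    HasDerivAt (fun y => (h.goursatField (h.traceField τ hτ) - h.φField) (t, y))
      (h.slope τ hτ (t, x)) x := by
  have ht' := Ioo_subset_Icc_self ht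
  set w := h.traceField τ hτ with hw
  set V := h.goursatField w - w with hV
  have d1 := hasDerivAt_spaceInt le_rfl zero_lt_one (h.R V) ht' hx
  rw [neg_zero, Real.rpow_zero, one_mul] at d1
  have d2 := hasDerivAt_spaceInt h.ε₂_nonneg h.ε₂_lt (h.R (h.IW h.fField)) ht' hx
  have d3 : HasDerivAt τ (deriv τ x) x :=
    ((hτ'.differentiableOn one_ne_zero).differentiableAt (isOpen_Ioo.mem_nhds hx)).hasDerivAt
  refine ((((d3.sub_const (P.φ 0)).mul_const (h.R 1 (t, x))).add (d1.const_mul P.b)).add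
    d2).congr_of_eventuallyEq ?_
  filter_upwards [Ioo_mem_nhds hx.1 hx.2] with y hy
  have hy' := Ioo_subset_Icc_self hy
  rw [h.goursatField_eq_space (h.trace_const hτ)]
  simp only [BoundedContinuousFunction.coe_add, BoundedContinuousFunction.coe_sub,
    BoundedContinuousFunction.coe_mul, BoundedContinuousFunction.coe_one,
    BoundedContinuousFunction.coe_smul, Pi.add_apply, Pi.sub_apply, Pi.mul_apply, smul_eq_mul,
    Pi.one_apply]
  rw [h.traceField_apply hτ ht' hy', h.R_one ht', h.R_one ht']
  simp only [hV, XW, Admissible.X, hw]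
  ring

/-- The time derivative of the convolution of `φ - φ(0)` with the kernel of the
Caputo-Prabhakar derivative. -/
noncomputable def boundaryRate (h : P.RegularData ε₁ ε₂ f₁) (t : ℝ) : ℝ :=
  deriv ((prabhakarKernel P.β P.δ h.β_lt_one).conv fun s => P.φ s - P.φ 0) t

/-- The Caputo-Prabhakar derivative of the representation formula. -/
noncomputable def rate (h : P.RegularData ε₁ ε₂ f₁) (w : Field₂) (z : ℝ × ℝ) : ℝ :=
  Real.exp (P.b * z.2) * h.boundaryRate z.1 + P.a * h.S (h.goursatField w - h.φField) z
    + z.1 ^ (-ε₁) * h.S (h.XW h.fField) z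

/-- After applying `K`, only the part in `X` is inverted, by `S`. Everything but the term in `φ` is
then an integral in `t`, so the time derivative can be read off. -/
theorem K_goursatField_sub (h : P.RegularData ε₁ ε₂ f₁) (w : Field₂) :
    h.K (h.goursatField w - w) = h.S (h.K (h.φField - P.φ 0 • 1))
      + P.a • h.J (h.S (h.goursatField w - h.φField)) + h.JW (h.S (h.XW h.fField)) := by
  have h1 := h.goursatField_sub w
  generalize hV : h.goursatField w - w = V at h1 ⊢
  have hU : h.goursatField w = V + w := by rw [← hV]; abel
  have hsrc : h.K h.source = h.JW (h.XW h.fField) := h.K_IW _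
  have h2 : h.K V - P.b • h.X (h.K V) = h.K (h.φField - P.φ 0 • 1)
      + P.a • h.J (h.goursatField w - h.φField) + h.JW (h.XW h.fField) := by
    have h3 := congrArg h.K h1
    rw [load, map_sub, map_sub, map_add, map_sub, map_add, map_sub, map_smul, map_smul, map_smul,
      map_smul, map_smul, h.K_I, h.K_I, h.K_I, h.K_X, hsrc] at h3
    have h4 := congrArg (fun v => v + P.a • h.J V) h3
    rw [hU, map_sub, map_sub, map_add, map_smul]
    refine Eq.trans ?_ (h4.trans ?_)
    · abel
    · rw [smul_sub, smul_add]
      abel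
  have h5 := congrArg h.S h2
  rw [h.S_apply_sub, map_add, map_add, map_smul] at h5
  rw [h5]
  have e1 : h.S (h.J (h.goursatField w - h.φField)) = h.J (h.S (h.goursatField w - h.φField)) :=
    (h.timeInt_S _ _ _).symm
  have e2 : h.S (h.JW (h.XW h.fField)) = h.JW (h.S (h.XW h.fField)) := (h.timeInt_S _ _ _).symm
  rw [e1, e2]

theorem boundaryRate_spec (h : P.RegularData ε₁ ε₂ f₁) (hφ' : ContDiffOn ℝ 1 P.φ (Ioo 0 P.q))
    {t : ℝ} (ht : t ∈ Ioo 0 P.q) :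
    HasDerivAt ((prabhakarKernel P.β P.δ h.β_lt_one).conv fun s => P.φ s - P.φ 0)
      (h.boundaryRate t) t ∧ ContinuousAt h.boundaryRate t := by
  have := contDiff_prabhakar_conv (δ := P.δ) h.β_lt_one (h.φ_cont.sub continuousOn_const)
    (hφ'.sub contDiffOn_const : ContDiffOn ℝ 1 (fun s => P.φ s - P.φ 0) _) ht
  exact ⟨this.1.hasDerivAt, this.2⟩

theorem hasDerivAt_K_goursatField (h : P.RegularData ε₁ ε₂ f₁)
    (hφ' : ContDiffOn ℝ 1 P.φ (Ioo 0 P.q)) (w : Field₂) {t x : ℝ} (ht : t ∈ Ioo 0 P.q)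
    (hx : x ∈ Ioo 0 P.p) :
    HasDerivAt (fun s => h.K (h.goursatField w - w) (s, x)) (h.rate w (t, x)) t := by
  have hx' := Ioo_subset_Icc_self hx
  have d1 := hasDerivAt_timeInt le_rfl zero_lt_one (h.S (h.goursatField w - h.φField)) ht hx'
  rw [neg_zero, Real.rpow_zero, one_mul] at d1
  have d2 := hasDerivAt_timeInt h.ε₁_nonneg h.ε₁_lt_one (h.S (h.XW h.fField)) ht hx'
  refine ((((h.boundaryRate_spec hφ' ht).1.const_mul (Real.exp (P.b * x))).add
    (d1.const_mul P.a)).add d2).congr_of_eventuallyEq ?_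
  filter_upwards [Ioo_mem_nhds ht.1 ht.2] with s hs
  have hs' := Ioo_subset_Icc_self hs
  rw [h.K_goursatField_sub]
  have e : h.S (h.K (h.φField - P.φ 0 • 1)) (s, x) = Real.exp (P.b * x) *
      (prabhakarKernel P.β P.δ h.β_lt_one).conv (fun s => P.φ s - P.φ 0) s := by
    refine h.S_apply_of_const (fun r hr y hy => ?_) hs' hx'
    rw [Admissible.K, WeakKernel.opT_apply, clamp_of_mem hr, clamp_of_mem hy]
    refine WeakKernel.conv_congr _ hr.1 fun η hη => ?_
    rw [← h.φField_apply ⟨hη.1, hη.2.trans hr.2⟩ hy]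
    simp
  simp only [BoundedContinuousFunction.coe_add, BoundedContinuousFunction.coe_smul, Pi.add_apply,
    smul_eq_mul]
  rw [e]
  rfl

theorem continuousOn_rate (h : P.RegularData ε₁ ε₂ f₁) (hφ' : ContDiffOn ℝ 1 P.φ (Ioo 0 P.q))
    (w : Field₂) : ContinuousOn (h.rate w) P.domain := by
  have h1 : ContinuousOn h.boundaryRate (Ioo 0 P.q) := fun t ht =>
    (h.boundaryRate_spec hφ' ht).2.continuousWithinAt
  have h2 : ContinuousOn (fun z : ℝ × ℝ => h.boundaryRate z.1) P.domain :=
    h1.comp continuousOn_fst fun _ hz => hz.1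
  have h3 : ContinuousOn (fun z : ℝ × ℝ => z.1 ^ (-ε₁)) P.domain :=
    ContinuousOn.rpow_const continuousOn_fst fun z hz => Or.inl hz.1.1.ne'
  have h4 : Continuous fun z : ℝ × ℝ => Real.exp (P.b * z.2) := by fun_prop
  exact ((h4.continuousOn.mul h2).add
    (continuousOn_const.mul (BoundedContinuousFunction.continuous _).continuousOn)).add
    (h3.mul (BoundedContinuousFunction.continuous _).continuousOn)

/-- Differentiating `S w` or the exponential reproduces it with the factor `b`. The derivatives of
the arguments of `S` supply `a` times the slope and the source, so this is the differential
equation. -/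
theorem hasDerivAt_rate_x (h : P.RegularData ε₁ ε₂ f₁) {τ : ℝ → ℝ}
    (hτ : ContinuousOn τ (Icc 0 P.p)) (hτ' : ContDiffOn ℝ 1 τ (Ioo 0 P.p)) {t x : ℝ}
    (ht : t ∈ Ioo 0 P.q) (hx : x ∈ Ioo 0 P.p) :
    HasDerivAt (fun y => h.rate (h.traceField τ hτ) (t, y))
      (P.a * h.slope τ hτ (t, x) + P.b * h.rate (h.traceField τ hτ) (t, x) + P.f t x) x := by
  have d1 := h.hasDerivAt_S ht hx (h.hasDerivAt_goursatField_sub hτ hτ' ht hx)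
  have d2 := h.hasDerivAt_S ht hx
    (hasDerivAt_spaceInt h.ε₂_nonneg h.ε₂_lt h.fField (Ioo_subset_Icc_self ht) hx)
  have d3 : HasDerivAt (fun y : ℝ => Real.exp (P.b * y)) (Real.exp (P.b * x) * (P.b * 1)) x :=
    ((hasDerivAt_id x).const_mul P.b).exp
  refine (((d3.mul_const (h.boundaryRate t)).add (d1.const_mul P.a)).add
    (d2.const_mul (t ^ (-ε₁)))).congr_deriv ?_
  rw [h.f_eq (t, x) ⟨ht, hx⟩,
    h.fField_apply (Ioo_subset_Icc_self ht) (Ioo_subset_Icc_self hx)]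
  simp only [rate, XW]
  ring

theorem goursat_eventuallyEq (h : P.RegularData ε₁ ε₂ f₁) {τ : ℝ → ℝ}
    (hτ : ContinuousOn τ (Icc 0 P.p)) {t x : ℝ} (ht : t ∈ Ioo 0 P.q) (hx : x ∈ Ioo 0 P.p) :
    (fun y => P.goursat τ t y) =ᶠ[nhds x]
      fun y => (h.goursatField (h.traceField τ hτ) - h.φField) (t, y) + P.φ t := by
  filter_upwards [Ioo_mem_nhds hx.1 hx.2] with y hy
  rw [h.goursat_eq hτ (Ioo_subset_Icc_self ht) (Ioo_subset_Icc_self hy),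
    ← h.φField_apply (Ioo_subset_Icc_self ht) (Ioo_subset_Icc_self hy)]
  exact (sub_add_cancel _ _).symm

theorem hasDerivAt_primitive_goursat (h : P.RegularData ε₁ ε₂ f₁)
    (hφ' : ContDiffOn ℝ 1 P.φ (Ioo 0 P.q)) {τ : ℝ → ℝ}
    (hτ : ContinuousOn τ (Icc 0 P.p)) {t x : ℝ} (ht : t ∈ Ioo 0 P.q) (hx : x ∈ Ioo 0 P.p) :
    HasDerivAt (caputoPrabhakarPrimitive P.α P.β P.γ P.δ fun s => P.goursat τ s x)
      (h.rate (h.traceField τ hτ) (t, x)) t := by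
  have hx' := Ioo_subset_Icc_self hx
  refine (h.hasDerivAt_K_goursatField hφ' (h.traceField τ hτ) ht hx).congr_of_eventuallyEq ?_
  filter_upwards [Ioo_mem_nhds ht.1 ht.2] with s hs
  refine h.primitive_eq (Ioo_subset_Icc_self hs) hx' fun r hr => ?_
  rw [h.goursat_eq hτ hr hx', h.goursat_zero, ← h.traceField_apply hτ hr hx']
  rfl

/-- The representation formula gives a regular solution if it satisfies the two conditions. -/
theorem isRegularSolution_goursat (h : P.RegularData ε₁ ε₂ f₁)
    (hφ' : ContDiffOn ℝ 1 P.φ (Ioo 0 P.q)) {τ : ℝ → ℝ} (hτ : ContinuousOn τ (Icc 0 P.p))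
    (hτ' : ContDiffOn ℝ 1 τ (Ioo 0 P.p)) (h0 : τ 0 = P.φ 0)
    (hnl : ∀ x ∈ Icc 0 P.p, τ x - ∫ t in (0 : ℝ)..P.q, P.M t * P.goursat τ t x = P.ψ x) :
    P.IsRegularSolution (P.goursat τ) := by
  have hdx : ∀ z ∈ P.domain,
      HasDerivAt (fun y => P.goursat τ z.1 y) (h.slope τ hτ z) z.2 := fun z hz =>
    ((h.hasDerivAt_goursatField_sub hτ hτ' hz.1 hz.2).add_const _).congr_of_eventuallyEq
      (h.goursat_eventuallyEq hτ hz.1 hz.2)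
  have hD : ∀ z ∈ P.domain, P.D (P.goursat τ) z.1 z.2 = h.rate (h.traceField τ hτ) z :=
    fun z hz => (h.hasDerivAt_primitive_goursat hφ' hτ hz.1 hz.2).deriv
  have hDx : ∀ z ∈ P.domain, HasDerivAt (fun y => P.D (P.goursat τ) z.1 y)
      (P.a * h.slope τ hτ z + P.b * h.rate (h.traceField τ hτ) z + P.f z.1 z.2) z.2 := by
    intro z hz
    refine (h.hasDerivAt_rate_x hτ hτ' hz.1 hz.2).congr_of_eventuallyEq ?_
    filter_upwards [Ioo_mem_nhds hz.2.1 hz.2.2] with y hy using hD (z.1, y) ⟨hz.1, hy⟩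
  refine ⟨?_, fun z hz => (hdx z hz).differentiableAt, ?_, ?_, ?_,
    fun z hz => (hDx z hz).differentiableAt, ?_, fun t ht => h.goursat_boundary hτ h0 ht, ?_⟩
  · exact (h.goursatField (h.traceField τ hτ)).continuous.continuousOn.congr fun z hz =>
      h.goursat_eq hτ hz.1 hz.2
  · exact (h.continuousOn_slope hτ hτ').congr fun z hz => (hdx z hz).deriv
  · exact fun z hz => (h.hasDerivAt_primitive_goursat hφ' hτ hz.1 hz.2).differentiableAt
  · exact (h.continuousOn_rate hφ' _).congr hD
  · intro z hz
    rw [(hDx z hz).deriv, (hdx z hz).deriv, hD z hz]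
    ring
  · intro x hx
    rw [h.goursat_zero]
    exact hnl x hx

end RegularData

end TelegraphProblem

/-! ### The nonlocal condition and the Volterra equation -/

namespace TelegraphProblem

variable {P : TelegraphProblem}

namespace Admissible

theorem continuousOn_kernelF₂ (h : P.Admissible) :
    ContinuousOn (fun z : ℝ × ℝ => P.kernelF₂ z.1 z.2) (Icc 0 P.q ×ˢ Icc 0 P.p) := by
  rw [show (fun z : ℝ × ℝ => P.kernelF₂ z.1 z.2) = _ from
    funext fun z => (h.hasSum_kernelF₂ z.1 z.2).tsum_eq.symm]
  refine continuousOn_tsum (fun i => Continuous.continuousOn ?_)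
    (h.summable_bound.mul_right (1 / P.β)) ?_
  · have h1 : Continuous fun z : ℝ × ℝ => z.1 ^ P.β :=
      continuous_fst.rpow_const fun _ => Or.inr h.β_pos.le
    have h2 : Continuous fun z : ℝ × ℝ => expMoment (P.β * (i.1 + 1)) (P.δ * z.1) :=
      (continuous_expMoment (mul_natCast_add_one_pos h.β_pos i.1)).comp (by fun_prop)
    fun_prop
  · rintro ⟨m, j⟩ ⟨t, x⟩ ⟨ht, hx⟩
    exact abs_term_le_seriesBound h.β_pos (abs_choose_div_le m j m) (h.abs_time_le ht)
      (abs_space_le hx) (h.abs_expMoment_le m ht.1)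

theorem continuousOn_kernelF₃ (h : P.Admissible) :
    ContinuousOn (fun z : ℝ × ℝ => P.kernelF₃ z.1 z.2) (Icc 0 P.q ×ˢ Icc 0 P.p) := by
  rw [show (fun z : ℝ × ℝ => P.kernelF₃ z.1 z.2) = _ from
    funext fun z => (h.hasSum_kernelF₃ z.1 z.2).tsum_eq.symm]
  refine continuousOn_tsum (fun i => Continuous.continuousOn ?_)
    (h.summable_bound.mul_right 1) ?_
  · have h1 : Continuous fun z : ℝ × ℝ => z.1 ^ P.β :=
      continuous_fst.rpow_const fun _ => Or.inr h.β_pos.le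
    fun_prop
  · rintro ⟨m, j⟩ ⟨t, x⟩ ⟨ht, hx⟩
    exact abs_term_le_seriesBound h.β_pos (abs_choose_div_succ_le m j (m + 1)) (h.abs_time_le ht)
      (abs_space_le hx) (h.timeTerm_le ht.2 ⟨ht.1, le_rfl⟩).2

/-- The convolution kernel `r ^ (β - 1) F₃(r, x)`. -/
noncomputable def kernel₃ (h : P.Admissible) {x : ℝ} (hx : x ∈ Icc 0 P.p) : WeakKernel where
  s := P.β
  ε := 0
  e r := P.kernelF₃ (clamp P.q r) x
  s_pos := h.β_pos
  ε_nonneg := le_rfl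
  ε_lt_one := zero_lt_one
  ε_lt_s := h.β_pos
  cont := h.continuousOn_kernelF₃.comp_continuous (f := fun r : ℝ => (clamp P.q r, x))
    (by fun_prop) fun r => ⟨clamp_mem h.q_nonneg r, hx⟩

end Admissible

namespace RegularData

variable {ε₁ ε₂ : ℝ} {f₁ : ℝ → ℝ → ℝ}

/-- The kernel whose convolution at `q` is the integral against `M`. -/
noncomputable def momentKernel (h : P.RegularData ε₁ ε₂ f₁) : WeakKernel where
  s := 1
  ε := 0
  e r := P.M (clamp P.q (P.q - r))
  s_pos := one_pos
  ε_nonneg := le_rfl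
  ε_lt_one := zero_lt_one
  ε_lt_s := one_pos
  cont := h.M_cont.comp_continuous (f := fun r : ℝ => clamp P.q (P.q - r)) (by fun_prop)
    fun _ => clamp_mem h.q_nonneg _

theorem momentKernel_conv (h : P.RegularData ε₁ ε₂ f₁) (y : ℝ → ℝ) :
    h.momentKernel.conv y P.q = ∫ t in (0 : ℝ)..P.q, P.M t * y t := by
  refine intervalIntegral.integral_congr fun t ht => ?_
  rw [uIcc_of_le h.q_nonneg] at ht
  simp [momentKernel, clamp_of_mem ht]

/-- The operator whose value at `t = q` is the integral against `M`. -/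
noncomputable def moment (h : P.RegularData ε₁ ε₂ f₁) : Field₂ →L[ℝ] Field₂ :=
  h.momentKernel.opT P.q P.p

theorem moment_apply (h : P.RegularData ε₁ ε₂ f₁) (w : Field₂) {x : ℝ} (hx : x ∈ Icc 0 P.p) :
    h.moment w (P.q, x) = ∫ t in (0 : ℝ)..P.q, P.M t * w (t, x) := by
  rw [moment, WeakKernel.opT_apply, clamp_of_mem ⟨h.q_nonneg, le_rfl⟩, clamp_of_mem hx,
    h.momentKernel_conv]

theorem moment_eq (h : P.RegularData ε₁ ε₂ f₁) {w : Field₂} {y : ℝ → ℝ} {x : ℝ}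
    (hx : x ∈ Icc 0 P.p) (hw : ∀ t ∈ Icc 0 P.q, w (t, x) = y t) :
    h.moment w (P.q, x) = ∫ t in (0 : ℝ)..P.q, P.M t * y t := by
  rw [h.moment_apply w hx]
  refine intervalIntegral.integral_congr fun t ht => ?_
  rw [uIcc_of_le h.q_nonneg] at ht
  rw [hw t ht]

/-- The function `t ^ β F₂(t, x)` on the rectangle. -/
noncomputable def F₂Field (h : P.RegularData ε₁ ε₂ f₁) : Field₂ :=
  liftField h.q_nonneg h.p_nonneg (fun t x => t ^ P.β * P.kernelF₂ t x)
    ((continuousOn_fst.rpow_const fun _ _ => Or.inr h.β_pos.le).mul h.continuousOn_kernelF₂)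

theorem F₂Field_apply (h : P.RegularData ε₁ ε₂ f₁) {t x : ℝ} (ht : t ∈ Icc 0 P.q)
    (hx : x ∈ Icc 0 P.p) : h.F₂Field (t, x) = t ^ P.β * P.kernelF₂ t x :=
  liftField_of_mem _ _ (fun t x => t ^ P.β * P.kernelF₂ t x) _ ht hx

/-- `M₁` depends on `x - ξ` alone and is a slice of a continuous field, so the Volterra operator is
a convolution without singularity. -/
theorem M₁_eq (h : P.RegularData ε₁ ε₂ f₁) {ξ x : ℝ} (hx : x - ξ ∈ Icc 0 P.p) :
    P.M₁ ξ x = h.moment h.F₂Field (P.q, x - ξ) := by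
  rw [h.moment_eq hx fun t ht => h.F₂Field_apply ht hx, M₁]
  simp_rw [mul_assoc]

theorem A_eq (h : P.RegularData ε₁ ε₂ f₁) {x : ℝ} (hx : x ∈ Icc 0 P.p) :
    P.A = 1 - h.moment (h.R 1) (P.q, x) := by
  rw [h.moment_eq hx fun t ht => h.R_one ht x, A]

theorem moment_mul_R_one (h : P.RegularData ε₁ ε₂ f₁) {m : Field₂} {c x : ℝ}
    (hx : x ∈ Icc 0 P.p) (hm : ∀ t ∈ Icc 0 P.q, m (t, x) = c) :
    h.moment (m * h.R 1) (P.q, x) = c * (1 - P.A) := by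
  rw [h.A_eq hx, sub_sub_cancel, h.moment_apply (h.R 1) hx,
    h.moment_eq hx (y := fun t => c * h.R 1 (t, x)) fun t ht => by
      rw [BoundedContinuousFunction.coe_mul, Pi.mul_apply, hm t ht],
    ← intervalIntegral.integral_const_mul]
  refine intervalIntegral.integral_congr fun t _ => ?_
  ring

/-- Subtracting `τ R 1`, whose moment is `τ(x) (1 - A)`, leaves only the integral with `F₂`; Fubini
turns its moment into the integral with `M₁`. -/
theorem moment_trace (h : P.RegularData ε₁ ε₂ f₁) {τ : ℝ → ℝ} (hτ : ContinuousOn τ (Icc 0 P.p))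
    {x : ℝ} (hx : x ∈ Icc 0 P.p) :
    h.moment (h.traceField τ hτ) (P.q, x) + P.a * h.moment (h.N (h.I (h.traceField τ hτ))) (P.q, x)
      = τ x * (1 - P.A) + P.a * P.b * ∫ ξ in (0 : ℝ)..x, τ ξ * P.M₁ ξ x := by
  set w := h.traceField τ hτ with hw
  rw [← h.moment_mul_R_one hx (m := w) fun t ht => h.traceField_apply hτ ht hx]
  have e1 : h.moment (w + P.a • h.N (h.I w) - w * h.R 1) (P.q, x)
      = ∫ t in (0 : ℝ)..P.q, P.M t * (P.a * P.b * t ^ P.β *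
        ∫ ξ in (0 : ℝ)..x, τ ξ * P.kernelF₂ t (x - ξ)) := by
    refine h.moment_eq hx fun t ht => ?_
    have := h.N_I_trace hτ ht hx
    simp only [BoundedContinuousFunction.coe_add, BoundedContinuousFunction.coe_sub,
      BoundedContinuousFunction.coe_mul, BoundedContinuousFunction.coe_smul, Pi.add_apply,
      Pi.sub_apply, Pi.mul_apply, smul_eq_mul]
    rw [this, h.R_one ht, h.traceField_apply hτ ht hx]
    ring
  have hsub : ∀ ξ ∈ Icc 0 x, x - ξ ∈ Icc 0 P.p := fun ξ hξ =>
    ⟨by linarith [hξ.2], by linarith [hξ.1, hx.2]⟩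
  have e2 : ∫ t in (0 : ℝ)..P.q, P.M t * (P.a * P.b * t ^ P.β *
        ∫ ξ in (0 : ℝ)..x, τ ξ * P.kernelF₂ t (x - ξ))
      = P.a * P.b * ∫ t in (0 : ℝ)..P.q, ∫ ξ in (0 : ℝ)..x,
        P.M t * (τ ξ * h.F₂Field (t, x - ξ)) := by
    rw [← intervalIntegral.integral_const_mul]
    refine intervalIntegral.integral_congr fun t ht => ?_
    rw [uIcc_of_le h.q_nonneg] at ht
    rw [intervalIntegral.integral_const_mul]
    have : ∫ ξ in (0 : ℝ)..x, τ ξ * h.F₂Field (t, x - ξ)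
        = t ^ P.β * ∫ ξ in (0 : ℝ)..x, τ ξ * P.kernelF₂ t (x - ξ) := by
      rw [← intervalIntegral.integral_const_mul]
      refine intervalIntegral.integral_congr fun ξ hξ => ?_
      rw [uIcc_of_le hx.1] at hξ
      rw [h.F₂Field_apply ht (hsub ξ hξ)]
      ring
    rw [this]
    ring
  have hcont : ContinuousOn (Function.uncurry fun t ξ => P.M t * (τ ξ * h.F₂Field (t, x - ξ)))
      (uIcc 0 P.q ×ˢ uIcc 0 x) := by
    rw [uIcc_of_le h.q_nonneg, uIcc_of_le hx.1]
    refine (h.M_cont.comp continuousOn_fst fun z hz => hz.1).mul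
      (ContinuousOn.mul ?_ (h.F₂Field.continuous.comp (by fun_prop)).continuousOn)
    exact hτ.comp continuousOn_snd fun z hz => ⟨hz.2.1, hz.2.2.trans hx.2⟩
  have e3 : ∫ t in (0 : ℝ)..P.q, ∫ ξ in (0 : ℝ)..x, P.M t * (τ ξ * h.F₂Field (t, x - ξ))
      = ∫ ξ in (0 : ℝ)..x, τ ξ * P.M₁ ξ x := by
    rw [intervalIntegral_intervalIntegral_swap
      ((hcont.integrableOn_compact (isCompact_uIcc.prod isCompact_uIcc)).mono_set
        (prod_mono uIoc_subset_uIcc uIoc_subset_uIcc))]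
    refine intervalIntegral.integral_congr fun ξ hξ => ?_
    rw [uIcc_of_le hx.1] at hξ
    rw [h.M₁_eq (hsub ξ hξ), h.moment_apply _ (hsub ξ hξ), ← intervalIntegral.integral_const_mul]
    refine intervalIntegral.integral_congr fun t _ => ?_
    ring
  rw [e2, e3, map_sub, map_add, map_smul] at e1
  simp only [BoundedContinuousFunction.coe_add, BoundedContinuousFunction.coe_sub,
    BoundedContinuousFunction.coe_smul, Pi.add_apply, Pi.sub_apply, smul_eq_mul] at e1
  linarith

/-- Integration against `M` is convolution with `r ↦ M (q - r)` evaluated at `q`. The interchange of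
integrals is then the composition rule `conv_conv` for two kernels. -/
theorem moment_boundary (h : P.RegularData ε₁ ε₂ f₁) {x : ℝ} (hx : x ∈ Icc 0 P.p) :
    P.b * h.moment (h.N (h.X h.φField)) (P.q, x)
      = (Real.exp (P.b * x) - 1) * h.moment h.φField (P.q, x)
        + P.a * P.b * x * ∫ η in (0 : ℝ)..P.q, P.φ η *
          ∫ t in η..P.q, P.M t * (t - η) ^ (P.β - 1) * P.kernelF₃ (t - η) x := by
  have e1 : h.moment (P.b • h.N (h.X h.φField) - (Real.exp (P.b * x) - 1) • h.φField) (P.q, x)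
      = ∫ t in (0 : ℝ)..P.q, P.M t * (P.a * P.b * x *
        ∫ η in (0 : ℝ)..t, (t - η) ^ (P.β - 1) * P.φ η * P.kernelF₃ (t - η) x) := by
    refine h.moment_eq hx fun t ht => ?_
    have := h.N_X_φ ht hx
    simp only [BoundedContinuousFunction.coe_sub, BoundedContinuousFunction.coe_smul,
      Pi.sub_apply, smul_eq_mul]
    rw [this, h.φField_apply ht hx]
    ring
  set k := h.kernel₃ hx with hk
  have e2 : ∀ t ∈ Icc 0 P.q,
      ∫ η in (0 : ℝ)..t, (t - η) ^ (P.β - 1) * P.φ η * P.kernelF₃ (t - η) x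
        = k.conv P.φ t := by
    intro t ht
    refine intervalIntegral.integral_congr fun η hη => ?_
    rw [uIcc_of_le ht.1] at hη
    have : t - η ∈ Icc 0 P.q := ⟨by linarith [hη.2], by linarith [hη.1, ht.2]⟩
    simp only [hk, Admissible.kernel₃, clamp_of_mem this, neg_zero, Real.rpow_zero]
    ring
  have e3 : ∫ t in (0 : ℝ)..P.q, P.M t * (P.a * P.b * x *
        ∫ η in (0 : ℝ)..t, (t - η) ^ (P.β - 1) * P.φ η * P.kernelF₃ (t - η) x)
      = P.a * P.b * x * h.momentKernel.conv (k.conv P.φ) P.q := by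
    rw [h.momentKernel_conv, ← intervalIntegral.integral_const_mul]
    refine intervalIntegral.integral_congr fun t ht => ?_
    rw [uIcc_of_le h.q_nonneg] at ht
    rw [e2 t ht]
    ring
  have e4 : h.momentKernel.conv (k.conv P.φ) P.q = ∫ η in (0 : ℝ)..P.q, P.φ η *
          ∫ t in η..P.q, P.M t * (t - η) ^ (P.β - 1) * P.kernelF₃ (t - η) x := by
    rw [h.momentKernel.conv_conv k rfl h.q_nonneg h.φ_cont]
    refine intervalIntegral.integral_congr fun η hη => ?_
    rw [uIcc_of_le h.q_nonneg] at hη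
    have hsub := intervalIntegral.integral_comp_sub_right (a := η) (b := P.q)
      (fun v => P.M (v + η) * v ^ (P.β - 1) * P.kernelF₃ v x) η
    simp only [sub_add_cancel, sub_self] at hsub
    rw [hsub, mul_comm]
    congr 1
    · simp [hk, Admissible.kernel₃]
    · refine intervalIntegral.integral_congr fun v hv => ?_
      rw [uIcc_of_le (sub_nonneg.2 hη.2)] at hv
      have h1 : v ∈ Icc 0 P.q := ⟨hv.1, by linarith [hv.2, hη.1]⟩
      have h2 : v + η ∈ Icc 0 P.q := ⟨by linarith [hv.1, hη.1], by linarith [hv.2]⟩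
      simp only [momentKernel, hk, Admissible.kernel₃, clamp_of_mem h1,
        show P.q - (P.q - η - v) = v + η by ring, clamp_of_mem h2, sub_self, Real.rpow_zero]
      ring
  rw [e3, e4, map_sub, map_smul, map_smul] at e1
  simp only [BoundedContinuousFunction.coe_sub, BoundedContinuousFunction.coe_smul,
    Pi.sub_apply, smul_eq_mul] at e1
  linarith

theorem moment_N_one (h : P.RegularData ε₁ ε₂ f₁) {x : ℝ} (hx : x ∈ Icc 0 P.p) :
    h.moment (h.N 1) (P.q, x) = Real.exp (P.b * x) * h.moment 1 (P.q, x)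
      + P.a * ∫ t in (0 : ℝ)..P.q, P.M t * t ^ P.β * P.kernelF₁ t x := by
  have e1 : h.moment (h.N 1 - Real.exp (P.b * x) • 1) (P.q, x)
      = ∫ t in (0 : ℝ)..P.q, P.M t * (P.a * t ^ P.β * P.kernelF₁ t x) := by
    refine h.moment_eq hx fun t ht => ?_
    simp [h.N_one ht hx]
  have e2 : ∫ t in (0 : ℝ)..P.q, P.M t * (P.a * t ^ P.β * P.kernelF₁ t x)
      = P.a * ∫ t in (0 : ℝ)..P.q, P.M t * t ^ P.β * P.kernelF₁ t x := by
    rw [← intervalIntegral.integral_const_mul]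
    refine intervalIntegral.integral_congr fun t _ => ?_
    ring
  rw [e2, map_sub, map_smul] at e1
  simp only [BoundedContinuousFunction.coe_sub, BoundedContinuousFunction.coe_smul,
    Pi.sub_apply, smul_eq_mul] at e1
  linarith

theorem moment_goursatField (h : P.RegularData ε₁ ε₂ f₁) {τ : ℝ → ℝ}
    (hτ : ContinuousOn τ (Icc 0 P.p)) {x : ℝ} (hx : x ∈ Icc 0 P.p) :
    h.moment (h.goursatField (h.traceField τ hτ)) (P.q, x)
      = τ x * (1 - P.A) + P.a * P.b * (∫ ξ in (0 : ℝ)..x, τ ξ * P.M₁ ξ x) + (P.g x - P.ψ x) := by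
  have e1 := h.moment_trace hτ hx
  have e2 := h.moment_boundary hx
  have e3 := h.moment_N_one hx
  have e4 : h.moment (h.N h.source) (P.q, x)
      = ∫ t in (0 : ℝ)..P.q, P.M t * ∫ η in (0 : ℝ)..t, ∫ ξ in (0 : ℝ)..x,
        (t - η) ^ (P.β - 1) * P.f η ξ * P.kernelF₄ (t - η) (x - ξ) :=
    h.moment_eq hx fun t ht => h.source_integral ht hx
  have e5 : h.moment (h.φField - P.φ 0 • 1) (P.q, x)
      = ∫ t in (0 : ℝ)..P.q, P.M t * (P.φ t - P.φ 0) :=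
    h.moment_eq hx fun t ht => by simp [h.φField_apply ht hx]
  rw [goursatField, map_add, map_sub, map_add, map_add, map_add, map_smul, map_smul, map_smul]
  rw [map_sub, map_smul] at e5
  simp only [BoundedContinuousFunction.coe_add, BoundedContinuousFunction.coe_sub,
    BoundedContinuousFunction.coe_smul, Pi.add_apply, Pi.sub_apply, smul_eq_mul] at e5 ⊢
  rw [g, ← e4, ← e5]
  linear_combination e1 + e2 - P.φ 0 * e3

theorem moment_goursat (h : P.RegularData ε₁ ε₂ f₁) {τ : ℝ → ℝ}
    (hτ : ContinuousOn τ (Icc 0 P.p)) {x : ℝ} (hx : x ∈ Icc 0 P.p) :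
    ∫ t in (0 : ℝ)..P.q, P.M t * P.goursat τ t x
      = h.moment (h.goursatField (h.traceField τ hτ)) (P.q, x) :=
  (h.moment_eq hx fun _ ht => (h.goursat_eq hτ ht hx).symm).symm

/-- Inserting the moments, the condition becomes `A τ(x) - a b ∫ τ M₁ = g(x)`, and `A ≠ 0` allows
division. -/
theorem nonlocal_iff (h : P.RegularData ε₁ ε₂ f₁) (hA : P.A ≠ 0) {τ : ℝ → ℝ}
    (hτ : ContinuousOn τ (Icc 0 P.p)) {x : ℝ} (hx : x ∈ Icc 0 P.p) :
    τ x - (∫ t in (0 : ℝ)..P.q, P.M t * P.goursat τ t x) = P.ψ x ↔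
      τ x - P.a * P.b * (∫ ξ in (0 : ℝ)..x, τ ξ * P.M₂ ξ x) = P.G x := by
  have e : ∫ ξ in (0 : ℝ)..x, τ ξ * P.M₂ ξ x = (∫ ξ in (0 : ℝ)..x, τ ξ * P.M₁ ξ x) / P.A := by
    rw [← intervalIntegral.integral_div]
    refine intervalIntegral.integral_congr fun ξ _ => ?_
    rw [M₂, mul_div_assoc]
  rw [h.moment_goursat hτ hx, h.moment_goursatField hτ hx, e, G]
  field_simp
  constructor <;> intro H <;> linarith

/-- For `τ = 0` the moment of the formula is `g - ψ`, so continuity of `g` follows from that of a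
field. -/
theorem continuousOn_G (h : P.RegularData ε₁ ε₂ f₁) (hψ : ContinuousOn P.ψ (Icc 0 P.p)) :
    ContinuousOn P.G (Icc 0 P.p) := by
  have h0 : ContinuousOn (fun _ : ℝ => (0 : ℝ)) (Icc 0 P.p) := continuousOn_const
  have h1 : Continuous fun x =>
      h.moment (h.goursatField (h.traceField (fun _ => 0) h0)) (P.q, x) :=
    (BoundedContinuousFunction.continuous _).comp (by fun_prop)
  refine ((hψ.add h1.continuousOn).div_const P.A).congr fun x hx => ?_
  simp [G, h.moment_goursatField h0 hx]

/-- The kernel of the Volterra equation. -/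
noncomputable def volterraKernel (h : P.RegularData ε₁ ε₂ f₁) : WeakKernel where
  s := 1
  ε := 0
  e r := h.moment h.F₂Field (P.q, r)
  s_pos := one_pos
  ε_nonneg := le_rfl
  ε_lt_one := zero_lt_one
  ε_lt_s := one_pos
  cont := (BoundedContinuousFunction.continuous _).comp (by fun_prop)

/-- The Volterra operator. -/
noncomputable def volterra (h : P.RegularData ε₁ ε₂ f₁) : Field₂ →L[ℝ] Field₂ :=
  h.volterraKernel.opX P.q P.p

theorem volterra_apply (h : P.RegularData ε₁ ε₂ f₁) {w : Field₂} {σ : ℝ → ℝ} {t x : ℝ}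
    (ht : t ∈ Icc 0 P.q) (hx : x ∈ Icc 0 P.p) (hw : ∀ ξ ∈ Icc 0 P.p, w (t, ξ) = σ ξ) :
    P.a * P.b / P.A * h.volterra w (t, x)
      = P.a * P.b * ∫ ξ in (0 : ℝ)..x, σ ξ * P.M₂ ξ x := by
  rw [div_mul_eq_mul_div, mul_div_assoc, volterra, WeakKernel.opX_apply, clamp_of_mem ht,
    clamp_of_mem hx, WeakKernel.conv, ← intervalIntegral.integral_div]
  congr 1
  refine intervalIntegral.integral_congr fun ξ hξ => ?_
  rw [uIcc_of_le hx.1] at hξ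
  rw [M₂, h.M₁_eq ⟨by linarith [hξ.2], by linarith [hξ.1, hx.2]⟩]
  simp [volterraKernel, hw ξ ⟨hξ.1, hξ.2.trans hx.2⟩]
  ring

/-- The equation is solved for fields that do not depend on `t`, by the Neumann series of a
quasi-nilpotent operator, and the solution is read at `t = 0`. -/
theorem existsUnique_volterra (h : P.RegularData ε₁ ε₂ f₁) (hψ : ContinuousOn P.ψ (Icc 0 P.p)) :
    ∃ τ : ℝ → ℝ, P.SolvesVolterra τ ∧ ∀ σ, P.SolvesVolterra σ → EqOn σ τ (Icc 0 P.p) := by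
  have hq : QuasiNilpotent h.volterra := WeakKernel.quasiNilpotent_opX h.p_nonneg _ rfl rfl
  obtain ⟨T, -, hT, hT', -⟩ := hq.exists_inverse (P.a * P.b / P.A)
  have h0q : (0 : ℝ) ∈ Icc 0 P.q := ⟨le_rfl, h.q_nonneg⟩
  set γ := h.traceField P.G (h.continuousOn_G hψ) with hγ
  refine ⟨fun x => T γ (0, x), ⟨?_, fun x hx => ?_⟩, fun σ hσ x hx => ?_⟩
  · exact ((T γ).continuous.comp (by fun_prop : Continuous fun x : ℝ => ((0 : ℝ), x))).continuousOn
  · have := congrArg (fun v : Field₂ => v (0, x)) (hT' γ)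
    simp only [BoundedContinuousFunction.coe_sub, BoundedContinuousFunction.coe_smul,
      Pi.sub_apply, smul_eq_mul] at this
    rwa [h.volterra_apply h0q hx fun ξ _ => rfl, hγ, h.traceField_apply _ h0q hx] at this
  · have e : h.traceField σ hσ.1 - (P.a * P.b / P.A) • h.volterra (h.traceField σ hσ.1) = γ := by
      refine IsClamped.ext h.q_nonneg h.p_nonneg
        ((h.isClamped_traceField _ _).sub (IsClamped.smul _ (.opX _ _)))
        (h.isClamped_traceField _ _) fun t ht y hy => ?_
      simp only [BoundedContinuousFunction.coe_sub, BoundedContinuousFunction.coe_smul,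
        Pi.sub_apply, smul_eq_mul]
      rw [h.volterra_apply ht hy fun ξ hξ => h.traceField_apply hσ.1 ht hξ,
        h.traceField_apply hσ.1 ht hy, hγ, h.traceField_apply _ ht hy]
      exact hσ.2 y hy
    change σ x = T γ (0, x)
    rw [← e, hT, h.traceField_apply hσ.1 h0q hx]

theorem nonlocal_of_solvesVolterra (h : P.RegularData ε₁ ε₂ f₁) (hA : P.A ≠ 0) {τ : ℝ → ℝ}
    (hτ : P.SolvesVolterra τ) {x : ℝ} (hx : x ∈ Icc 0 P.p) :
    τ x - (∫ t in (0 : ℝ)..P.q, P.M t * P.goursat τ t x) = P.ψ x :=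
  (h.nonlocal_iff hA hτ.1 hx).2 (hτ.2 x hx)

/-- The solution of the Volterra equation inherits the smoothness of `ψ`. -/
theorem contDiffOn_of_solvesVolterra (h : P.RegularData ε₁ ε₂ f₁) (hA : P.A ≠ 0)
    (hψ' : ContDiffOn ℝ 1 P.ψ (Ioo 0 P.p)) {τ : ℝ → ℝ} (hτ : P.SolvesVolterra τ) :
    ContDiffOn ℝ 1 τ (Ioo 0 P.p) := by
  set w := h.traceField τ hτ.1 with hw
  set v := h.moment (h.R (h.goursatField w - w)) with hv
  set s := h.moment (h.R (h.IW h.fField)) with hs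
  have hqm : P.q ∈ Icc 0 P.q := ⟨h.q_nonneg, le_rfl⟩
  -- Solving the nonlocal condition for `τ` in the form with explicit `x`-dependence leaves `ψ`, a
  -- constant and integrals in `x` of continuous, possibly weighted, functions. Continuity of `τ`
  -- thus already yields a derivative.
  have e : ∀ x ∈ Ioo 0 P.p, τ x = (P.ψ x + ((∫ t in (0 : ℝ)..P.q, P.M t * P.φ t)
      - P.φ 0 * (1 - P.A)) + P.b * h.X v (P.q, x) + h.XW s (P.q, x)) / P.A := by
    intro x hx
    have hx' := Ioo_subset_Icc_self hx
    have e1 := h.nonlocal_of_solvesVolterra hA hτ hx'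
    rw [h.moment_goursat hτ.1 hx', h.goursatField_eq_space (h.trace_const hτ.1), map_add, map_add,
      map_add, map_smul] at e1
    have e2 : h.moment (h.X (h.R (h.goursatField w - w))) = h.X v :=
      congrArg (fun T : Field₂ →L[ℝ] Field₂ => T (h.R (h.goursatField w - w)))
        (WeakKernel.commute_opT_opX h.q_nonneg h.p_nonneg h.momentKernel _).eq
    have e3 : h.moment (h.XW (h.R (h.IW h.fField))) = h.XW s :=
      congrArg (fun T : Field₂ →L[ℝ] Field₂ => T (h.R (h.IW h.fField)))
        (WeakKernel.commute_opT_opX h.q_nonneg h.p_nonneg h.momentKernel _).eq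
    have e4 := h.moment_mul_R_one hx' (m := w - P.φ 0 • 1) (c := τ x - P.φ 0) fun t ht => by
      simp [hw, h.traceField_apply hτ.1 ht hx']
    have e5 := h.moment_eq hx' fun t ht => h.φField_apply ht hx'
    rw [e2, e3] at e1
    simp only [BoundedContinuousFunction.coe_add, BoundedContinuousFunction.coe_smul,
      Pi.add_apply, smul_eq_mul] at e1
    rw [e4, e5] at e1
    rw [eq_div_iff hA]
    linarith
  have hd : ∀ x ∈ Ioo 0 P.p, HasDerivAt τ
      ((deriv P.ψ x + P.b * v (P.q, x) + x ^ (-ε₂) * s (P.q, x)) / P.A) x := by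
    intro x hx
    have d1 := hasDerivAt_spaceInt le_rfl zero_lt_one v hqm hx
    rw [neg_zero, Real.rpow_zero, one_mul] at d1
    have d2 := hasDerivAt_spaceInt h.ε₂_nonneg h.ε₂_lt s hqm hx
    have d3 : HasDerivAt P.ψ (deriv P.ψ x) x :=
      ((hψ'.differentiableOn one_ne_zero).differentiableAt (isOpen_Ioo.mem_nhds hx)).hasDerivAt
    refine ((((d3.add_const ((∫ t in (0 : ℝ)..P.q, P.M t * P.φ t) - P.φ 0 * (1 - P.A))).add
      (d1.const_mul P.b)).add d2).div_const P.A).congr_of_eventuallyEq ?_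
    filter_upwards [Ioo_mem_nhds hx.1 hx.2] with y hy using e y hy
  have hc : ContinuousOn (fun x => (deriv P.ψ x + P.b * v (P.q, x) + x ^ (-ε₂) * s (P.q, x)) / P.A)
      (Ioo 0 P.p) := by
    have c1 : ∀ y : Field₂, ContinuousOn (fun x => y (P.q, x)) (Ioo 0 P.p) := fun y =>
      (y.continuous.comp (by fun_prop)).continuousOn
    exact (((hψ'.continuousOn_deriv_of_isOpen isOpen_Ioo le_rfl).add
      (continuousOn_const.mul (c1 v))).add ((ContinuousOn.rpow_const continuousOn_id
        fun x hx => Or.inl (ne_of_gt hx.1)).mul (c1 s))).div_const _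
  rw [show (1 : WithTop ℕ∞) = 0 + 1 from rfl, contDiffOn_succ_iff_deriv_of_isOpen isOpen_Ioo]
  refine ⟨fun x hx => (hd x hx).differentiableAt.differentiableWithinAt, by simp, ?_⟩
  rw [contDiffOn_zero]
  exact hc.congr fun x hx => (hd x hx).deriv

/-- Uniqueness for the Volterra equation identifies traces only on `[0, p]`, and the formula sees no
other values. -/
theorem goursat_congr (h : P.RegularData ε₁ ε₂ f₁) {σ τ : ℝ → ℝ}
    (hσ : ContinuousOn σ (Icc 0 P.p)) (hτ : ContinuousOn τ (Icc 0 P.p))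
    (hστ : EqOn σ τ (Icc 0 P.p)) {t x : ℝ} (ht : t ∈ Icc 0 P.q) (hx : x ∈ Icc 0 P.p) :
    P.goursat σ t x = P.goursat τ t x := by
  have : h.traceField σ hσ = h.traceField τ hτ := BoundedContinuousFunction.ext fun z =>
    hστ (clamp_mem h.p_nonneg z.2)
  rw [h.goursat_eq hσ ht hx, h.goursat_eq hτ ht hx, this]

end RegularData

end TelegraphProblem

/-! ### Existence and uniqueness for the nonlocal problem -/

theorem theorem2 (P : TelegraphProblem)
    (hq : 0 < P.q) (hp : 0 < P.p)
    (hα : P.α = 1) (hβ₀ : 0 < P.β) (hβ₁ : P.β < 1) (hγ : P.γ = P.β)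
    (ha : P.a < 0) (hb : P.b < 0) (hδ : P.δ < 0)
    (hφ : ContinuousOn P.φ (Set.Icc 0 P.q)) (hφ' : ContDiffOn ℝ 1 P.φ (Set.Ioo 0 P.q))
    (hψ : ContinuousOn P.ψ (Set.Icc 0 P.p)) (hψ' : ContDiffOn ℝ 1 P.ψ (Set.Ioo 0 P.p))
    (hM : ContinuousOn P.M (Set.Icc 0 P.q))
    (ε₁ ε₂ : ℝ) (hε₁ : 0 ≤ ε₁) (hε₁' : ε₁ < P.β) (hε₂ : 0 ≤ ε₂) (hε₂' : ε₂ < 1)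
    (f₁ : ℝ → ℝ → ℝ)
    (hf₁ : ContinuousOn (fun z : ℝ × ℝ => f₁ z.1 z.2) P.closedDomain)
    (hf : ∀ z ∈ P.domain, P.f z.1 z.2 = z.1 ^ (-ε₁) * z.2 ^ (-ε₂) * f₁ z.1 z.2)
    (hcompat : P.φ 0 - (∫ t in (0 : ℝ)..P.q, P.M t * P.φ t) = P.ψ 0)
    (hA : P.A ≠ 0) (hG : P.φ 0 = P.G 0) :
    ∃ τ : ℝ → ℝ,
      -- the trace is the unique solution of the Volterra equation
      P.SolvesVolterra τ ∧ ContDiffOn ℝ 1 τ (Set.Ioo 0 P.p) ∧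
      (∀ σ : ℝ → ℝ, P.SolvesVolterra σ → Set.EqOn σ τ (Set.Icc 0 P.p)) ∧
      -- the representation formula with this trace gives a regular solution
      P.IsRegularSolution (P.goursat τ) ∧
      (∀ x ∈ Set.Icc 0 P.p, P.goursat τ 0 x = τ x) ∧
      -- and it is the only one
      ∀ u : ℝ → ℝ → ℝ, P.IsRegularSolution u →
        ∀ z ∈ P.closedDomain, u z.1 z.2 = P.goursat τ z.1 z.2 := by
  have h : P.RegularData ε₁ ε₂ f₁ :=
    { q_pos := hq, p_pos := hp, α_eq := hα, β_pos := hβ₀, β_lt_one := hβ₁, γ_eq := hγ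
      δ_neg := hδ, φ_cont := hφ, M_cont := hM, ε₁_nonneg := hε₁, ε₁_lt := hε₁'
      ε₂_nonneg := hε₂, ε₂_lt := hε₂', f₁_cont := hf₁, f_eq := hf }
  obtain ⟨τ, hτ, huniq⟩ := h.existsUnique_volterra hψ
  have hτ' := h.contDiffOn_of_solvesVolterra hA hψ' hτ
  -- At `x = 0` the Volterra integral is empty, so `τ 0 = G 0`; this makes the trace match the
  -- boundary values at the corner.
  have h0 : τ 0 = P.φ 0 := by
    have := hτ.2 0 ⟨le_rfl, hp.le⟩
    rw [intervalIntegral.integral_same, mul_zero, sub_zero] at this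
    rw [this, hG]
  refine ⟨τ, hτ, hτ', huniq, h.isRegularSolution_goursat hφ' hτ.1 hτ' h0 fun x hx =>
    h.nonlocal_of_solvesVolterra hA hτ hx, fun x _ => h.goursat_zero τ x, fun u hu z hz => ?_⟩
  have hu0 := hu.continuousOn_trace hq.le
  have heq : ∀ t ∈ Set.Icc 0 P.q, ∀ x ∈ Set.Icc 0 P.p, u t x = P.goursat (u 0) t x :=
    fun t ht x hx => h.eq_goursat_of_isRegularSolution hu ht hx
  -- Any regular solution is the formula with its own trace, so its nonlocal condition is the
  -- Volterra equation for `u 0`.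
  have hσ : P.SolvesVolterra (u 0) := by
    refine ⟨hu0, fun x hx => (h.nonlocal_iff hA hu0 hx).1 ?_⟩
    rw [← hu.nonlocal x hx]
    congr 1
    refine intervalIntegral.integral_congr fun t ht => ?_
    rw [Set.uIcc_of_le hq.le] at ht
    rw [heq t ht x hx]
  rw [heq z.1 hz.1 z.2 hz.2]
  exact h.goursat_congr hu0 hτ.1 (huniq _ hσ) hz.1 hz.2
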